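/- Let $p$ be a prime, let $k$ be a finite extension of $\mathbb{Q}_p$ with valuation ring $O_k$ and residue field $\mathbb{F}$, and fix an algebraic closure $\overline{k}$ of $k$. Let $A$ be an abelian variety over $k$ with good reduction, i.e. $A$ is the generic fibre of an abelian scheme $\mathcal{A}$ over $O_k$, and let $\overline{A}$ be its reduction, the special fibre of $\mathcal{A}$. Let $\mathbb{G}_m$ and $A$ also denote the Mackey functors over $k$ given by the $\operatorname{Gal}(\overline{k}/k)$-modules $\overline{k}^{\times}$ and $A(\overline{k})$ (so $\mathbb{G}_m(K)=K^\times$ and $A(K)$ is the group of $K$-rational points, with the usual restrictions and norms, for $K/k$ finite). Let $\widehat{A}\subset A$ be the sub Mackey functor of points of the formal group of $A$, that is, $\widehat{A}(K)=\operatorname{Ker}(A(K)\to\overline{A}(\mathbb{F}_K))$ with $\mathbb{F}_K$ the residue field of $K$, and let $\overline{\mathscr{A}}=A/\widehat{A}$ be the quotient Mackey functor, $\overline{\mathscr{A}}(K)=A(K)/\widehat{A}(K)$. For a Mackey functor $\mathscr{M}$ and $m\ge 1$ put $(\mathscr{M}/m)(K)=\mathscr{M}(K)/m\mathscr{M}(K)$.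 For Mackey functors $\mathscr{M},\mathscr{N}$ over $k$, the value at $k$ of their Mackey product is $$(\mathscr{M}\otimes\mathscr{N})(k)=\Bigl(\bigoplus_{K/k\ \text{finite}}\mathscr{M}(K)\otimes_{\mathbb{Z}}\mathscr{N}(K)\Bigr)\Big/ R,$$ where $R$ is the subgroup generated, for all finite extensions $K/k$ and $L/K$, by the elements $N_{L/K}(x)\otimes y-x\otimes\operatorname{Res}_{L/K}(y)$ with $x\in\mathscr{M}(L)$, $y\in\mathscr{N}(K)$, and $\operatorname{Res}_{L/K}(x)\otimes y-x\otimes N_{L/K}(y)$ with $x\in\mathscr{M}(K)$, $y\in\mathscr{N}(L)$. Then, for every integer $n\ge 1$, there is an isomorphism of abelian groups $$(\mathbb{G}_m/p^n\otimes\overline{\mathscr{A}}/p^n)(k)\;\simeq\;\overline{A}(\mathbb{F})/p^n\overline{A}(\mathbb{F}).$$ -/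

import Mathlib

open CategoryTheory AlgebraicGeometry
open scoped TensorProduct

universe u

/-- A finite field extension of `k`. -/
structure FinExt (k : Type u) [Field k] where
  carrier : Type u
  [field : Field carrier]
  [algebra : Algebra k carrier]
  [finite : FiniteDimensional k carrier]

namespace FinExt

instance (k : Type u) [Field k] : CoeSort (FinExt k) (Type u) := ⟨FinExt.carrier⟩

attribute [instance] FinExt.field FinExt.algebra FinExt.finite

/-- The trivial extension `k/k`. -/
def base (k : Type u) [Field k] : FinExt k := ⟨k⟩

end FinExt

/-- A Mackey functor over `k`.  By additivity it is determined by its values `M(K)` at (spectra of)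
finite field extensions `K/k`.  The base change axiom is the one for a Cartesian square
`Spec (L ⊗_K L') = ∐ Spec E_i`. -/
structure MackeyFunctor (k : Type u) [Field k] where
  obj : FinExt k → Type u
  [addCommGroup : ∀ K, AddCommGroup (obj K)]
  res : ∀ {K L : FinExt k}, (K →ₐ[k] L) → (obj K →+ obj L)
  norm : ∀ {K L : FinExt k}, (K →ₐ[k] L) → (obj L →+ obj K)
  res_id : ∀ (K : FinExt k) (x : obj K), res (AlgHom.id k K) x = x
  res_comp : ∀ {K L E : FinExt k} (f : K →ₐ[k] L) (g : L →ₐ[k] E) (x : obj K),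
    res (g.comp f) x = res g (res f x)
  norm_id : ∀ (K : FinExt k) (x : obj K), norm (AlgHom.id k K) x = x
  norm_comp : ∀ {K L E : FinExt k} (f : K →ₐ[k] L) (g : L →ₐ[k] E) (x : obj E),
    norm (g.comp f) x = norm f (norm g x)
  base_change : ∀ {K L L' : FinExt k} (f : K →ₐ[k] L) (g : K →ₐ[k] L')
    {ι : Type} [Fintype ι] (E : ι → FinExt k) (a : ∀ i, L →ₐ[k] E i) (b : ∀ i, L' →ₐ[k] E i),
    IsPushout (CommRingCat.ofHom f.toRingHom) (CommRingCat.ofHom g.toRingHom)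
      (CommRingCat.ofHom (RingHom.pi fun i => (a i).toRingHom))
      (CommRingCat.ofHom (RingHom.pi fun i => (b i).toRingHom)) →
    ∀ x : obj L, res g (norm f x) = ∑ i, norm (b i) (res (a i) x)

namespace MackeyFunctor

attribute [instance] MackeyFunctor.addCommGroup

variable {k : Type u} [Field k]

/-- A sub Mackey functor. -/
structure Sub (M : MackeyFunctor k) where
  obj : ∀ K, AddSubgroup (M.obj K)
  res_mem : ∀ {K L : FinExt k} (f : K →ₐ[k] L) {x}, x ∈ obj K → M.res f x ∈ obj L
  norm_mem : ∀ {K L : FinExt k} (f : K →ₐ[k] L) {x}, x ∈ obj L → M.norm f x ∈ obj K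

/-- The quotient Mackey functor `M/N`, with values `M(K)/N(K)`. -/
def quotient (M : MackeyFunctor k) (N : M.Sub) : MackeyFunctor k where
  obj K := M.obj K ⧸ N.obj K
  res f := QuotientAddGroup.map _ _ (M.res f) fun _ hx => N.res_mem f hx
  norm f := QuotientAddGroup.map _ _ (M.norm f) fun _ hx => N.norm_mem f hx
  res_id K x := by
    induction x using QuotientAddGroup.induction_on with
    | H x => exact congrArg _ (M.res_id K x)
  res_comp f g x := by
    induction x using QuotientAddGroup.induction_on with
    | H x => exact congrArg _ (M.res_comp f g x)
  norm_id K x := by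
    induction x using QuotientAddGroup.induction_on with
    | H x => exact congrArg _ (M.norm_id K x)
  norm_comp f g x := by
    induction x using QuotientAddGroup.induction_on with
    | H x => exact congrArg _ (M.norm_comp f g x)
  base_change f g _ _ E a b h x := by
    induction x using QuotientAddGroup.induction_on with
    | H x =>
      exact (congrArg (QuotientAddGroup.mk' _) (M.base_change f g E a b h x)).trans
        (map_sum (QuotientAddGroup.mk' _) _ _)

/-- The sub Mackey functor `m M`. -/
def nsmulSub (M : MackeyFunctor k) (m : ℕ) : M.Sub where
  obj K := (nsmulAddMonoidHom (α := M.obj K) m).range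
  res_mem f x := by
    rintro ⟨y, rfl⟩
    exact ⟨M.res f y, by simp⟩
  norm_mem f x := by
    rintro ⟨y, rfl⟩
    exact ⟨M.norm f y, by simp⟩

/-- The Mackey functor `M/m`, with values `M(K)/m M(K)`. -/
def modNat (M : MackeyFunctor k) (m : ℕ) : MackeyFunctor k := M.quotient (M.nsmulSub m)

section GaloisModule

variable {V : Type u} [AddCommGroup V]
  (ρ : Gal(AlgebraicClosure k/k) →* AddMonoid.End V)

/-- The value at `K/k` of the Mackey functor of the `G_k`-module `V`: the `G_k`-equivariant maps
`Hom_k(K, k̄) → V`.  Evaluation at a chosen embedding `K → k̄` identifies this group with the fixed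
submodule `V^{Gal(k̄/K)}`. -/
def galoisObj (K : FinExt k) : AddSubgroup ((K →ₐ[k] AlgebraicClosure k) → V) where
  carrier := {φ | ∀ (σ : Gal(AlgebraicClosure k/k)) (τ : K →ₐ[k] AlgebraicClosure k),
    φ ((σ : AlgebraicClosure k →ₐ[k] AlgebraicClosure k).comp τ) = ρ σ (φ τ)}
  zero_mem' := by intro σ τ; simp
  add_mem' := by intro a b ha hb σ τ; simp [ha σ τ, hb σ τ]
  neg_mem' := by intro a ha σ τ; simp [ha σ τ]

open Classical in
/-- The Mackey functor `K ↦ V^{Gal(k̄/K)}` of a `G_k`-module `V`.  Restrictions are the inclusions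
of fixed submodules, and norms are the sums over the conjugates. -/
noncomputable def ofGaloisModule : MackeyFunctor k where
  obj K := galoisObj ρ K
  res {K L} f :=
    { toFun := fun φ => ⟨fun τ => φ.1 (τ.comp f), fun σ τ => φ.2 σ (τ.comp f)⟩
      map_zero' := rfl
      map_add' := fun _ _ => rfl }
  norm {K L} f :=
    { toFun := fun ψ => ⟨fun τ => ∑ θ : L →ₐ[k] AlgebraicClosure k with θ.comp f = τ, ψ.1 θ, by
        intro σ τ
        rw [map_sum]
        refine (Finset.sum_bij
          (fun θ _ => (σ : AlgebraicClosure k →ₐ[k] AlgebraicClosure k).comp θ) ?_ ?_ ?_ ?_).symm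
        · intro θ hθ
          simp only [Finset.mem_filter, Finset.mem_univ, true_and] at hθ ⊢
          rw [AlgHom.comp_assoc, hθ]
        · intro θ _ θ' _ h
          ext x
          exact σ.injective (DFunLike.congr_fun h x)
        · intro θ hθ
          simp only [Finset.mem_filter, Finset.mem_univ, true_and] at hθ ⊢
          refine ⟨((σ⁻¹ : Gal(AlgebraicClosure k/k)) :
            AlgebraicClosure k →ₐ[k] AlgebraicClosure k).comp θ, ?_, ?_⟩
          · ext x
            have := DFunLike.congr_fun hθ x
            simp only [AlgHom.comp_apply] at this ⊢
            rw [this]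
            exact σ.symm_apply_apply _
          · ext x
            exact σ.apply_symm_apply _
        · intro θ _
          exact (ψ.2 σ θ).symm⟩
      map_zero' := by ext; simp
      map_add' := by intro x y; ext; simp [Finset.sum_add_distrib] }
  res_id K x := rfl
  res_comp f g x := rfl
  norm_id K x := by
    ext τ
    refine (Finset.sum_filter _ _).trans ?_
    rw [Finset.sum_eq_single τ]
    · exact if_pos (AlgHom.comp_id τ)
    · exact fun θ _ hθ => if_neg hθ
    · exact fun h => absurd (Finset.mem_univ τ) h
  norm_comp {K L E} f g x := by
    ext τ
    simp only [AddMonoidHom.coe_mk, ZeroHom.coe_mk]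
    refine (Finset.sum_fiberwise_of_maps_to
      (s := Finset.univ.filter fun θ : E →ₐ[k] AlgebraicClosure k => θ.comp (g.comp f) = τ)
      (t := Finset.univ.filter fun θ : L →ₐ[k] AlgebraicClosure k => θ.comp f = τ)
      (g := fun θ => θ.comp g) ?_ _).symm.trans ?_
    · intro η hη
      simpa [AlgHom.comp_assoc] using hη
    · refine Finset.sum_congr rfl fun θ hθ => Finset.sum_congr ?_ fun _ _ => rfl
      ext η
      simp only [Finset.mem_filter, Finset.mem_univ, true_and] at hθ ⊢
      constructor
      · exact fun h => h.2
      · rintro rfl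
        exact ⟨hθ, rfl⟩
  base_change {K L L'} f g ι _ E a b h x := by
    ext τ
    rw [AddSubgroup.val_finsetSum, Finset.sum_apply]
    simp only [AddMonoidHom.coe_mk, ZeroHom.coe_mk]
    rw [Finset.sum_sigma']
    symm
    have hw : ∀ i, (a i).comp f = (b i).comp g := by
      intro i
      ext z
      exact congrFun (DFunLike.congr_fun (congrArg CommRingCat.Hom.hom h.w) z) i
    refine Finset.sum_bij (fun s _ => s.2.comp (a s.1)) ?_ ?_ ?_ ?_
    · rintro ⟨i, θ⟩ hθ
      simp only [Finset.mem_sigma, Finset.mem_filter, Finset.mem_univ, true_and] at hθ ⊢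
      rw [AlgHom.comp_assoc, hw, ← AlgHom.comp_assoc, hθ]
    · rintro ⟨i, θ⟩ hθ ⟨j, η⟩ hη hij
      simp only [Finset.mem_sigma, Finset.mem_filter, Finset.mem_univ, true_and] at hθ hη hij
      have key : CommRingCat.ofHom (θ.toRingHom.comp (Pi.evalRingHom (fun i => (E i : Type u)) i)) =
          CommRingCat.ofHom (η.toRingHom.comp (Pi.evalRingHom (fun i => (E i : Type u)) j)) := by
        apply h.hom_ext
        · ext z
          exact DFunLike.congr_fun hij z
        · ext z
          exact DFunLike.congr_fun (hθ.trans hη.symm) z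
      have key' : ∀ z : (∀ i, (E i : Type u)), θ (z i) = η (z j) := fun z =>
        DFunLike.congr_fun (congrArg CommRingCat.Hom.hom key) z
      have hi : i = j := by
        by_contra hne
        have := key' (Pi.single i 1)
        rw [Pi.single_eq_same, Pi.single_eq_of_ne (Ne.symm hne)] at this
        simp at this
      subst hi
      congr 1
      ext z
      simpa using key' (Pi.single i z)
    · intro θ hθ
      simp only [Finset.mem_filter, Finset.mem_univ, true_and] at hθ
      have hc : CommRingCat.ofHom f.toRingHom ≫ CommRingCat.ofHom θ.toRingHom =
          CommRingCat.ofHom g.toRingHom ≫ CommRingCat.ofHom τ.toRingHom := by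
        ext z
        exact DFunLike.congr_fun hθ z
      let d : (∀ i, (E i : Type u)) →+* AlgebraicClosure k := (h.desc _ _ hc).hom
      have hd1 : ∀ z : L, d (fun i => a i z) = θ z := fun z =>
        DFunLike.congr_fun (congrArg CommRingCat.Hom.hom (h.inl_desc _ _ hc)) z
      have hd2 : ∀ z : L', d (fun i => b i z) = τ z := fun z =>
        DFunLike.congr_fun (congrArg CommRingCat.Hom.hom (h.inr_desc _ _ hc)) z
      have hone : ∑ i, d (Pi.single i 1) = 1 := by
        rw [← map_sum, Finset.univ_sum_single (fun i => (1 : (E i : Type u)))]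
        exact map_one d
      obtain ⟨i, hi⟩ : ∃ i, d (Pi.single i 1) ≠ 0 := by
        by_contra hcon
        push Not at hcon
        simp [hcon] at hone
      have hi1 : d (Pi.single i 1) = 1 := by
        have : d (Pi.single i 1) * d (Pi.single i 1) = d (Pi.single i 1) := by
          rw [← map_mul, ← Pi.single_mul, one_mul]
        exact mul_left_cancel₀ hi (by rw [this, mul_one])
      have hdi : ∀ z : (∀ i, (E i : Type u)), d z = d (Pi.single i (z i)) := by
        intro z
        have : Pi.single i (z i) = z * Pi.single i 1 := by
          ext j
          by_cases hj : j = i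
          · subst hj; simp
          · simp [hj]
        rw [this, map_mul, hi1, mul_one]
      let η : E i →ₐ[k] AlgebraicClosure k :=
        { toFun := fun z => d (Pi.single i z)
          map_one' := hi1
          map_zero' := by simp
          map_mul' := fun z w => by rw [Pi.single_mul, map_mul]
          map_add' := fun z w => by rw [Pi.single_add, map_add]
          commutes' := fun r => by
            have := hd1 (algebraMap k L r)
            rw [hdi] at this
            simpa using this }
      refine ⟨⟨i, η⟩, ?_, ?_⟩
      · simp only [Finset.mem_sigma, Finset.mem_filter, Finset.mem_univ, true_and]
        ext z
        exact (hdi _).symm.trans (hd2 z)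
      · ext z
        exact (hdi _).symm.trans (hd1 z)
    · intros
      rfl

/-- A `G_k`-stable subgroup `W ⊆ V` gives the sub Mackey functor `K ↦ W^{Gal(k̄/K)}`, consisting of
the equivariant maps with values in `W`. -/
noncomputable def galoisSub (W : AddSubgroup V) (_hW : ∀ σ, ∀ v ∈ W, ρ σ v ∈ W) :
    (ofGaloisModule ρ).Sub where
  obj _ := { carrier := {φ | ∀ τ, φ.1 τ ∈ W}
             zero_mem' := fun _ => W.zero_mem
             add_mem' := fun ha hb τ => W.add_mem (ha τ) (hb τ)
             neg_mem' := fun ha τ => W.neg_mem (ha τ) }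
  res_mem f _ hx τ := hx (τ.comp f)
  norm_mem _ _ hx _ := W.sum_mem fun θ _ => hx θ

end GaloisModule

section Product

variable (M N : MackeyFunctor k) (k' : FinExt k)

/-- The direct sum of the groups `M(K) ⊗ N(K)` over all finite extensions `K/k'`. -/
abbrev ProductGen : Type (u + 1) :=
  DirectSum (Σ K : FinExt k, k' →ₐ[k] K) fun K => M.obj K.1 ⊗[ℤ] N.obj K.1

open Classical in
/-- The element `x ⊗ y` in the summand of `K/k'`, where `K` is an extension of `k'` through `s`. -/
noncomputable def gen {k' : FinExt k} {K : FinExt k} (s : k' →ₐ[k] K) (x : M.obj K) (y : N.obj K) :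
    ProductGen M N k' :=
  DirectSum.of (fun K : (Σ K : FinExt k, k' →ₐ[k] K) => M.obj K.1 ⊗[ℤ] N.obj K.1) ⟨K, s⟩ (x ⊗ₜ[ℤ] y)

/-- The subgroup generated by the relations of the projection formula. -/
def PF : AddSubgroup (ProductGen M N k') :=
  AddSubgroup.closure
    ({z | ∃ (K L : FinExt k) (s : k' →ₐ[k] K) (f : K →ₐ[k] L) (x : M.obj L) (y : N.obj K),
        z = gen M N s (M.norm f x) y - gen M N (f.comp s) x (N.res f y)} ∪
     {z | ∃ (K L : FinExt k) (s : k' →ₐ[k] K) (f : K →ₐ[k] L) (x : M.obj K) (y : N.obj L),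
        z = gen M N (f.comp s) (M.res f x) y - gen M N s x (N.norm f y)})

/-- The value `(M ⊗ N)(k')` of the Mackey product. -/
abbrev Product : Type (u + 1) := ProductGen M N k' ⧸ PF M N k'

end Product

end MackeyFunctor

/-- The Mackey functor `𝔾ₘ`, given by the `G_k`-module `k̄ˣ`. -/
noncomputable def gmMackey (k : Type u) [Field k] : MackeyFunctor k :=
  MackeyFunctor.ofGaloisModule (V := Additive (AlgebraicClosure k)ˣ)
    { toFun := fun σ => (Units.map (σ : AlgebraicClosure k →* AlgebraicClosure k)).toAdditive
      map_one' := rfl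
      map_mul' := fun _ _ => rfl }

open scoped MonObj

section AbelianVariety

/-- An abelian scheme over `S`: a smooth proper group scheme with geometrically integral fibres
(for smooth group schemes of finite type this is the same as geometrically connected fibres).
Over a field, these are the abelian varieties. -/
class IsAbelianScheme {S : Scheme.{u}} (A : Over S) [GrpObj A] : Prop where
  smooth : Smooth A.hom
  proper : IsProper A.hom
  geometricallyIntegral : GeometricallyIntegral A.hom

/-- An abelian variety is a commutative group scheme. -/
lemma IsAbelianScheme.isCommMonObj {k : Type u} [Field k] (A : Over (Spec (.of k))) [GrpObj A]
    [h : IsAbelianScheme A] : IsCommMonObj A := by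
  have := h.proper
  have := h.geometricallyIntegral
  exact isCommMonObj_of_isProper_of_geometricallyIntegral A

/-- The scheme `Spec S` over `Spec R`, for an `R`-algebra `S`. -/
noncomputable abbrev specOver (R S : Type u) [CommRing R] [CommRing S] [Algebra R S] :
    Over (Spec (.of R)) :=
  Over.mk (Spec.map (CommRingCat.ofHom (algebraMap R S)))

/-- The morphism `Spec S' → Spec S` over `Spec R` given by a homomorphism of `R`-algebras. -/
noncomputable abbrev specOverMap {R S S' : Type u} [CommRing R] [CommRing S] [CommRing S']
    [Algebra R S] [Algebra R S'] (f : S →ₐ[R] S') : specOver R S' ⟶ specOver R S :=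
  Over.homMk (Spec.map (CommRingCat.ofHom f.toRingHom)) (by
    dsimp
    rw [← Spec.map_comp, ← CommRingCat.ofHom_comp]
    congr 2
    exact f.comp_algebraMap)

variable {k : Type u} [Field k] (A : Over (Spec (.of k))) [GrpObj A] [IsAbelianScheme A]

/-- The commutative group `A(S)` of `S`-valued points of an abelian variety `A`
over `k`, for a `k`-algebra `S`. -/
def AVPoints (S : Type u) [CommRing S] [Algebra k S] : Type u :=
  Additive (specOver k S ⟶ A)

noncomputable instance (S : Type u) [CommRing S] [Algebra k S] : AddCommGroup (AVPoints A S) :=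
  have := IsAbelianScheme.isCommMonObj A
  inferInstanceAs (AddCommGroup (Additive (specOver k S ⟶ A)))

/-- The map `A(S) → A(S')` induced by a homomorphism of `k`-algebras `S → S'`. -/
noncomputable def AVPoints.map {S S' : Type u} [CommRing S] [CommRing S'] [Algebra k S]
    [Algebra k S'] (f : S →ₐ[k] S') : AVPoints A S →+ AVPoints A S' where
  toFun x := Additive.ofMul (specOverMap f ≫ x.toMul)
  map_zero' := congrArg Additive.ofMul (MonObj.comp_one _)
  map_add' _ _ := congrArg Additive.ofMul (MonObj.comp_mul _ _ _)

/-- The action of `G_k` on `A(k̄)`. -/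
noncomputable def avRep : Gal(AlgebraicClosure k/k) →*
    AddMonoid.End (AVPoints A (AlgebraicClosure k)) where
  toFun σ := AVPoints.map A (σ : AlgebraicClosure k →ₐ[k] AlgebraicClosure k)
  map_one' := by
    ext x
    refine congrArg Additive.ofMul ((congrArg (· ≫ x.toMul) ?_).trans (Category.id_comp x.toMul))
    ext1
    exact Spec.map_id _
  map_mul' := by
    intro σ τ
    ext x
    refine congrArg Additive.ofMul ((congrArg (· ≫ x.toMul) ?_).trans (Category.assoc _ _ x.toMul))
    ext1
    exact Spec.map_comp
      (CommRingCat.ofHom (τ : AlgebraicClosure k →ₐ[k] AlgebraicClosure k).toRingHom)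
      (CommRingCat.ofHom (σ : AlgebraicClosure k →ₐ[k] AlgebraicClosure k).toRingHom)

/-- The Mackey functor of an abelian variety `A`, given by the `G_k`-module `A(k̄)`. -/
noncomputable def avMackey : MackeyFunctor k := MackeyFunctor.ofGaloisModule (avRep A)

end AbelianVariety

section Padic

variable (p : ℕ) [Fact p.Prime]

/-- The valuation ring `O_F` of an algebraic extension `F` of `ℚ_p`: the unit ball of the unique
extension of the `p`-adic absolute value to `F`. -/
noncomputable def padicInt (F : Type u) [Field F] [Algebra ℚ_[p] F] [Algebra.IsAlgebraic ℚ_[p] F] :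
    ValuationSubring F where
  carrier := {x | spectralNorm ℚ_[p] F x ≤ 1}
  zero_mem' := by
    change spectralMulAlgNorm ℚ_[p] F 0 ≤ 1
    simp
  one_mem' := by
    change spectralMulAlgNorm ℚ_[p] F 1 ≤ 1
    simp
  add_mem' {x y} hx hy := (isNonarchimedean_spectralNorm x y).trans (max_le hx hy)
  mul_mem' {x y} hx hy := by
    change spectralMulAlgNorm ℚ_[p] F (x * y) ≤ 1
    rw [map_mul]
    exact mul_le_one₀ hx (spectralNorm_nonneg y) hy
  neg_mem' {x} hx := by
    change spectralMulAlgNorm ℚ_[p] F (-x) ≤ 1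
    rw [map_neg_eq_map]
    exact hx
  mem_or_inv_mem' x := by
    change spectralMulAlgNorm ℚ_[p] F x ≤ 1 ∨ spectralMulAlgNorm ℚ_[p] F x⁻¹ ≤ 1
    by_cases hx : x = 0
    · left; simp [hx]
    · by_contra! h
      have h1 := one_lt_mul_of_le_of_lt h.1.le h.2
      rw [← map_mul, mul_inv_cancel₀ hx, map_one] at h1
      exact lt_irrefl _ h1

variable (k : Type u) [Field k] [Algebra ℚ_[p] k] [FiniteDimensional ℚ_[p] k]

instance : Algebra.IsAlgebraic ℚ_[p] (AlgebraicClosure k) := Algebra.IsAlgebraic.trans ℚ_[p] k _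

/-- The inclusion `O_k → O_k̄`. -/
noncomputable def padicIntMap : padicInt p k →+* padicInt p (AlgebraicClosure k) :=
  ((algebraMap k (AlgebraicClosure k)).comp (padicInt p k).subtype).codRestrict
    (padicInt p (AlgebraicClosure k)) fun x => by
      change spectralNorm ℚ_[p] (AlgebraicClosure k) (algebraMap k (AlgebraicClosure k) x) ≤ 1
      rw [← spectralNorm.eq_of_tower]
      exact x.2

open scoped CategoryTheory.Obj

variable {k}

/-- The morphism `Spec k → Spec O_k`. -/
noncomputable abbrev specFracMap (k : Type u) [Field k] [Algebra ℚ_[p] k]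
    [FiniteDimensional ℚ_[p] k] : Spec (.of k) ⟶ Spec (.of (padicInt p k)) :=
  Spec.map (CommRingCat.ofHom (padicInt p k).subtype)

/-- The residue field `𝔽` of `k`. -/
abbrev padicResidueField (k : Type u) [Field k] [Algebra ℚ_[p] k]
    [FiniteDimensional ℚ_[p] k] : Type u := IsLocalRing.ResidueField (padicInt p k)

/-- The morphism `Spec 𝔽 → Spec O_k`. -/
noncomputable abbrev specResidueMap (k : Type u) [Field k] [Algebra ℚ_[p] k]
    [FiniteDimensional ℚ_[p] k] : Spec (.of (padicResidueField p k)) ⟶ Spec (.of (padicInt p k)) :=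
  Spec.map (CommRingCat.ofHom (IsLocalRing.residue (padicInt p k)))

/-- A model of the abelian variety `A` over `k` witnessing its good reduction: an abelian scheme
`X` over `O_k` with an isomorphism of group schemes `X ×_{O_k} k ≅ A`. -/
structure GoodReduction (A : Over (Spec (.of k))) [GrpObj A] where
  X : Over (Spec (.of (padicInt p k)))
  [grpObj : GrpObj X]
  [isAbelianScheme : IsAbelianScheme X]
  iso : (Over.pullback (specFracMap p k)).obj X ≅ A
  [isMonHom : IsMonHom iso.hom]

namespace GoodReduction

attribute [instance] GoodReduction.grpObj GoodReduction.isAbelianScheme GoodReduction.isMonHom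

variable {p} {A : Over (Spec (.of k))} [GrpObj A] (𝒳 : GoodReduction p A)

/-- The reduction `Ā`: the special fibre of the model. -/
noncomputable abbrev reduction : Over (Spec (.of (padicResidueField p k))) :=
  (Over.pullback (specResidueMap p k)).obj 𝒳.X

/-- The group scheme structure of the special fibre. -/
noncomputable instance : GrpObj 𝒳.reduction := Functor.grpObjObj

instance : IsAbelianScheme 𝒳.reduction where
  smooth := by
    have := 𝒳.isAbelianScheme.smooth
    dsimp; infer_instance
  proper := by
    have := 𝒳.isAbelianScheme.proper
    dsimp; infer_instance
  geometricallyIntegral := by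
    have := 𝒳.isAbelianScheme.geometricallyIntegral
    dsimp; infer_instance

/-- `Spec k̄` over `Spec O_k`. -/
noncomputable abbrev specGeneric (p : ℕ) [Fact p.Prime] (k : Type u) [Field k] [Algebra ℚ_[p] k]
    [FiniteDimensional ℚ_[p] k] : Over (Spec (.of (padicInt p k))) :=
  Over.mk (Spec.map (CommRingCat.ofHom (algebraMap k (AlgebraicClosure k))) ≫ specFracMap p k)

/-- `Spec O_k̄` over `Spec O_k`. -/
noncomputable abbrev specInt (p : ℕ) [Fact p.Prime] (k : Type u) [Field k] [Algebra ℚ_[p] k]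
    [FiniteDimensional ℚ_[p] k] : Over (Spec (.of (padicInt p k))) :=
  Over.mk (Spec.map (CommRingCat.ofHom (padicIntMap p k)))

/-- The spectrum of the residue field of `O_k̄`, over `Spec O_k`. -/
noncomputable abbrev specSpecial (p : ℕ) [Fact p.Prime] (k : Type u) [Field k] [Algebra ℚ_[p] k]
    [FiniteDimensional ℚ_[p] k] : Over (Spec (.of (padicInt p k))) :=
  Over.mk (Spec.map (CommRingCat.ofHom (IsLocalRing.residue (padicInt p (AlgebraicClosure k)))) ≫
    Spec.map (CommRingCat.ofHom (padicIntMap p k)))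

/-- The morphism `Spec k̄ → Spec O_k̄` over `Spec O_k`. -/
noncomputable abbrev specGenericToInt (p : ℕ) [Fact p.Prime] (k : Type u) [Field k]
    [Algebra ℚ_[p] k] [FiniteDimensional ℚ_[p] k] : specGeneric p k ⟶ specInt p k :=
  Over.homMk (V := specInt p k)
    (Spec.map (CommRingCat.ofHom (padicInt p (AlgebraicClosure k)).subtype)) (by
      dsimp
      rw [← Spec.map_comp, ← Spec.map_comp, ← CommRingCat.ofHom_comp, ← CommRingCat.ofHom_comp]
      rfl)

/-- The inclusion of the closed point of `Spec O_k̄`, over `Spec O_k`. -/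
noncomputable abbrev specSpecialToInt (p : ℕ) [Fact p.Prime] (k : Type u) [Field k]
    [Algebra ℚ_[p] k] [FiniteDimensional ℚ_[p] k] : specSpecial p k ⟶ specInt p k :=
  Over.homMk (V := specInt p k)
    (Spec.map (CommRingCat.ofHom (IsLocalRing.residue (padicInt p (AlgebraicClosure k))))) rfl

/-- The group homomorphism `X(O_k̄) → X(k̄)`. -/
noncomputable def toGeneric : (specInt p k ⟶ 𝒳.X) →* (specGeneric p k ⟶ 𝒳.X) where
  toFun y := specGenericToInt p k ≫ y
  map_one' := MonObj.comp_one _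
  map_mul' _ _ := MonObj.comp_mul _ _ _

/-- The reduction homomorphism `X(O_k̄) → X(𝔽̄)`, with `𝔽̄` the residue field of `O_k̄`. -/
noncomputable def toSpecial : (specInt p k ⟶ 𝒳.X) →* (specSpecial p k ⟶ 𝒳.X) where
  toFun y := specSpecialToInt p k ≫ y
  map_one' := MonObj.comp_one _
  map_mul' _ _ := MonObj.comp_mul _ _ _

/-- The isomorphism `A(k̄) → X(k̄)`, induced by `A ≅ X ×_{O_k} k → X`. -/
noncomputable def ofGenericFibre :
    (specOver k (AlgebraicClosure k) ⟶ A) →* (specGeneric p k ⟶ 𝒳.X) where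
  toFun x := ((Over.mapPullbackAdj (specFracMap p k)).homEquiv _ _).symm (x ≫ 𝒳.iso.inv)
  map_one' := by
    rw [Equiv.symm_apply_eq, Adjunction.homEquiv_unit, MonObj.one_comp, Functor.map_one,
      MonObj.comp_one]
  map_mul' x y := by
    rw [Equiv.symm_apply_eq, Adjunction.homEquiv_unit, MonObj.mul_comp, Functor.map_mul,
      MonObj.comp_mul, ← Adjunction.homEquiv_unit, ← Adjunction.homEquiv_unit,
      Equiv.apply_symm_apply, Equiv.apply_symm_apply]

/-- The subgroup of `A(k̄)` of the points that extend to `O_k̄`-points of the model with trivial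
reduction, i.e. the kernel of the reduction map `A(k̄) = X(O_k̄) → Ā(𝔽̄)`. This is the group of
points with coordinates in the maximal ideal of `O_k̄` of the formal group `Â` of `A`. -/
noncomputable def kernelOfReduction [IsAbelianScheme A] :
    AddSubgroup (AVPoints A (AlgebraicClosure k)) :=
  Subgroup.toAddSubgroup ((𝒳.toSpecial.ker.map 𝒳.toGeneric).comap 𝒳.ofGenericFibre)

/-- The automorphism of `O_k̄` given by an element of `G_k`. -/
noncomputable def intAut (p : ℕ) [Fact p.Prime] {k : Type u} [Field k] [Algebra ℚ_[p] k]
    [FiniteDimensional ℚ_[p] k] (σ : Gal(AlgebraicClosure k/k)) :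
    padicInt p (AlgebraicClosure k) →+* padicInt p (AlgebraicClosure k) :=
  (((σ : AlgebraicClosure k →ₐ[k] AlgebraicClosure k).toRingHom).comp
    (padicInt p (AlgebraicClosure k)).subtype).codRestrict
    (padicInt p (AlgebraicClosure k)) fun x => by
      change spectralNorm ℚ_[p] (AlgebraicClosure k) (σ.restrictScalars ℚ_[p] x) ≤ 1
      rw [← spectralNorm_eq_of_equiv]
      exact x.2

lemma intAut_comp (σ : Gal(AlgebraicClosure k/k)) (x : padicInt p (AlgebraicClosure k)) :
    intAut p σ⁻¹ (intAut p σ x) = x :=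
  Subtype.ext (σ.symm_apply_apply (x : AlgebraicClosure k))

instance (σ : Gal(AlgebraicClosure k/k)) : IsLocalHom (intAut p σ) where
  map_nonunit x hx := by
    have := hx.map (intAut p σ⁻¹)
    rwa [intAut_comp] at this

/-- The morphism `Spec O_k̄ → Spec O_k̄` over `Spec O_k` given by an element of `G_k`. -/
noncomputable abbrev specIntAut (p : ℕ) [Fact p.Prime] {k : Type u} [Field k]
    [Algebra ℚ_[p] k] [FiniteDimensional ℚ_[p] k] (σ : Gal(AlgebraicClosure k/k)) :
    specInt p k ⟶ specInt p k :=
  Over.homMk (U := specInt p k) (V := specInt p k) (Spec.map (CommRingCat.ofHom (intAut p σ))) (by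
    dsimp
    rw [← Spec.map_comp, ← CommRingCat.ofHom_comp]
    congr 2
    ext x
    exact σ.commutes x)

/-- The action of an element of `G_k` on the spectrum of the residue field of `O_k̄`. -/
noncomputable abbrev specSpecialAut (p : ℕ) [Fact p.Prime] {k : Type u} [Field k]
    [Algebra ℚ_[p] k] [FiniteDimensional ℚ_[p] k] (σ : Gal(AlgebraicClosure k/k)) :
    specSpecial p k ⟶ specSpecial p k :=
  Over.homMk (U := specSpecial p k) (V := specSpecial p k)
    (Spec.map (CommRingCat.ofHom (IsLocalRing.ResidueField.map (intAut p σ)))) (by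
    dsimp
    rw [← Spec.map_comp_assoc, ← CommRingCat.ofHom_comp, IsLocalRing.ResidueField.map_comp_residue,
      CommRingCat.ofHom_comp, Spec.map_comp, Category.assoc]
    congr 1
    exact (specIntAut p σ).w)

lemma kernelOfReduction_stable [IsAbelianScheme A] (σ : Gal(AlgebraicClosure k/k))
    (x : AVPoints A (AlgebraicClosure k)) (hx : x ∈ 𝒳.kernelOfReduction) :
    avRep A σ x ∈ 𝒳.kernelOfReduction := by
  obtain ⟨y, hy, hyx⟩ := hx
  refine ⟨specIntAut p σ ≫ y, ?_, ?_⟩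
  · change specSpecialToInt p k ≫ specIntAut p σ ≫ y = 1
    have h1 : specSpecialToInt p k ≫ specIntAut p σ =
        specSpecialAut p σ ≫ specSpecialToInt p k := by
      ext1
      change Spec.map _ ≫ Spec.map _ = Spec.map _ ≫ Spec.map _
      rw [← Spec.map_comp, ← Spec.map_comp, ← CommRingCat.ofHom_comp, ← CommRingCat.ofHom_comp,
        IsLocalRing.ResidueField.map_comp_residue]
    have h2 : specSpecialToInt p k ≫ y = 1 := hy
    rw [← Category.assoc, h1, Category.assoc, h2, MonObj.comp_one]
  · change specGenericToInt p k ≫ specIntAut p σ ≫ y =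
      ((Over.mapPullbackAdj (specFracMap p k)).homEquiv _ _).symm
        ((specOverMap (σ : AlgebraicClosure k →ₐ[k] AlgebraicClosure k) ≫ x.toMul) ≫ 𝒳.iso.inv)
    rw [Category.assoc, Adjunction.homEquiv_naturality_left_symm]
    have h3 : ((Over.mapPullbackAdj (specFracMap p k)).homEquiv _ _).symm (x.toMul ≫ 𝒳.iso.inv) =
      specGenericToInt p k ≫ y := hyx.symm
    rw [h3, ← Category.assoc, ← Category.assoc]
    congr 1
    ext1
    change Spec.map _ ≫ Spec.map _ = Spec.map _ ≫ Spec.map _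
    rw [← Spec.map_comp, ← Spec.map_comp, ← CommRingCat.ofHom_comp, ← CommRingCat.ofHom_comp]
    rfl

/-- The Mackey functor `Â ⊆ A` of the formal group of `A`, with values `Â(K)` the kernel of the
reduction map `A(K) → Ā(𝔽_K)`. -/
noncomputable def formalMackey [IsAbelianScheme A] : (avMackey A).Sub :=
  MackeyFunctor.galoisSub (avRep A) 𝒳.kernelOfReduction 𝒳.kernelOfReduction_stable

/-- The Mackey functor `A/Â`. -/
noncomputable def abarMackey [IsAbelianScheme A] : MackeyFunctor k :=
  (avMackey A).quotient 𝒳.formalMackey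

/-- The group `Ā(𝔽)` of rational points of the reduction. -/
abbrev reductionPoints : Type u := AVPoints 𝒳.reduction (padicResidueField p k)

end GoodReduction

end Padic

/-!
Write `Ā` for the reduction, `𝔽̄` for the residue field of `k̄`, and `{a, b}_K` for the class of
`a ⊗ b` in the Mackey product. By the valuative criterion, smoothness of the model and Galois
descent, `A(K) / Â(K) ≃ Ā(𝔽_K)` for every finite `K / k` (`GoodReduction.abarEquiv`). With the
normalized valuation `v_K` (`gmVal`) and the trace `Tr_K : Ā(𝔽_K) → Ā(𝔽)`, the sum over the
embeddings `𝔽_K → 𝔽̄` (`GoodReduction.reductionTrace`), the isomorphism is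
`{a, b}_K ↦ v_K(a) • Tr_K(b)`.

*The map is well defined.* For `L / K` with ramification index `e` and residue degree `f`, the
restriction multiplies `v` by `e` and the norm multiplies it by `f` (`gmVal_res`, `gmVal_norm`). On
the other side, each embedding of `𝔽_K` extends to `f` embeddings of `𝔽_L`
(`reductionTrace_map`), and each embedding of `𝔽_L` over a given embedding of `K` is induced by `e`
embeddings of `L` (`card_embeddings_residue_eq`, `reductionTrace_abarEquiv_norm`). These are the
projection formulas.

*The map is bijective.* The map `b ↦ {π, b}_k`, for a uniformizer `π` of `k`, followed by the map
above is the quotient map `Ā(𝔽) → Ā(𝔽) / p ^ n`, so it is enough that every element of the product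
is of the form `{π, b}_k` (`exists_symbol_base_eq`). Given this, a symbol `{π, b}_k` in the kernel
has `b` divisible by `p ^ n`, hence it vanishes.

*Symbols with a unit entry vanish* (`symbol_eq_zero_of_gmVal_eq_zero`). The group `Ā(𝔽̄)` is
divisible by `p`: it is a quotient of `A(k̄)`, which is divisible because multiplication by `N ≠ 0`
is injective on the local ring of `A` at the origin, hence fixes the generic point of `A`, hence is
surjective (`exists_pow_eq`). So there is `ζ ∈ 𝔽̄` such that `b` becomes divisible by `p ^ n` over
every `L` with `ζ ∈ 𝔽_L`. For every monic lift `g` of degree `d` of the minimal polynomial of `ζ`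
over `𝔽_K`, the element `(-1) ^ d g(0)` is the norm of a root of `g`, and so its symbol with `b` is
zero by the projection formula. As `g(0)` may be multiplied by any unit `c ≡ 1`, this gives
`{c, b}_K = 0` for these `c`. Every unit has a power of this kind with exponent prime to `p`, and
the product is killed by `p ^ n`, so all symbols with a unit entry vanish.

*Reduction to the base field.* Let `K₀` be the maximal unramified subextension of `K / k`
(`exists_unramified_subextension`). Since `𝔽_{K₀} = 𝔽_K`, the element `b` is the restriction of some
`b₀` over `K₀`, and up to a unit symbol `{a, b}_K = {N(a), b₀}_{K₀} = v • {π, b₀}_{K₀}`, which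
equals `v • {π, N(b₀)}_k`, because `π` remains a uniformizer of `K₀`.
-/

/-! ### Valuation rings of algebraic extensions of `ℚ_p` -/

section PadicFields

open IsLocalRing

variable {p : ℕ} [Fact p.Prime]

/-- The absolute value of an algebraic extension of `ℚ_p` is invariant under embeddings, because
it depends only on the minimal polynomial. -/
lemma spectralNorm_algHom {K L : Type*} [Field K] [Field L] [Algebra ℚ_[p] K]
    [Algebra ℚ_[p] L] (f : K →ₐ[ℚ_[p]] L) (x : K) :
    spectralNorm ℚ_[p] L (f x) = spectralNorm ℚ_[p] K x := by
  rw [spectralNorm, spectralNorm, minpoly.algHom_eq f f.injective]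

section Algebraic

variable {K L E : Type*} [Field K] [Field L] [Field E] [Algebra ℚ_[p] K] [Algebra ℚ_[p] L]
  [Algebra ℚ_[p] E] [Algebra.IsAlgebraic ℚ_[p] K] [Algebra.IsAlgebraic ℚ_[p] L]
  [Algebra.IsAlgebraic ℚ_[p] E]

lemma mem_padicInt {x : K} : x ∈ padicInt p K ↔ spectralNorm ℚ_[p] K x ≤ 1 := Iff.rfl

lemma spectralNorm_padic_mul (x y : K) : spectralNorm ℚ_[p] K (x * y) =
    spectralNorm ℚ_[p] K x * spectralNorm ℚ_[p] K y :=
  map_mul (spectralMulAlgNorm ℚ_[p] K) x y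

lemma spectralNorm_padic_pow (x : K) (n : ℕ) : spectralNorm ℚ_[p] K (x ^ n) =
    spectralNorm ℚ_[p] K x ^ n :=
  map_pow (spectralMulAlgNorm ℚ_[p] K) x n

lemma spectralNorm_padic_pos {x : K} (hx : x ≠ 0) : 0 < spectralNorm ℚ_[p] K x :=
  spectralNorm_zero_lt hx (Algebra.IsAlgebraic.isAlgebraic x)

lemma padicInt_isUnit_iff (x : padicInt p K) :
    IsUnit x ↔ spectralNorm ℚ_[p] K (x : K) = 1 := by
  constructor
  · intro h
    obtain ⟨y, hy⟩ := h.exists_right_inv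
    have h1 : spectralNorm ℚ_[p] K (x : K) * spectralNorm ℚ_[p] K (y : K) = 1 := by
      rw [← spectralNorm_padic_mul]
      have : (x : K) * (y : K) = 1 := congrArg Subtype.val hy
      rw [this, spectralNorm_one]
    have hx : spectralNorm ℚ_[p] K (x : K) ≤ 1 := x.2
    have hy : spectralNorm ℚ_[p] K (y : K) ≤ 1 := y.2
    have h0 := spectralNorm_nonneg (K := ℚ_[p]) (x : K)
    nlinarith
  · intro h
    have hx : (x : K) ≠ 0 := by
      intro h0
      rw [h0, spectralNorm_zero] at h
      exact zero_ne_one h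
    refine .of_mul_eq_one ⟨(x : K)⁻¹, ?_⟩ (Subtype.ext (mul_inv_cancel₀ hx))
    have : spectralNorm ℚ_[p] K (x : K) * spectralNorm ℚ_[p] K (x : K)⁻¹ = 1 := by
      rw [← spectralNorm_padic_mul, mul_inv_cancel₀ hx, spectralNorm_one]
    rw [h, one_mul] at this
    exact this.le

lemma padicInt_mem_maximalIdeal_iff (x : padicInt p K) :
    x ∈ maximalIdeal (padicInt p K) ↔ spectralNorm ℚ_[p] K (x : K) < 1 := by
  rw [mem_maximalIdeal, mem_nonunits_iff, padicInt_isUnit_iff]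
  exact (lt_iff_le_and_ne.trans (and_iff_right x.2)).symm

/-- The homomorphism `O_K → O_L` induced by an embedding `K → L`. -/
noncomputable def padicInt.map (f : K →ₐ[ℚ_[p]] L) : padicInt p K →+* padicInt p L :=
  ((f : K →+* L).comp (padicInt p K).subtype).codRestrict (padicInt p L) fun x =>
    (spectralNorm_algHom f (x : K)).trans_le x.2

@[simp] lemma padicInt.coe_map (f : K →ₐ[ℚ_[p]] L) (x : padicInt p K) :
    (padicInt.map f x : L) = f x := rfl

instance padicInt.isLocalHom_map (f : K →ₐ[ℚ_[p]] L) : IsLocalHom (padicInt.map f) where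
  map_nonunit x hx := by
    rw [padicInt_isUnit_iff] at hx ⊢
    rwa [padicInt.coe_map, spectralNorm_algHom] at hx

/-- The homomorphism of residue fields induced by an embedding `K → L`. -/
noncomputable def padicResidueMap (f : K →ₐ[ℚ_[p]] L) :
    ResidueField (padicInt p K) →+* ResidueField (padicInt p L) :=
  ResidueField.map (padicInt.map f)

/-- The valuation ring is the integral closure of `ℤ_p`: an element is integral if and only if the
coefficients of its minimal polynomial are. -/
lemma padicInt_isIntegral_iff [Algebra ℤ_[p] K] [IsScalarTower ℤ_[p] ℚ_[p] K] {x : K} :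
    IsIntegral ℤ_[p] x ↔ x ∈ padicInt p K := by
  have hcoe : ∀ z : ℤ_[p], algebraMap ℤ_[p] K z ∈ padicInt p K := fun z => by
    rw [IsScalarTower.algebraMap_apply ℤ_[p] ℚ_[p] K, mem_padicInt, spectralNorm_extends]
    exact z.2
  constructor
  · rintro ⟨g, hg, hgx⟩
    let i : ℤ_[p] →+* padicInt p K := (algebraMap ℤ_[p] K).codRestrict (padicInt p K) hcoe
    have : IsIntegral (padicInt p K) x := by
      refine ⟨g.map i, hg.map i, ?_⟩
      rw [Polynomial.eval₂_map]
      exact hgx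
    obtain ⟨y, rfl⟩ := IsIntegrallyClosed.isIntegral_iff.mp this
    exact y.2
  · intro hx
    rw [mem_padicInt, spectralNorm, spectralValue_le_one_iff
      (minpoly.monic (Algebra.IsAlgebraic.isAlgebraic x).isIntegral)] at hx
    have hlift : minpoly ℚ_[p] x ∈ Polynomial.lifts (algebraMap ℤ_[p] ℚ_[p]) := by
      rw [Polynomial.lifts_iff_coeff_lifts]
      exact fun n => ⟨⟨_, hx n⟩, rfl⟩
    obtain ⟨g, hg, -, hgm⟩ := Polynomial.lifts_and_natDegree_eq_and_monic hlift
      (minpoly.monic (Algebra.IsAlgebraic.isAlgebraic x).isIntegral)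
    refine ⟨g, hgm, ?_⟩
    rw [IsScalarTower.algebraMap_eq ℤ_[p] ℚ_[p] K, ← Polynomial.eval₂_map, hg]
    exact minpoly.aeval _ _

end Algebraic

section Finite

variable (p) (K : Type*) [Field K] [Algebra ℚ_[p] K] [FiniteDimensional ℚ_[p] K]

/-- The valuation ring of a finite extension of `ℚ_p` is a discrete valuation ring with finite
residue field, and its ramification index `e` and residue degree `f` satisfy `e f = [K : ℚ_p]`. -/
theorem padicInt_exists_ramification :
    IsDiscreteValuationRing (padicInt p K) ∧ ∃ e f : ℕ, 0 < e ∧ 0 < f ∧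
      e * f = Module.finrank ℚ_[p] K ∧ Nat.card (ResidueField (padicInt p K)) = p ^ f ∧
      (∀ x : K, x ≠ 0 → ∃ m : ℤ, spectralNorm ℚ_[p] K x ^ e = (p : ℝ) ^ (-m)) ∧
      ∃ x : K, x ≠ 0 ∧ spectralNorm ℚ_[p] K x ^ e = (p : ℝ) ^ (-1 : ℤ) := by
  let : Algebra ℤ_[p] K := ((algebraMap ℚ_[p] K).comp (algebraMap ℤ_[p] ℚ_[p])).toAlgebra
  have : IsScalarTower ℤ_[p] ℚ_[p] K := .of_algebraMap_eq fun _ => rfl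
  have hp : p.Prime := Fact.out
  let i : ℤ_[p] →+* padicInt p K := (algebraMap ℤ_[p] K).codRestrict (padicInt p K) fun z =>
    padicInt_isIntegral_iff.mp isIntegral_algebraMap
  let : Algebra ℤ_[p] (padicInt p K) := i.toAlgebra
  have : IsScalarTower ℤ_[p] (padicInt p K) K := .of_algebraMap_eq fun _ => rfl
  have : IsIntegralClosure (padicInt p K) ℤ_[p] K :=
    { algebraMap_injective := Subtype.val_injective
      isIntegral_iff := fun {x} => padicInt_isIntegral_iff.trans
        ⟨fun h => ⟨⟨x, h⟩, rfl⟩, by rintro ⟨y, rfl⟩; exact y.2⟩ }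
  have : Module.IsTorsionFree ℤ_[p] K := .trans_faithfulSMul ℤ_[p] ℚ_[p] K
  have : IsDedekindDomain (padicInt p K) := IsIntegralClosure.isDedekindDomain ℤ_[p] ℚ_[p] K _
  have : Module.Finite ℤ_[p] (padicInt p K) := IsIntegralClosure.finite ℤ_[p] ℚ_[p] K _
  have : Module.Free ℤ_[p] (padicInt p K) := IsIntegralClosure.module_free ℤ_[p] ℚ_[p] K _
  have hrank := IsIntegralClosure.rank ℤ_[p] ℚ_[p] K (padicInt p K)
  have hnp : spectralNorm ℚ_[p] K (p : K) = (p : ℝ)⁻¹ := by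
    have := spectralNorm_extends (L := K) (p : ℚ_[p])
    rwa [map_natCast, Padic.norm_p] at this
  have hp0 : (p : K) ≠ 0 := by
    intro h
    rw [h, spectralNorm_zero] at hnp
    exact (inv_ne_zero (by exact_mod_cast hp.ne_zero)) hnp.symm
  have hpm : (p : padicInt p K) ∈ maximalIdeal (padicInt p K) := by
    rw [padicInt_mem_maximalIdeal_iff]
    have h : ((p : padicInt p K) : K) = p := by simp
    rw [h, hnp]
    exact inv_lt_one_of_one_lt₀ (by exact_mod_cast hp.one_lt)
  have hp0' : (p : padicInt p K) ≠ 0 := by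
    intro h
    apply hp0
    simpa using congrArg Subtype.val h
  have hbot : maximalIdeal (padicInt p K) ≠ ⊥ := by
    intro h
    rw [h, Ideal.mem_bot] at hpm
    exact hp0' hpm
  have hnf : ¬ IsField (padicInt p K) := by rwa [isField_iff_maximalIdeal_eq]
  have hdvr : IsDiscreteValuationRing (padicInt p K) :=
    ((IsDiscreteValuationRing.TFAE (padicInt p K) hnf).out 0 2).mpr ‹_›
  refine ⟨hdvr, ?_⟩
  obtain ⟨π, hπ⟩ := IsDiscreteValuationRing.exists_irreducible (padicInt p K)
  obtain ⟨e, w, he⟩ := IsDiscreteValuationRing.eq_unit_mul_pow_irreducible hp0' hπ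
  -- The quotient `O_K / p` has `p ^ [K : ℚ_p]` elements.
  have hcard : Nat.card (padicInt p K ⧸ Ideal.span {(p : padicInt p K)}) =
      p ^ Module.finrank ℚ_[p] K := by
    let b := Module.finBasis ℤ_[p] (padicInt p K)
    let r : padicInt p K →+ (Fin (Module.finrank ℤ_[p] (padicInt p K)) → ZMod p) :=
      { toFun := fun x j => PadicInt.toZMod (b.equivFun x j)
        map_zero' := by ext j; simp
        map_add' := fun x y => by ext j; simp }
    have hr : Function.Surjective r := by
      intro z
      have hz : ∀ j, ∃ y, (PadicInt.toZMod : ℤ_[p] →+* ZMod p) y = z j := fun j =>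
        ZMod.ringHom_surjective _ _
      choose y hy using hz
      refine ⟨b.equivFun.symm y, ?_⟩
      ext j
      change PadicInt.toZMod (b.equivFun (b.equivFun.symm y) j) = z j
      rw [LinearEquiv.apply_symm_apply, hy]
    have hk : r.ker = (Ideal.span {(p : padicInt p K)}).toAddSubgroup := by
      ext x
      rw [AddMonoidHom.mem_ker, Submodule.mem_toAddSubgroup, Ideal.mem_span_singleton]
      constructor
      · intro hx
        have hz : ∀ j, ∃ y, b.equivFun x j = p * y := fun j => by
          have h1 : (PadicInt.toZMod : ℤ_[p] →+* ZMod p) (b.equivFun x j) = 0 := congrFun hx j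
          rw [← RingHom.mem_ker, PadicInt.ker_toZMod, PadicInt.maximalIdeal_eq_span_p,
            Ideal.mem_span_singleton] at h1
          exact h1
        choose y hy using hz
        refine ⟨b.equivFun.symm y, b.equivFun.injective ?_⟩
        have : (p : padicInt p K) * b.equivFun.symm y = (p : ℤ_[p]) • b.equivFun.symm y := by
          rw [Algebra.smul_def, map_natCast]
        rw [this, map_smul, LinearEquiv.apply_symm_apply]
        ext j
        exact hy j
      · rintro ⟨y, rfl⟩
        rw [← nsmul_eq_mul, map_nsmul]
        ext j
        simp
    calc Nat.card (padicInt p K ⧸ Ideal.span {(p : padicInt p K)})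
        = Nat.card (padicInt p K ⧸ (Ideal.span {(p : padicInt p K)}).toAddSubgroup) := rfl
      _ = Nat.card (padicInt p K ⧸ r.ker) := by rw [hk]
      _ = Nat.card (Fin (Module.finrank ℤ_[p] (padicInt p K)) → ZMod p) :=
          Nat.card_congr (QuotientAddGroup.quotientKerEquivOfSurjective r hr).toEquiv
      _ = p ^ Module.finrank ℚ_[p] K := by simp [hrank]
  have hspan : Ideal.span {(p : padicInt p K)} = maximalIdeal (padicInt p K) ^ e := by
    rw [hπ.maximalIdeal_eq, Ideal.span_singleton_pow, he, Ideal.span_singleton_eq_span_singleton]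
    exact ⟨w⁻¹, by rw [mul_comm (w : padicInt p K), mul_assoc, Units.mul_inv, mul_one]⟩
  have hpow : Nat.card (ResidueField (padicInt p K)) ^ e = p ^ Module.finrank ℚ_[p] K := by
    rw [← hcard, hspan]
    exact (cardQuot_pow_of_prime hbot).symm
  have he0 : e ≠ 0 := by
    rintro rfl
    rw [pow_zero, Ideal.one_eq_top, Ideal.span_singleton_eq_top] at hspan
    exact (mem_maximalIdeal _).mp hpm hspan
  obtain ⟨f, -, hf⟩ := (Nat.dvd_prime_pow hp).mp (hpow ▸ dvd_pow_self _ he0)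
  have hef : e * f = Module.finrank ℚ_[p] K := by
    rw [hf, ← pow_mul, mul_comm] at hpow
    exact Nat.pow_right_injective hp.two_le hpow
  have hf0 : 0 < f := by
    rw [Nat.pos_iff_ne_zero]
    rintro rfl
    rw [mul_zero] at hef
    exact Module.finrank_pos.ne hef
  have hπn : spectralNorm ℚ_[p] K (π : K) ^ e = (p : ℝ) ^ (-1 : ℤ) := by
    have h1 : spectralNorm ℚ_[p] K ((p : padicInt p K) : K) = (p : ℝ)⁻¹ := by
      rw [← hnp]
      simp
    rw [he] at h1
    have h2 : spectralNorm ℚ_[p] K ((w : padicInt p K) : K) = 1 :=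
      (padicInt_isUnit_iff _).mp w.isUnit
    have h3 : (((w : padicInt p K) * π ^ e : padicInt p K) : K) =
      ((w : padicInt p K) : K) * (π : K) ^ e := by simp
    rw [h3, spectralNorm_padic_mul, h2, one_mul, spectralNorm_padic_pow] at h1
    rw [h1, zpow_neg_one]
  have hint : ∀ x : padicInt p K, x ≠ 0 → ∃ m : ℤ,
      spectralNorm ℚ_[p] K (x : K) ^ e = (p : ℝ) ^ (-m) := by
    intro x hx
    obtain ⟨m, v, rfl⟩ := IsDiscreteValuationRing.eq_unit_mul_pow_irreducible hx hπ
    refine ⟨m, ?_⟩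
    have h2 : spectralNorm ℚ_[p] K ((v : padicInt p K) : K) = 1 :=
      (padicInt_isUnit_iff _).mp v.isUnit
    have h3 : (((v : padicInt p K) * π ^ m : padicInt p K) : K) =
      ((v : padicInt p K) : K) * (π : K) ^ m := by simp
    rw [h3, spectralNorm_padic_mul, h2, one_mul, spectralNorm_padic_pow, ← pow_mul, mul_comm m,
      pow_mul, hπn, ← zpow_natCast, ← zpow_mul]
    congr 1
    ring
  refine ⟨e, f, Nat.pos_of_ne_zero he0, hf0, hef, hf, ?_, ⟨π, ?_, hπn⟩⟩
  · intro x hx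
    rcases (padicInt p K).mem_or_inv_mem x with h | h
    · exact hint ⟨x, h⟩ fun h0 => hx (congrArg Subtype.val h0)
    · obtain ⟨m, hm⟩ := hint ⟨x⁻¹, h⟩ fun h0 => inv_ne_zero hx (congrArg Subtype.val h0)
      refine ⟨-m, ?_⟩
      have h1 : spectralNorm ℚ_[p] K x * spectralNorm ℚ_[p] K x⁻¹ = 1 := by
        rw [← spectralNorm_padic_mul, mul_inv_cancel₀ hx, spectralNorm_one]
      have h2 : spectralNorm ℚ_[p] K x ^ e * spectralNorm ℚ_[p] K x⁻¹ ^ e = 1 := by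
        rw [← mul_pow, h1, one_pow]
      change spectralNorm ℚ_[p] K x⁻¹ ^ e = _ at hm
      rw [hm] at h2
      rw [eq_inv_of_mul_eq_one_left h2, zpow_neg, zpow_neg, zpow_neg]
  · intro h0
    exact hπ.ne_zero (Subtype.ext h0)

instance padicInt_isDiscreteValuationRing : IsDiscreteValuationRing (padicInt p K) :=
  (padicInt_exists_ramification p K).1

/-- The absolute ramification index. -/
noncomputable def padicRamification : ℕ := (padicInt_exists_ramification p K).2.choose

/-- The absolute residue degree. -/
noncomputable def padicResidueDegree : ℕ :=
  (padicInt_exists_ramification p K).2.choose_spec.choose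

lemma padicRamification_pos : 0 < padicRamification p K :=
  (padicInt_exists_ramification p K).2.choose_spec.choose_spec.1

lemma padicResidueDegree_pos : 0 < padicResidueDegree p K :=
  (padicInt_exists_ramification p K).2.choose_spec.choose_spec.2.1

lemma padicRamification_mul_padicResidueDegree :
    padicRamification p K * padicResidueDegree p K = Module.finrank ℚ_[p] K :=
  (padicInt_exists_ramification p K).2.choose_spec.choose_spec.2.2.1

lemma card_padicResidueField :
    Nat.card (ResidueField (padicInt p K)) = p ^ padicResidueDegree p K :=
  (padicInt_exists_ramification p K).2.choose_spec.choose_spec.2.2.2.1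

lemma exists_spectralNorm_pow_eq {x : K} (hx : x ≠ 0) :
    ∃ m : ℤ, spectralNorm ℚ_[p] K x ^ padicRamification p K = (p : ℝ) ^ (-m) :=
  (padicInt_exists_ramification p K).2.choose_spec.choose_spec.2.2.2.2.1 x hx

/-- The absolute value of a uniformizer, normalized so that `|p| = p⁻¹`. -/
lemma exists_padic_uniformizer :
    ∃ x : K, x ≠ 0 ∧ spectralNorm ℚ_[p] K x ^ padicRamification p K = (p : ℝ) ^ (-1 : ℤ) :=
  (padicInt_exists_ramification p K).2.choose_spec.choose_spec.2.2.2.2.2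

instance finite_padicResidueField : Finite (ResidueField (padicInt p K)) :=
  Nat.finite_of_card_ne_zero (by
    rw [card_padicResidueField]
    exact pow_ne_zero _ (Fact.out : p.Prime).ne_zero)

lemma exists_spectralNorm_limit {c : ℝ} (hc0 : 0 ≤ c) (hc : c < 1) (a : ℕ → K)
    (ha : ∀ m n, m ≤ n → spectralNorm ℚ_[p] K (a m - a n) ≤ c ^ m) :
    ∃ x, ∀ m, spectralNorm ℚ_[p] K (a m - x) ≤ c ^ m := by
  let _ : NormedField K := spectralNorm.normedField ℚ_[p] K
  have _ : CompleteSpace K := spectralNorm.completeSpace ℚ_[p] K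
  have hd : ∀ m n, m ≤ n → dist (a m) (a n) ≤ c ^ m := ha
  have hcau : CauchySeq a := cauchySeq_of_le_tendsto_0' (fun n => c ^ n) hd
    (tendsto_pow_atTop_nhds_zero_of_lt_one hc0 hc)
  obtain ⟨x, hx⟩ := cauchySeq_tendsto_of_complete hcau
  have hlim : ∀ m, dist (a m) x ≤ c ^ m := fun m => by
    refine le_of_tendsto (tendsto_const_nhds.dist hx) ?_
    filter_upwards [Filter.eventually_ge_atTop m] with n hn using hd m n hn
  exact ⟨x, hlim⟩

/-- The `𝔪`-adic topology is the topology of the absolute value. -/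
lemma mem_maximalIdeal_pow_iff {π : padicInt p K} (hπ : Irreducible π) (n : ℕ)
    (x : padicInt p K) : x ∈ maximalIdeal (padicInt p K) ^ n ↔
      spectralNorm ℚ_[p] K (x : K) ≤ spectralNorm ℚ_[p] K (π : K) ^ n := by
  have hπ0 : (π : K) ≠ 0 := fun h => hπ.ne_zero (Subtype.ext h)
  have hpos : 0 < spectralNorm ℚ_[p] K (π : K) ^ n := pow_pos (spectralNorm_padic_pos hπ0) n
  have hcoe : ∀ z : padicInt p K, ((π ^ n * z : padicInt p K) : K) = (π : K) ^ n * z :=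
    fun _ => rfl
  rw [hπ.maximalIdeal_eq, Ideal.span_singleton_pow, Ideal.mem_span_singleton]
  constructor
  · rintro ⟨y, rfl⟩
    rw [hcoe, spectralNorm_padic_mul, spectralNorm_padic_pow]
    exact mul_le_of_le_one_right hpos.le y.2
  · intro h
    have hx : (x : K) = (π : K) ^ n * ((x : K) / (π : K) ^ n) :=
      (mul_div_cancel₀ _ (pow_ne_zero n hπ0)).symm
    have h1 : spectralNorm ℚ_[p] K ((x : K) / (π : K) ^ n) ≤ 1 := by
      rw [hx, spectralNorm_padic_mul, spectralNorm_padic_pow] at h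
      exact le_of_mul_le_mul_left (h.trans_eq (mul_one _).symm) hpos
    exact ⟨⟨_, h1⟩, Subtype.ext (hx.trans (hcoe ⟨_, h1⟩).symm)⟩

lemma padicInt_exists_limit {c : ℝ} (hc0 : 0 ≤ c) (hc : c < 1) (a : ℕ → padicInt p K)
    (ha : ∀ m n, m ≤ n → spectralNorm ℚ_[p] K ((a m : K) - (a n : K)) ≤ c ^ m) :
    ∃ x : padicInt p K, ∀ m, spectralNorm ℚ_[p] K ((a m : K) - (x : K)) ≤ c ^ m := by
  obtain ⟨x, hx⟩ := exists_spectralNorm_limit p K hc0 hc (fun n => (a n : K)) ha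
  have h1 : (a 0 : K) - x ∈ padicInt p K := (hx 0).trans (pow_zero c).le
  have h2 : x ∈ padicInt p K := by
    have h3 : x = (a 0 : K) - ((a 0 : K) - x) := (sub_sub_cancel _ _).symm
    rw [h3]
    exact sub_mem (a 0).2 h1
  exact ⟨⟨x, h2⟩, hx⟩

lemma padicInt_isPrecomplete :
    IsPrecomplete (maximalIdeal (padicInt p K)) (padicInt p K) := by
  refine ⟨fun a ha => ?_⟩
  obtain ⟨π, hπ⟩ := IsDiscreteValuationRing.exists_irreducible (padicInt p K)
  have hπ1 : spectralNorm ℚ_[p] K (π : K) < 1 :=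
    (padicInt_mem_maximalIdeal_iff π).mp
      (hπ.maximalIdeal_eq ▸ Ideal.mem_span_singleton_self π)
  have key : ∀ m n, m ≤ n → a m - a n ∈ maximalIdeal (padicInt p K) ^ m := fun m n hmn => by
    have h := SModEq.sub_mem.mp (ha hmn)
    rwa [smul_eq_mul, Ideal.mul_top] at h
  obtain ⟨x, hx⟩ := padicInt_exists_limit p K (spectralNorm_nonneg (π : K)) hπ1 a fun m n hmn =>
    (mem_maximalIdeal_pow_iff p K hπ m (a m - a n)).mp (key m n hmn)
  refine ⟨x, fun n => ?_⟩
  rw [SModEq.sub_mem, smul_eq_mul, Ideal.mul_top]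
  exact (mem_maximalIdeal_pow_iff p K hπ n (a n - x)).mpr (hx n)

/-- The valuation ring of a finite extension of `ℚ_p` is complete. -/
instance padicInt_isAdicComplete :
    IsAdicComplete (maximalIdeal (padicInt p K)) (padicInt p K) where
  __ := (inferInstance : IsHausdorff (maximalIdeal (padicInt p K)) (padicInt p K))
  __ := padicInt_isPrecomplete p K

instance padicInt_henselianLocalRing : HenselianLocalRing (padicInt p K) where
  is_henselian g hg a₀ h₁ h₂ := by
    have h := IsAdicComplete.henselianRing (padicInt p K) (maximalIdeal (padicInt p K))
    exact h.is_henselian g hg a₀ h₁ (h₂.map _)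

end Finite

end PadicFields

/-! ### Coordinates of points with values in fields -/

section AffineCharts

open IsLocalRing

variable {X : Scheme.{u}} {R : Type u} [CommRing R] [IsLocalRing R]

/-- A morphism from the spectrum of a local ring factors through every affine open subset that
contains the image of the closed point. -/
lemma exists_specMap_comp_fromSpec {U : X.Opens} (hU : IsAffineOpen U) (f : Spec (.of R) ⟶ X)
    (h : f (closedPoint R) ∈ U) : ∃ φ : Γ(X, U) ⟶ .of R, Spec.map φ ≫ hU.fromSpec = f := by
  have h1 : f ⁻¹ᵁ U = ⊤ := Scheme.preimage_eq_top_of_closedPoint_mem (R := .of R) f h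
  have h2 : Set.range f ⊆ Set.range hU.fromSpec := by
    rw [hU.range_fromSpec]
    rintro _ ⟨y, rfl⟩
    have : y ∈ f ⁻¹ᵁ U := h1 ▸ trivial
    exact this
  exact ⟨Spec.preimage (IsOpenImmersion.lift hU.fromSpec f h2), by simp⟩

lemma exists_isAffineOpen_mem (x : X) : ∃ U : X.Opens, IsAffineOpen U ∧ x ∈ U := by
  obtain ⟨_, ⟨U, hU, rfl⟩, hxU, -⟩ := X.isBasis_affineOpens.exists_subset_of_mem_open
    (Set.mem_univ x) isOpen_univ
  exact ⟨U, hU, hxU⟩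

end AffineCharts

section FieldPoints

variable {k : Type u} [Field k] {A : Over (Spec (.of k))}

lemma specOverMap_comp {R S S' S'' : Type u} [CommRing R] [CommRing S] [CommRing S'] [CommRing S'']
    [Algebra R S] [Algebra R S'] [Algebra R S''] (g : S' →ₐ[R] S'') (f : S →ₐ[R] S') :
    specOverMap (g.comp f) = specOverMap g ≫ specOverMap f := by
  ext1
  exact Spec.map_comp (CommRingCat.ofHom f.toRingHom) (CommRingCat.ofHom g.toRingHom)

/-- A point of a scheme locally of finite type with values in a field extension `Ω` of `k` involves
only finitely many coordinates `C ⊆ Ω`: it comes from every subextension that contains `C`, and an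
endomorphism of `Ω` that fixes the point fixes `C`. -/
lemma exists_finite_coordinates [LocallyOfFiniteType A.hom] {Ω : Type u} [Field Ω] [Algebra k Ω]
    (x : specOver k Ω ⟶ A) : ∃ C : Set Ω, C.Finite ∧
      (∀ (E : Type u) [Field E] [Algebra k E] (i : E →ₐ[k] Ω), C ⊆ Set.range i →
        ∃ y : specOver k E ⟶ A, specOverMap i ≫ y = x) ∧
      ∀ g : Ω →ₐ[k] Ω, specOverMap g ≫ x = x → ∀ c ∈ C, g c = c := by
  obtain ⟨U, hU, hxU⟩ := exists_isAffineOpen_mem (x.left (IsLocalRing.closedPoint Ω))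
  obtain ⟨φ, hφ⟩ := exists_specMap_comp_fromSpec hU x.left hxU
  obtain ⟨ψ, hψ⟩ := Spec.map_surjective (hU.fromSpec ≫ A.hom)
  have hft : ψ.hom.FiniteType := by
    have : LocallyOfFiniteType (Spec.map ψ) := by rw [hψ]; infer_instance
    exact (HasRingHomProperty.Spec_iff (P := @LocallyOfFiniteType)).mp this
  have hψφ : ψ ≫ φ = CommRingCat.ofHom (algebraMap k Ω) := by
    apply Spec.map_injective
    rw [Spec.map_comp, hψ, ← Category.assoc, hφ]
    exact Over.w x
  algebraize [ψ.hom]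
  obtain ⟨s, hs⟩ := (inferInstance : Algebra.FiniteType k Γ(A.left, U)).out
  let φ' : Γ(A.left, U) →ₐ[k] Ω :=
    { φ.hom with commutes' := fun r => DFunLike.congr_fun (congrArg CommRingCat.Hom.hom hψφ) r }
  refine ⟨φ' '' s, s.finite_toSet.image _, ?_, ?_⟩
  · intro E _ _ i hi
    have hr : ∀ b, φ' b ∈ i.range := by
      intro b
      have hb : b ∈ Algebra.adjoin k (s : Set Γ(A.left, U)) := hs ▸ trivial
      have h1 : Algebra.adjoin k (s : Set Γ(A.left, U)) ≤ i.range.comap φ' := by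
        rw [Algebra.adjoin_le_iff]
        intro c hc
        exact hi ⟨c, hc, rfl⟩
      exact h1 hb
    let e : E ≃ₐ[k] i.range := AlgEquiv.ofInjective i i.injective
    let χ : Γ(A.left, U) →ₐ[k] E := (e.symm : i.range →ₐ[k] E).comp (φ'.codRestrict i.range hr)
    have hχ : ∀ b, i (χ b) = φ' b := fun b =>
      congrArg Subtype.val (e.apply_symm_apply (φ'.codRestrict i.range hr b))
    let y : specOver k E ⟶ A := Over.homMk (Spec.map (CommRingCat.ofHom χ.toRingHom) ≫ hU.fromSpec)
      (by
        rw [Category.assoc, ← hψ, ← Spec.map_comp]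
        congr 1
        ext r
        exact χ.commutes r)
    refine ⟨y, ?_⟩
    ext1
    change Spec.map (CommRingCat.ofHom i.toRingHom) ≫ Spec.map (CommRingCat.ofHom χ.toRingHom) ≫
      hU.fromSpec = x.left
    rw [← Category.assoc, ← Spec.map_comp, ← hφ]
    congr 2
    ext b
    exact hχ b
  · rintro g hg _ ⟨b, -, rfl⟩
    have h1 : Spec.map (φ ≫ CommRingCat.ofHom g.toRingHom) ≫ hU.fromSpec =
        Spec.map φ ≫ hU.fromSpec := by
      rw [Spec.map_comp, Category.assoc, hφ]
      exact congrArg CommaMorphism.left hg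
    rw [cancel_mono] at h1
    exact DFunLike.congr_fun (congrArg CommRingCat.Hom.hom (Spec.map_injective h1)) b

/-- Points with values in a field inject into the points with values in an extension field. -/
lemma specOverMap_comp_injective {E Ω : Type u} [Field E] [Field Ω] [Algebra k E] [Algebra k Ω]
    (i : E →ₐ[k] Ω) {x y : specOver k E ⟶ A} (h : specOverMap i ≫ x = specOverMap i ≫ y) :
    x = y := by
  have hl : Spec.map (CommRingCat.ofHom i.toRingHom) ≫ x.left =
      Spec.map (CommRingCat.ofHom i.toRingHom) ≫ y.left := congrArg CommaMorphism.left h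
  have hpt : x.left (IsLocalRing.closedPoint E) = y.left (IsLocalRing.closedPoint E) := by
    have h1 := congrArg (fun f => f.base (IsLocalRing.closedPoint Ω)) hl
    have h2 : Spec.map (CommRingCat.ofHom i.toRingHom) (IsLocalRing.closedPoint Ω) =
      IsLocalRing.closedPoint E := Subsingleton.elim (α := PrimeSpectrum E) _ _
    have h3 : ∀ z : Spec (.of E) ⟶ A.left, (Spec.map (CommRingCat.ofHom i.toRingHom) ≫ z)
        (IsLocalRing.closedPoint Ω) = z (IsLocalRing.closedPoint E) := fun z =>
      (Scheme.Hom.comp_apply _ _ _).trans (congrArg z h2)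
    exact (h3 x.left).symm.trans (h1.trans (h3 y.left))
  obtain ⟨U, hU, hxU⟩ := exists_isAffineOpen_mem (x.left (IsLocalRing.closedPoint E))
  obtain ⟨φ, hφ⟩ := exists_specMap_comp_fromSpec hU x.left hxU
  obtain ⟨χ, hχ⟩ := exists_specMap_comp_fromSpec hU y.left (hpt ▸ hxU)
  rw [← hφ, ← hχ, ← Category.assoc, ← Category.assoc, cancel_mono, ← Spec.map_comp,
    ← Spec.map_comp] at hl
  have h1 := Spec.map_injective hl
  have h2 : φ = χ := by
    ext b
    exact i.injective (DFunLike.congr_fun (congrArg CommRingCat.Hom.hom h1) b)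
  ext1
  rw [← hφ, ← hχ, h2]

end FieldPoints

/-! ### Points with values in complete local rings and valuation rings -/

section LocalRingPoints

open IsLocalRing

variable {O R : Type u} [CommRing O] [CommRing R] {X : Scheme.{u}} (h : X ⟶ Spec (.of O))
  (i : O →+* R)

/-- A point of a smooth scheme with values in the residue field of a complete local ring lifts to
that ring. -/
lemma exists_lift_of_smooth [Smooth h] [IsLocalRing R] [IsAdicComplete (maximalIdeal R) R]
    (y : Spec (.of (ResidueField R)) ⟶ X)
    (hy : y ≫ h = Spec.map (CommRingCat.ofHom ((residue R).comp i))) :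
    ∃ z : Spec (.of R) ⟶ X, z ≫ h = Spec.map (CommRingCat.ofHom i) ∧
      Spec.map (CommRingCat.ofHom (residue R)) ≫ z = y := by
  obtain ⟨U, hU, hyU⟩ := exists_isAffineOpen_mem (y (closedPoint (ResidueField R)))
  obtain ⟨φ, hφ⟩ := exists_specMap_comp_fromSpec hU y hyU
  obtain ⟨ψ, hψ⟩ := Spec.map_surjective (hU.fromSpec ≫ h)
  have hsm : ψ.hom.Smooth := by
    have : Smooth (Spec.map ψ) := by rw [hψ]; infer_instance
    exact (HasRingHomProperty.Spec_iff (P := @Smooth)).mp this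
  have hψφ : ψ ≫ φ = CommRingCat.ofHom ((residue R).comp i) := by
    apply Spec.map_injective
    rw [Spec.map_comp, hψ, ← Category.assoc, hφ]
    exact hy
  algebraize [ψ.hom, i]
  let φ' : Γ(X, U) →ₐ[O] R ⧸ maximalIdeal R :=
    { φ.hom with commutes' := fun r => DFunLike.congr_fun (congrArg CommRingCat.Hom.hom hψφ) r }
  obtain ⟨g, hg⟩ := Algebra.FormallySmooth.exists_mkₐ_comp_eq_of_isAdicComplete φ'
  refine ⟨Spec.map (CommRingCat.ofHom g.toRingHom) ≫ hU.fromSpec, ?_, ?_⟩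
  · rw [Category.assoc, ← hψ, ← Spec.map_comp]
    congr 1
    ext r
    exact g.commutes r
  · rw [← Category.assoc, ← Spec.map_comp, ← hφ]
    congr 2
    ext b
    exact DFunLike.congr_fun hg b

/-- The existence part of the valuative criterion. -/
lemma exists_extension_of_isProper [IsProper h] [IsDomain R] [ValuationRing R] {K : Type u}
    [Field K] [Algebra R K] [IsFractionRing R K] (x : Spec (.of K) ⟶ X)
    (hx : x ≫ h = Spec.map (CommRingCat.ofHom ((algebraMap R K).comp i))) :
    ∃ z : Spec (.of R) ⟶ X, z ≫ h = Spec.map (CommRingCat.ofHom i) ∧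
      Spec.map (CommRingCat.ofHom (algebraMap R K)) ≫ z = x := by
  have hv : ValuativeCriterion h := by
    have : IsProper h := inferInstance
    rw [IsProper.eq_valuativeCriterion] at this
    exact this.1.1.1
  let S : ValuativeCommSq h :=
    { R := R, K := K, i₁ := x, i₂ := Spec.map (CommRingCat.ofHom i)
      commSq := ⟨by rw [hx, ← Spec.map_comp]; rfl⟩ }
  obtain ⟨l⟩ := (hv.existence S).exists_lift
  exact ⟨l.l, l.fac_right, l.fac_left⟩

/-- The uniqueness part of the valuative criterion. -/
lemma extension_unique_of_isSeparated [IsSeparated h] [IsDomain R] [ValuationRing R] {K : Type u}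
    [Field K] [Algebra R K] [IsFractionRing R K] {z z' : Spec (.of R) ⟶ X}
    (hz : z ≫ h = Spec.map (CommRingCat.ofHom i)) (hz' : z' ≫ h = Spec.map (CommRingCat.ofHom i))
    (hzz' : Spec.map (CommRingCat.ofHom (algebraMap R K)) ≫ z =
      Spec.map (CommRingCat.ofHom (algebraMap R K)) ≫ z') : z = z' := by
  let S : ValuativeCommSq h :=
    { R := R, K := K, i₁ := Spec.map (CommRingCat.ofHom (algebraMap R K)) ≫ z
      i₂ := Spec.map (CommRingCat.ofHom i), commSq := ⟨by rw [Category.assoc, hz]⟩ }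
  have := IsSeparated.valuativeCriterion h S
  have hl := Subsingleton.elim (⟨z, rfl, hz⟩ : S.commSq.LiftStruct) ⟨z', hzz'.symm, hz'⟩
  exact congrArg CommSq.LiftStruct.l hl

end LocalRingPoints

/-! ### Multiplication by integers on the cotangent space of a group scheme -/

section CotangentSpace

open IsLocalRing

/-- An endomorphism of a Noetherian local ring that acts on `𝔪 / 𝔪²` as a unit `N` acts on
`𝔪 ^ i / 𝔪 ^ (i + 1)` as `N ^ i`, and is therefore injective. -/
lemma injective_of_cotangent {O : Type*} [CommRing O] [IsLocalRing O] [IsNoetherianRing O]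
    (φ : O →+* O) {N : O} (hN : IsUnit N)
    (h : ∀ f ∈ maximalIdeal O, φ f - N * f ∈ maximalIdeal O ^ 2) : Function.Injective φ := by
  have hφ : ∀ f ∈ maximalIdeal O, φ f ∈ maximalIdeal O := fun f hf => by
    have h1 := Ideal.add_mem _ (Ideal.pow_le_self two_ne_zero (h f hf))
      (Ideal.mul_mem_left _ N hf)
    rwa [sub_add_cancel] at h1
  have key : ∀ i : ℕ, ∀ f ∈ maximalIdeal O ^ (i + 1),
      φ f - N ^ (i + 1) * f ∈ maximalIdeal O ^ (i + 2) := by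
    intro i
    induction i with
    | zero => simpa using h
    | succ i ih =>
      intro f hf
      rw [pow_succ] at hf
      refine Submodule.mul_induction_on hf (fun a ha b hb => ?_) fun x y hx hy => ?_
      · have h1 : φ (a * b) - N ^ (i + 1 + 1) * (a * b) =
            (φ a - N ^ (i + 1) * a) * φ b + N ^ (i + 1) * (a * (φ b - N * b)) := by
          rw [map_mul]; ring
        rw [h1]
        refine Ideal.add_mem _ ?_ (Ideal.mul_mem_left _ _ ?_)
        · rw [show i + 1 + 2 = i + 2 + 1 from rfl, pow_succ (maximalIdeal O) (i + 2)]
          exact Ideal.mul_mem_mul (ih a ha) (hφ b hb)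
        · rw [pow_add (maximalIdeal O) (i + 1) 2]
          exact Ideal.mul_mem_mul ha (h b hb)
      · have h1 : φ (x + y) - N ^ (i + 1 + 1) * (x + y) =
            (φ x - N ^ (i + 1 + 1) * x) + (φ y - N ^ (i + 1 + 1) * y) := by
          rw [map_add]; ring
        rw [h1]
        exact Ideal.add_mem _ hx hy
  rw [injective_iff_map_eq_zero]
  intro f hf
  -- A kernel element lies in all powers of `𝔪`, since `φ` is injective on the graded pieces.
  have hall : ∀ i : ℕ, f ∈ maximalIdeal O ^ i := by
    intro i
    induction i with
    | zero => simp
    | succ i ih =>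
      rcases i with _ | i
      · rw [zero_add, pow_one, mem_maximalIdeal, mem_nonunits_iff]
        intro hu
        have := hu.map φ
        rw [hf] at this
        exact not_isUnit_zero this
      · have h1 := key i f ih
        rw [hf, zero_sub, neg_mem_iff] at h1
        exact (Ideal.unit_mul_mem_iff_mem _ (hN.pow _)).mp h1
  have h1 := Ideal.iInf_pow_eq_bot_of_isLocalRing (maximalIdeal O)
    (Ideal.IsPrime.ne_top inferInstance)
  have h2 : f ∈ ⨅ i : ℕ, maximalIdeal O ^ i := (Submodule.mem_iInf _).mpr hall
  rwa [h1] at h2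

/-- Point derivations separate the cotangent space at a rational point. -/
lemma sub_mem_maximalIdeal_sq {k O : Type*} [Field k] [CommRing O] [IsLocalRing O] [Algebra k O]
    (ε : O →ₐ[k] k) (φ : O →ₐ[k] O) (N : ℕ) (hφε : ε.comp φ = ε)
    (hD : ∀ D : O →ₗ[k] k, (∀ f g, D (f * g) = ε f * D g + ε g * D f) →
      ∀ f, D (φ f) = N * D f) (f : O) (hf : f ∈ maximalIdeal O) :
    φ f - N * f ∈ maximalIdeal O ^ 2 := by
  have hker : ∀ g, ε g = 0 ↔ g ∈ maximalIdeal O := by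
    have h1 : RingHom.ker ε = maximalIdeal O := by
      apply eq_maximalIdeal
      apply RingHom.ker_isMaximal_of_surjective
      exact fun c => ⟨algebraMap k O c, by simp⟩
    intro g
    rw [← h1, RingHom.mem_ker]
  have hfε : ε f = 0 := (hker f).mpr hf
  have hφf : ε (φ f) = 0 := (DFunLike.congr_fun hφε f).trans hfε
  by_contra hcon
  let W : Submodule k O := (maximalIdeal O ^ 2).restrictScalars k ⊔ k ∙ (1 : O)
  have hW : φ f - N * f ∉ W := by
    intro hmem
    obtain ⟨a, ha, b, hb, hab⟩ := Submodule.mem_sup.mp hmem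
    obtain ⟨c, rfl⟩ := Submodule.mem_span_singleton.mp hb
    have ha0 : ε a = 0 := (hker a).mpr (Ideal.pow_le_self two_ne_zero ha)
    have h1 := congrArg ε hab
    rw [map_add, ha0, map_smul, map_one, map_sub, map_mul, hφf, hfε] at h1
    have hc : c = 0 := by simpa using h1
    rw [hc, zero_smul, add_zero] at hab
    exact hcon (hab ▸ ha)
  obtain ⟨D, hD1, hD2⟩ := Submodule.exists_le_ker_of_notMem hW
  have hD3 : ∀ c : k, D (algebraMap k O c) = 0 := fun c => by
    refine hD2 (Submodule.mem_sup_right (Submodule.mem_span_singleton.mpr ⟨c, ?_⟩))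
    rw [Algebra.smul_def, mul_one]
  have hleib : ∀ f g, D (f * g) = ε f * D g + ε g * D f := by
    intro f g
    have h0 : ∀ g, g - algebraMap k O (ε g) ∈ maximalIdeal O := fun g => by
      rw [← hker]; simp
    have h1 : D ((f - algebraMap k O (ε f)) * (g - algebraMap k O (ε g))) = 0 := by
      refine hD2 (Submodule.mem_sup_left ?_)
      rw [Submodule.restrictScalars_mem, pow_two]
      exact Ideal.mul_mem_mul (h0 f) (h0 g)
    have h2 : (f - algebraMap k O (ε f)) * (g - algebraMap k O (ε g)) =
        f * g - ε f • g - ε g • f + algebraMap k O (ε f * ε g) := by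
      rw [Algebra.smul_def, Algebra.smul_def, map_mul]; ring
    rw [h2, map_add, hD3, map_sub, map_sub, map_smul, map_smul, smul_eq_mul, smul_eq_mul] at h1
    linear_combination h1
  have h3 := hD D hleib f
  apply hD1
  rw [map_sub, h3, ← nsmul_eq_mul N f, map_nsmul, nsmul_eq_mul, sub_self]

end CotangentSpace

section Divisibility

open IsLocalRing

variable {k : Type u} [Field k] (A : Over (Spec (.of k))) [GrpObj A]

instance TrivSqZeroExt.isLocalRing_of_field (M : Type*) [AddCommGroup M] [Module k M]
    [Module kᵐᵒᵖ M] [IsCentralScalar k M] : IsLocalRing (TrivSqZeroExt k M) := by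
  have : IsLocalHom (TrivSqZeroExt.fstHom k k M : TrivSqZeroExt k M →+* k) :=
    ⟨fun a ha => TrivSqZeroExt.isUnit_iff_isUnit_fst.mpr ha⟩
  exact RingHom.domain_isLocalRing (TrivSqZeroExt.fstHom k k M : TrivSqZeroExt k M →+* k)

/-- The unit point of a group scheme over `k`. -/
noncomputable def unitPoint : A.left := (1 : specOver k k ⟶ A).left (closedPoint k)

/-- The local ring of a group scheme at the unit point. -/
abbrev UnitStalk : Type u := A.left.presheaf.stalk (unitPoint A)

/-- The `k`-algebra structure given by the structure morphism of `A`. -/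
noncomputable instance : Algebra k (UnitStalk A) :=
  (Spec.preimage (A.left.fromSpecStalk (unitPoint A) ≫ A.hom)).hom.toAlgebra

/-- The morphism from the spectrum of the local ring at the unit point. -/
noncomputable def fromUnitStalk : specOver k (UnitStalk A) ⟶ A :=
  Over.homMk (A.left.fromSpecStalk (unitPoint A)) (Spec.map_preimage _).symm

/-- Homomorphisms out of the local ring at the unit point give points of the group scheme. -/
noncomputable def stalkPoint {T : Type u} [CommRing T] [Algebra k T] (χ : UnitStalk A →ₐ[k] T) :
    specOver k T ⟶ A := specOverMap χ ≫ fromUnitStalk A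

variable {A} in
lemma stalkPoint_injective {T : Type u} [CommRing T] [Algebra k T]
    {χ χ' : UnitStalk A →ₐ[k] T} (h : stalkPoint A χ = stalkPoint A χ') : χ = χ' := by
  have h1 : Spec.map (CommRingCat.ofHom χ.toRingHom) ≫ A.left.fromSpecStalk (unitPoint A) =
    Spec.map (CommRingCat.ofHom χ'.toRingHom) ≫ A.left.fromSpecStalk (unitPoint A) :=
    congrArg CommaMorphism.left h
  rw [cancel_mono] at h1
  ext b
  exact DFunLike.congr_fun (congrArg CommRingCat.Hom.hom (Spec.map_injective h1)) b

variable {A} in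
lemma specOverMap_stalkPoint {T T' : Type u} [CommRing T] [CommRing T'] [Algebra k T]
    [Algebra k T'] (q : T →ₐ[k] T') (χ : UnitStalk A →ₐ[k] T) :
    specOverMap q ≫ stalkPoint A χ = stalkPoint A (q.comp χ) := by
  rw [stalkPoint, stalkPoint, specOverMap_comp, Category.assoc]

lemma exists_stalkPoint_of_closedPoint {T : Type u} [CommRing T] [IsLocalRing T] [Algebra k T]
    (t : specOver k T ⟶ A) (ht : t.left (closedPoint T) = unitPoint A) :
    ∃ χ : UnitStalk A →ₐ[k] T, stalkPoint A χ = t := by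
  have key : ∃ ρ : .of (UnitStalk A) ⟶ CommRingCat.of T,
      Spec.map ρ ≫ A.left.fromSpecStalk (unitPoint A) = t.left := by
    have : ∀ x, t.left (closedPoint T) = x → ∃ ρ : A.left.presheaf.stalk x ⟶ CommRingCat.of T,
      Spec.map ρ ≫ A.left.fromSpecStalk x = t.left := by
        rintro _ rfl
        exact ⟨_, Scheme.Spec_stalkClosedPointTo_fromSpecStalk (R := .of T) t.left⟩
    exact this _ ht
  obtain ⟨ρ, hρ⟩ := key
  have hk : CommRingCat.ofHom (algebraMap k (UnitStalk A)) ≫ ρ =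
      CommRingCat.ofHom (algebraMap k T) := by
    apply Spec.map_injective
    have h1 : Spec.map (CommRingCat.ofHom (algebraMap k (UnitStalk A))) =
      A.left.fromSpecStalk (unitPoint A) ≫ A.hom := Spec.map_preimage _
    rw [Spec.map_comp, h1, ← Category.assoc, hρ]
    exact Over.w t
  refine ⟨{ ρ.hom with
    commutes' := fun r => DFunLike.congr_fun (congrArg CommRingCat.Hom.hom hk) r }, ?_⟩
  ext1
  exact hρ

/-- A point with values in a local `k`-algebra with residue field `k` whose reduction is the unit
comes from the local ring at the unit point. -/
lemma exists_stalkPoint {T : Type u} [CommRing T] [IsLocalRing T] [Algebra k T]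
    (q : T →ₐ[k] k) (t : specOver k T ⟶ A) (ht : specOverMap q ≫ t = 1) :
    ∃ χ : UnitStalk A →ₐ[k] T, stalkPoint A χ = t := by
  refine exists_stalkPoint_of_closedPoint A t ?_
  have h1 : (specOverMap q ≫ t).left (closedPoint k) = unitPoint A := by rw [ht]; rfl
  have : IsLocalHom q.toRingHom :=
    ⟨fun a ha => by
      by_contra hna
      have h2 : RingHom.ker q = maximalIdeal T := eq_maximalIdeal
        (RingHom.ker_isMaximal_of_surjective _ fun c => ⟨algebraMap k T c, by simp⟩)
      have h3 : a ∈ RingHom.ker q := h2 ▸ (mem_maximalIdeal a).mpr hna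
      rw [RingHom.mem_ker] at h3
      exact ha.ne_zero h3⟩
  have h2 : Spec.map (CommRingCat.ofHom q.toRingHom) (closedPoint k) = closedPoint T :=
    comap_closedPoint q.toRingHom
  exact (((Scheme.Hom.comp_apply _ _ _).trans (congrArg t.left h2)).symm).trans h1

/-- The evaluation at the unit point. -/
lemma exists_unitCounit : ∃ ε : UnitStalk A →ₐ[k] k, stalkPoint A ε = 1 :=
  exists_stalkPoint_of_closedPoint A 1 rfl

variable {A}

lemma stalkPoint_ofId {ε : UnitStalk A →ₐ[k] k} (hε : stalkPoint A ε = 1) (T : Type u) [CommRing T]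
    [Algebra k T] : stalkPoint A ((Algebra.ofId k T).comp ε) = 1 := by
  rw [← specOverMap_stalkPoint, hε, MonObj.comp_one]

/-- The homomorphism to the square-zero extension `k ⊕ M` given by a point derivation. -/
def pointDerivationHom {O : Type*} [CommRing O] [Algebra k O] {M : Type*} [AddCommGroup M]
    [Module k M] [Module kᵐᵒᵖ M] [IsCentralScalar k M] (ε : O →ₐ[k] k) (D : O →ₗ[k] M)
    (hD : ∀ f g, D (f * g) = ε f • D g + ε g • D f) : O →ₐ[k] TrivSqZeroExt k M :=
  have h1 : D 1 = 0 := by simpa using hD 1 1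
  AlgHom.ofLinearMap
    { toFun := fun f => TrivSqZeroExt.inl (ε f) + TrivSqZeroExt.inr (D f)
      map_add' := fun f g => by
        ext <;> simp
      map_smul' := fun c f => by
        ext <;> simp }
    (by ext <;> simp [h1])
    (fun f g => by
      ext
      · simp
      · simp [hD])

/-- The additive structure on tangent vectors is the group structure of the scheme: multiplying a
tangent vector at the unit by `n` is the same as taking the `n`-th power of the corresponding
point with values in the dual numbers. This is an Eckmann–Hilton argument with the algebra
`k ⊕ k²` of two independent tangent directions. -/
lemma stalkPoint_pointDerivation_pow {ε : UnitStalk A →ₐ[k] k} (hε : stalkPoint A ε = 1)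
    (χ : UnitStalk A →ₐ[k] TrivSqZeroExt k k)
    (hχ : (TrivSqZeroExt.fstHom k k k).comp χ = ε) (n : ℕ) :
    stalkPoint A ((TrivSqZeroExt.map ((n : k) • LinearMap.id)).comp χ) = stalkPoint A χ ^ n := by
  have hχ' : ∀ f, (χ f).fst = ε f := fun f => DFunLike.congr_fun hχ f
  induction n with
  | zero =>
    rw [pow_zero, ← stalkPoint_ofId hε]
    congr 1
    ext f
    · simp [hχ', Algebra.ofId_apply, TrivSqZeroExt.algebraMap_eq_inl]
    · simp [Algebra.ofId_apply, TrivSqZeroExt.algebraMap_eq_inl]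
  | succ n ih =>
    let c : ∀ a b : k, k →ₗ[k] k × k := fun a b =>
      LinearMap.prod (a • LinearMap.id) (b • LinearMap.id)
    let P : ∀ a b : k, UnitStalk A →ₐ[k] TrivSqZeroExt k (k × k) := fun a b =>
      (TrivSqZeroExt.map (c a b)).comp χ
    let r : specOver k (TrivSqZeroExt k (k × k)) ⟶ A := stalkPoint A (P n 0) * stalkPoint A (P 0 1)
    have hq : ∀ l : k × k →ₗ[k] k, ∀ a b : k,
        specOverMap (TrivSqZeroExt.map l) ≫ stalkPoint A (P a b) =
        stalkPoint A ((TrivSqZeroExt.map (l.comp (c a b))).comp χ) := fun l a b => by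
      rw [specOverMap_stalkPoint, ← AlgHom.comp_assoc, ← TrivSqZeroExt.map_comp_map]
    have h0 : stalkPoint A ((TrivSqZeroExt.map (0 : k →ₗ[k] k)).comp χ) = 1 := by
      rw [← stalkPoint_ofId hε]
      congr 1
      ext f
      · simp [hχ', Algebra.ofId_apply, TrivSqZeroExt.algebraMap_eq_inl]
      · simp [Algebra.ofId_apply, TrivSqZeroExt.algebraMap_eq_inl]
    have h1 : (TrivSqZeroExt.map (LinearMap.id : k →ₗ[k] k)).comp χ = χ := by
      rw [TrivSqZeroExt.map_id, AlgHom.id_comp]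
    have hr : specOverMap (TrivSqZeroExt.fstHom k k (k × k)) ≫ r = 1 := by
      rw [MonObj.comp_mul, specOverMap_stalkPoint, specOverMap_stalkPoint]
      have h2 : ∀ a b, (TrivSqZeroExt.fstHom k k (k × k)).comp (P a b) = ε := fun a b => by
        ext f
        simp [P, hχ']
      rw [h2, h2, hε, one_mul]
    obtain ⟨ρ, hρ⟩ := exists_stalkPoint A _ r hr
    have hρ1 : (TrivSqZeroExt.map (LinearMap.fst k k k)).comp ρ =
        (TrivSqZeroExt.map ((n : k) • LinearMap.id)).comp χ := by
      apply stalkPoint_injective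
      rw [← specOverMap_stalkPoint, hρ, MonObj.comp_mul, hq, hq]
      have h2 : (LinearMap.fst k k k).comp (c n 0) = (n : k) • LinearMap.id := by ext; simp [c]
      have h3 : (LinearMap.fst k k k).comp (c 0 1) = 0 := by ext; simp [c]
      rw [h2, h3, h0, mul_one]
    have hρ2 : (TrivSqZeroExt.map (LinearMap.snd k k k)).comp ρ = χ := by
      apply stalkPoint_injective
      rw [← specOverMap_stalkPoint, hρ, MonObj.comp_mul, hq, hq]
      have h2 : (LinearMap.snd k k k).comp (c n 0) = 0 := by ext; simp [c]
      have h3 : (LinearMap.snd k k k).comp (c 0 1) = LinearMap.id := by ext; simp [c]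
      rw [h2, h3, h0, one_mul, h1]
    have hρ3 : (TrivSqZeroExt.map (LinearMap.fst k k k + LinearMap.snd k k k)).comp ρ =
        (TrivSqZeroExt.map (((n + 1 : ℕ) : k) • LinearMap.id)).comp χ := by
      ext f
      · have := congrArg TrivSqZeroExt.fst (DFunLike.congr_fun hρ2 f)
        simpa using this
      · have e1 := congrArg TrivSqZeroExt.snd (DFunLike.congr_fun hρ1 f)
        have e2 := congrArg TrivSqZeroExt.snd (DFunLike.congr_fun hρ2 f)
        simp only [AlgHom.comp_apply, TrivSqZeroExt.snd_map, LinearMap.fst_apply,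
          LinearMap.snd_apply, LinearMap.smul_apply, LinearMap.id_apply, LinearMap.add_apply,
          smul_eq_mul] at e1 e2 ⊢
        rw [e1, e2]
        push_cast
        ring
    rw [← hρ3, ← specOverMap_stalkPoint, hρ, MonObj.comp_mul, hq, hq]
    have h2 : (LinearMap.fst k k k + LinearMap.snd k k k).comp (c n 0) =
        (n : k) • LinearMap.id := by
      ext; simp [c]
    have h3 : (LinearMap.fst k k k + LinearMap.snd k k k).comp (c 0 1) = LinearMap.id := by
      ext; simp [c]
    rw [h2, h3, h1, ih, pow_succ]

end Divisibility

/-! ### Divisibility of the geometric points of an abelian variety -/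

section DivisiblePoints

open IsLocalRing Limits

variable {k : Type u} [Field k] (A : Over (Spec (.of k))) [GrpObj A]

/-- In characteristic zero, multiplication by `N ≠ 0` is injective on the local ring at the unit
point, since it acts on the cotangent space as the scalar `N`. -/
lemma exists_injective_stalkPoint_pow [CharZero k] [IsNoetherianRing (UnitStalk A)] {N : ℕ}
    (hN : N ≠ 0) : ∃ φ : UnitStalk A →ₐ[k] UnitStalk A, Function.Injective φ ∧
      stalkPoint A φ = fromUnitStalk A ≫ (𝟙 A) ^ N := by
  obtain ⟨ε, hε⟩ := exists_unitCounit A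
  have hid : stalkPoint A (AlgHom.id k _) = fromUnitStalk A := by
    have : specOverMap (AlgHom.id k (UnitStalk A)) = 𝟙 _ := by
      ext1
      exact Spec.map_id _
    rw [stalkPoint, this, Category.id_comp]
  have hpow : fromUnitStalk A ≫ (𝟙 A) ^ N = fromUnitStalk A ^ N := by
    rw [MonObj.comp_pow, Category.comp_id]
  obtain ⟨φ, hφ⟩ := exists_stalkPoint A ε (fromUnitStalk A ≫ (𝟙 A) ^ N) (by
    rw [hpow, MonObj.comp_pow]
    change stalkPoint A ε ^ N = 1
    rw [hε, one_pow])
  refine ⟨φ, ?_, hφ⟩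
  have hcomp : ∀ {T : Type u} [CommRing T] [Algebra k T] (χ : UnitStalk A →ₐ[k] T),
      stalkPoint A (χ.comp φ) = stalkPoint A χ ^ N := fun χ => by
    rw [← specOverMap_stalkPoint, hφ, hpow, MonObj.comp_pow]
    rfl
  have hφε : ε.comp φ = ε := by
    apply stalkPoint_injective
    rw [hcomp, hε, one_pow]
  have hunit : IsUnit (N : UnitStalk A) := by
    have : IsUnit (N : k) := (Nat.cast_ne_zero.mpr hN).isUnit
    simpa using this.map (algebraMap k (UnitStalk A))
  refine injective_of_cotangent φ.toRingHom hunit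
    (sub_mem_maximalIdeal_sq ε φ N hφε fun D hD f => ?_)
  let χ := pointDerivationHom ε D hD
  have hχ : (TrivSqZeroExt.fstHom k k k).comp χ = ε := by
    ext f
    simp [χ, pointDerivationHom]
  have h1 : χ.comp φ = (TrivSqZeroExt.map ((N : k) • LinearMap.id)).comp χ := by
    apply stalkPoint_injective
    rw [hcomp, stalkPoint_pointDerivation_pow hε χ hχ]
  have h2 := congrArg TrivSqZeroExt.snd (DFunLike.congr_fun h1 f)
  simpa [χ, pointDerivationHom, mul_comm] using h2

variable [IsAbelianScheme A]

/-- In characteristic zero, multiplication by `N ≠ 0` on an abelian variety fixes the generic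
point; as a proper morphism it is therefore surjective. -/
lemma surjective_pow_left [CharZero k] {N : ℕ} (hN : N ≠ 0) :
    IsProper ((𝟙 A) ^ N : A ⟶ A).left ∧ Surjective ((𝟙 A) ^ N : A ⟶ A).left := by
  have hsm : Smooth A.hom := IsAbelianScheme.smooth
  have hpr : IsProper A.hom := IsAbelianScheme.proper
  have hgi : GeometricallyIntegral A.hom := IsAbelianScheme.geometricallyIntegral
  have hint : IsIntegral A.left := GeometricallyIntegral.isIntegral_of_subsingleton A.hom
  have hln : IsLocallyNoetherian A.left := LocallyOfFiniteType.isLocallyNoetherian A.hom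
  set F := ((𝟙 A) ^ N : A ⟶ A) with hF
  have hw : F.left ≫ A.hom = A.hom := Over.w F
  have hFp : IsProper F.left := by
    have : IsProper (F.left ≫ A.hom) := by rw [hw]; infer_instance
    exact IsProper.of_comp F.left A.hom
  refine ⟨hFp, ⟨?_⟩⟩
  obtain ⟨φ, hφ, hφF⟩ := exists_injective_stalkPoint_pow A hN
  let c := A.left.fromSpecStalk (unitPoint A)
  have hcF : Spec.map (CommRingCat.ofHom φ.toRingHom) ≫ c = c ≫ F.left :=
    congrArg CommaMorphism.left hφF
  let b : Spec (.of (UnitStalk A)) := (⊥ : PrimeSpectrum (UnitStalk A))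
  have hb : Spec.map (CommRingCat.ofHom φ.toRingHom) b = b := by
    apply PrimeSpectrum.ext
    change Ideal.comap φ.toRingHom ⊥ = ⊥
    rw [← RingHom.ker_eq_comap_bot]
    exact (RingHom.injective_iff_ker_eq_bot _).mp hφ
  -- The generic point is the image of the zero ideal of the local ring, which `φ` preserves.
  have hfix : F.left (c b) = c b := by
    have h1 : (Spec.map (CommRingCat.ofHom φ.toRingHom) ≫ c) b = (c ≫ F.left) b := by rw [hcF]
    have h2 : (Spec.map (CommRingCat.ofHom φ.toRingHom) ≫ c) b = c b :=
      (Scheme.Hom.comp_apply _ _ _).trans (congrArg c hb)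
    exact ((Scheme.Hom.comp_apply _ _ _).symm.trans h1.symm).trans h2
  have hgen : c b = genericPoint A.left := by
    have h1 : genericPoint A.left ∈ Set.range c := by
      rw [Scheme.range_fromSpecStalk]
      exact genericPoint_specializes _
    obtain ⟨q, hq⟩ := h1
    have h2 : b ⤳ q := (PrimeSpectrum.le_iff_specializes _ _).mp bot_le
    have h3 : c b ⤳ genericPoint A.left := hq ▸ h2.map c.continuous
    exact (h3.antisymm (genericPoint_specializes _)).eq
  have hcl : IsClosed (Set.range F.left) := F.left.isClosedMap.isClosed_range
  rw [← Set.range_eq_univ, ← hcl.closure_eq, Set.eq_univ_iff_forall]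
  intro x
  have h1 : genericPoint A.left ∈ Set.range F.left := ⟨c b, hfix.trans hgen⟩
  exact (genericPoint_specializes x).mem_closed isClosed_closure (subset_closure h1)

/-- The group of points of an abelian variety in characteristic zero with values in an
algebraically closed field is divisible. -/
lemma exists_pow_eq [CharZero k] {Ω : Type u} [Field Ω] [IsAlgClosed Ω] [Algebra k Ω] {N : ℕ}
    (hN : N ≠ 0) (t : specOver k Ω ⟶ A) : ∃ t' : specOver k Ω ⟶ A, t' ^ N = t := by
  obtain ⟨hFp, hFs⟩ := surjective_pow_left A hN
  set F := ((𝟙 A) ^ N : A ⟶ A) with hF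
  have hne : Nonempty ↥(pullback F.left t.left) := by
    obtain ⟨z, -⟩ := (pullback.snd F.left t.left).surjective (closedPoint Ω)
    exact ⟨z⟩
  have hc : CompactSpace ↥(specOver k Ω).left :=
    inferInstanceAs (CompactSpace ↥(Spec (.of Ω)))
  have hcomp : CompactSpace ↥(pullback F.left t.left) :=
    QuasiCompact.compactSpace_of_compactSpace (pullback.snd F.left t.left)
  -- A closed point of the fibre over `t` is `Ω`-rational.
  obtain ⟨z, -, hz⟩ := IsClosed.exists_closed_singleton
    (X := ↥(pullback F.left t.left)) isClosed_univ Set.univ_nonempty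
  let s := pointOfClosedPoint (pullback.snd F.left t.left) z hz
  have hs : s ≫ pullback.snd F.left t.left = 𝟙 _ := pointOfClosedPoint_comp _ z hz
  have hsF : (s ≫ pullback.fst F.left t.left) ≫ F.left = t.left := by
    rw [Category.assoc, pullback.condition, ← Category.assoc, hs]
    exact Category.id_comp t.left
  let t' : specOver k Ω ⟶ A := Over.homMk (s ≫ pullback.fst F.left t.left) (by
    rw [← Over.w F, ← Category.assoc, hsF]
    exact Over.w t)
  refine ⟨t', ?_⟩
  have h1 : t' ≫ F = t := by
    ext1
    exact hsF
  rw [← h1, hF, MonObj.comp_pow, Category.comp_id]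

end DivisiblePoints

/-! ### The reduction homomorphism -/

section ReductionOfPoints

open IsLocalRing Limits
open scoped CategoryTheory.Obj

variable {p : ℕ} [Fact p.Prime] {k : Type u} [Field k] [Algebra ℚ_[p] k]
  [FiniteDimensional ℚ_[p] k]

section Extensions

variable (K : Type u) [Field K] [Algebra ℚ_[p] K] [Algebra.IsAlgebraic ℚ_[p] K] [Algebra k K]
  [IsScalarTower ℚ_[p] k K]
  {L : Type u} [Field L] [Algebra ℚ_[p] L] [Algebra.IsAlgebraic ℚ_[p] L] [Algebra k L]
  [IsScalarTower ℚ_[p] k L]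
  {E : Type u} [Field E] [Algebra ℚ_[p] E] [Algebra.IsAlgebraic ℚ_[p] E] [Algebra k E]
  [IsScalarTower ℚ_[p] k E]

variable (p k) in
/-- The inclusion `O_k → O_K`. -/
noncomputable def padicIntBase : padicInt p k →+* padicInt p K :=
  padicInt.map (IsScalarTower.toAlgHom ℚ_[p] k K)

/-- The residue field of an extension of `k` is an extension of the residue field of `k`. -/
noncomputable instance padicResidueAlgebra :
    Algebra (padicResidueField p k) (ResidueField (padicInt p K)) :=
  (padicResidueMap (IsScalarTower.toAlgHom ℚ_[p] k K)).toAlgebra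

variable {K}

variable (p) in
/-- The homomorphism of extensions of the residue field of `k` induced by a `k`-embedding. -/
noncomputable def padicResidueAlgHom (f : K →ₐ[k] L) :
    ResidueField (padicInt p K) →ₐ[padicResidueField p k] ResidueField (padicInt p L) :=
  { padicResidueMap (f.restrictScalars ℚ_[p]) with
    commutes' := fun r => by
      obtain ⟨r, rfl⟩ := residue_surjective r
      change residue _ _ = residue _ _
      congr 1
      exact Subtype.ext (f.commutes (r : k)) }

variable (p) in
lemma padicResidueAlgHom_residue (f : K →ₐ[k] L) (x : padicInt p K) :
    padicResidueAlgHom p f (residue _ x) =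
      residue _ (padicInt.map (f.restrictScalars ℚ_[p]) x) := rfl

lemma padicResidueAlgHom_comp (g : L →ₐ[k] E) (f : K →ₐ[k] L) :
    padicResidueAlgHom p (g.comp f) = (padicResidueAlgHom p g).comp (padicResidueAlgHom p f) := by
  ext x
  obtain ⟨x, rfl⟩ := residue_surjective x
  rfl

end Extensions

namespace GoodReduction

variable {A : Over (Spec (.of k))} [GrpObj A] (𝒳 : GoodReduction p A)

/-- The projection from the generic fibre to the model. -/
noncomputable def genericProj : A.left ⟶ 𝒳.X.left :=
  𝒳.iso.inv.left ≫ pullback.fst 𝒳.X.hom (specFracMap p k)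

/-- The projection from the special fibre to the model. -/
noncomputable def specialProj : 𝒳.reduction.left ⟶ 𝒳.X.left :=
  pullback.fst 𝒳.X.hom (specResidueMap p k)

lemma genericProj_comp : 𝒳.genericProj ≫ 𝒳.X.hom = A.hom ≫ specFracMap p k := by
  rw [genericProj, Category.assoc, pullback.condition, ← Category.assoc]
  congr 1
  exact Over.w 𝒳.iso.inv

lemma specialProj_comp : 𝒳.specialProj ≫ 𝒳.X.hom = 𝒳.reduction.hom ≫ specResidueMap p k :=
  pullback.condition

lemma specialProj_hom_ext {T : Scheme.{u}} {x y : T ⟶ 𝒳.reduction.left}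
    (h1 : x ≫ 𝒳.specialProj = y ≫ 𝒳.specialProj)
    (h2 : x ≫ 𝒳.reduction.hom = y ≫ 𝒳.reduction.hom) : x = y :=
  pullback.hom_ext h1 h2

/-- The universal property of the generic fibre as a fibre product. -/
lemma exists_genericProj_eq {T : Scheme.{u}} (m : T ⟶ 𝒳.X.left) (t : T ⟶ Spec (.of k))
    (h : m ≫ 𝒳.X.hom = t ≫ specFracMap p k) :
    ∃ x : T ⟶ A.left, x ≫ A.hom = t ∧ x ≫ 𝒳.genericProj = m := by
  have h3 : 𝒳.iso.hom.left ≫ A.hom = pullback.snd 𝒳.X.hom (specFracMap p k) := Over.w 𝒳.iso.hom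
  have h4 : 𝒳.iso.hom.left ≫ 𝒳.iso.inv.left = 𝟙 _ :=
    congrArg CommaMorphism.left 𝒳.iso.hom_inv_id
  refine ⟨pullback.lift m t h ≫ 𝒳.iso.hom.left, ?_, ?_⟩
  · rw [Category.assoc, h3, pullback.lift_snd]
  · rw [genericProj, Category.assoc, ← Category.assoc 𝒳.iso.hom.left, h4, Category.id_comp,
      pullback.lift_fst]

/-- The universal property of the special fibre as a fibre product. -/
lemma exists_specialProj_eq {T : Scheme.{u}} (m : T ⟶ 𝒳.X.left)
    (t : T ⟶ Spec (.of (padicResidueField p k)))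
    (h : m ≫ 𝒳.X.hom = t ≫ specResidueMap p k) :
    ∃ y : T ⟶ 𝒳.reduction.left, y ≫ 𝒳.reduction.hom = t ∧ y ≫ 𝒳.specialProj = m :=
  ⟨pullback.lift m t h, pullback.lift_snd _ _ _, pullback.lift_fst _ _ _⟩

section Relation

variable {K : Type u} [Field K] [Algebra ℚ_[p] K] [Algebra.IsAlgebraic ℚ_[p] K] [Algebra k K]
  [IsScalarTower ℚ_[p] k K]
  {L : Type u} [Field L] [Algebra ℚ_[p] L] [Algebra.IsAlgebraic ℚ_[p] L] [Algebra k L]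
  [IsScalarTower ℚ_[p] k L]

/-- The relation "`y ∈ Ā(𝔽_K)` is the reduction of `x ∈ A(K)`": some `O_K`-point of the model has
generic fibre `x` and special fibre `y`. -/
def IsReduction (x : specOver k K ⟶ A)
    (y : specOver (padicResidueField p k) (ResidueField (padicInt p K)) ⟶ 𝒳.reduction) : Prop :=
  ∃ z : Spec (.of (padicInt p K)) ⟶ 𝒳.X.left,
    z ≫ 𝒳.X.hom = Spec.map (CommRingCat.ofHom (padicIntBase p k K)) ∧
    Spec.map (CommRingCat.ofHom (padicInt p K).subtype) ≫ z = x.left ≫ 𝒳.genericProj ∧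
    Spec.map (CommRingCat.ofHom (residue (padicInt p K))) ≫ z = y.left ≫ 𝒳.specialProj

lemma specialBase_eq :
    Spec.map (CommRingCat.ofHom (residue (padicInt p K))) ≫
      Spec.map (CommRingCat.ofHom (padicIntBase p k K)) =
    Spec.map (CommRingCat.ofHom (algebraMap (padicResidueField p k)
      (ResidueField (padicInt p K)))) ≫ specResidueMap p k := by
  rw [← Spec.map_comp, ← Spec.map_comp]
  rfl

lemma genericBase_eq :
    Spec.map (CommRingCat.ofHom (padicInt p K).subtype) ≫
      Spec.map (CommRingCat.ofHom (padicIntBase p k K)) =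
    Spec.map (CommRingCat.ofHom (algebraMap k K)) ≫ specFracMap p k := by
  rw [← Spec.map_comp, ← Spec.map_comp]
  rfl

variable {𝒳}

/-- Reduction is compatible with extensions of the base field. -/
lemma IsReduction.map (f : K →ₐ[k] L) {x : specOver k K ⟶ A}
    {y : specOver (padicResidueField p k) (ResidueField (padicInt p K)) ⟶ 𝒳.reduction}
    (h : 𝒳.IsReduction x y) :
    𝒳.IsReduction (specOverMap f ≫ x) (specOverMap (padicResidueAlgHom p f) ≫ y) := by
  obtain ⟨z, hz1, hz2, hz3⟩ := h
  refine ⟨Spec.map (CommRingCat.ofHom (padicInt.map (f.restrictScalars ℚ_[p]))) ≫ z, ?_, ?_, ?_⟩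
  · rw [Category.assoc, hz1, ← Spec.map_comp]
    congr 2
    ext r
    exact f.commutes (r : k)
  · have h1 : (specOverMap f ≫ x).left ≫ 𝒳.genericProj =
        Spec.map (CommRingCat.ofHom f.toRingHom) ≫ x.left ≫ 𝒳.genericProj :=
      Category.assoc _ _ _
    rw [h1, ← hz2, ← Category.assoc, ← Category.assoc, ← Spec.map_comp, ← Spec.map_comp]
    rfl
  · have h1 : (specOverMap (padicResidueAlgHom p f) ≫ y).left ≫ 𝒳.specialProj =
        Spec.map (CommRingCat.ofHom (padicResidueAlgHom p f).toRingHom) ≫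
          y.left ≫ 𝒳.specialProj :=
      Category.assoc _ _ _
    rw [h1, ← hz3, ← Category.assoc, ← Category.assoc, ← Spec.map_comp, ← Spec.map_comp]
    rfl

variable (𝒳)

/-- Every point has a reduction, by the valuative criterion. -/
lemma exists_isReduction (x : specOver k K ⟶ A) : ∃ y, 𝒳.IsReduction x y := by
  have hp : IsProper 𝒳.X.hom := 𝒳.isAbelianScheme.proper
  have hx : (x.left ≫ 𝒳.genericProj) ≫ 𝒳.X.hom =
      Spec.map (CommRingCat.ofHom ((algebraMap (padicInt p K) K).comp (padicIntBase p k K))) := by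
    rw [Category.assoc, genericProj_comp, ← Category.assoc]
    have h1 : x.left ≫ A.hom = Spec.map (CommRingCat.ofHom (algebraMap k K)) := Over.w x
    rw [h1, ← genericBase_eq, ← Spec.map_comp]
    rfl
  obtain ⟨z, hz1, hz2⟩ := exists_extension_of_isProper 𝒳.X.hom (padicIntBase p k K) _ hx
  obtain ⟨y, hy1, hy2⟩ := 𝒳.exists_specialProj_eq
    (Spec.map (CommRingCat.ofHom (residue (padicInt p K))) ≫ z)
    (Spec.map (CommRingCat.ofHom (algebraMap (padicResidueField p k)
      (ResidueField (padicInt p K))))) (by rw [Category.assoc, hz1, specialBase_eq])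
  exact ⟨Over.homMk y hy1, z, hz1, hz2, hy2.symm⟩

/-- Every point of the special fibre lifts, because the model is smooth and `O_K` is complete. -/
lemma exists_isReduction_of_finite [FiniteDimensional ℚ_[p] K]
    (y : specOver (padicResidueField p k) (ResidueField (padicInt p K)) ⟶ 𝒳.reduction) :
    ∃ x : specOver k K ⟶ A, 𝒳.IsReduction x y := by
  have hs : Smooth 𝒳.X.hom := 𝒳.isAbelianScheme.smooth
  have hy : (y.left ≫ 𝒳.specialProj) ≫ 𝒳.X.hom =
      Spec.map (CommRingCat.ofHom ((residue (padicInt p K)).comp (padicIntBase p k K))) := by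
    rw [Category.assoc, specialProj_comp, ← Category.assoc]
    have h1 : y.left ≫ 𝒳.reduction.hom = Spec.map (CommRingCat.ofHom
      (algebraMap (padicResidueField p k) (ResidueField (padicInt p K)))) := Over.w y
    rw [h1, ← specialBase_eq, ← Spec.map_comp]
    rfl
  obtain ⟨z, hz1, hz2⟩ := exists_lift_of_smooth 𝒳.X.hom (padicIntBase p k K) _ hy
  obtain ⟨x, hx1, hx2⟩ := 𝒳.exists_genericProj_eq
    (Spec.map (CommRingCat.ofHom (padicInt p K).subtype) ≫ z)
    (Spec.map (CommRingCat.ofHom (algebraMap k K)))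
    (by rw [Category.assoc, hz1, genericBase_eq])
  exact ⟨Over.homMk x hx1, z, hz1, hx2.symm, hz2⟩

end Relation

section Homomorphism

variable (p k) in
/-- The residue field of the algebraic closure of `k`. -/
abbrev GeomResidueField : Type u := ResidueField (padicInt p (AlgebraicClosure k))

/-- Points with values in `k̄` extend uniquely to the valuation ring, by the valuative criterion. -/
lemma toGeneric_bijective : Function.Bijective 𝒳.toGeneric := by
  have hp : IsProper 𝒳.X.hom := 𝒳.isAbelianScheme.proper
  constructor
  · intro z z' h
    ext1
    exact extension_unique_of_isSeparated 𝒳.X.hom (padicIntMap p k)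
      (K := AlgebraicClosure k) (Over.w z) (Over.w z') (congrArg CommaMorphism.left h)
  · intro x
    have hx : x.left ≫ 𝒳.X.hom = Spec.map (CommRingCat.ofHom ((algebraMap
        (padicInt p (AlgebraicClosure k)) (AlgebraicClosure k)).comp (padicIntMap p k))) := by
      have h1 : x.left ≫ 𝒳.X.hom = Spec.map (CommRingCat.ofHom (algebraMap k (AlgebraicClosure k)))
        ≫ specFracMap p k := Over.w x
      rw [h1, ← Spec.map_comp]
      rfl
    obtain ⟨z, hz1, hz2⟩ := exists_extension_of_isProper 𝒳.X.hom (padicIntMap p k) _ hx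
    exact ⟨Over.homMk z hz1, by ext1; exact hz2⟩

lemma ofGenericFibre_left (x : specOver k (AlgebraicClosure k) ⟶ A) :
    (𝒳.ofGenericFibre x).left = x.left ≫ 𝒳.genericProj := by
  simp [ofGenericFibre, genericProj, Over.mapPullbackAdj]

/-- The isomorphism `Ā(𝔽̄) → X(𝔽̄)`, induced by `Ā = X ×_{O_k} 𝔽 → X`. -/
noncomputable def ofSpecialFibre :
    (specOver (padicResidueField p k) (GeomResidueField p k) ⟶ 𝒳.reduction) →*
      (specSpecial p k ⟶ 𝒳.X) where
  toFun y := (Over.homMk (𝟙 _) (by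
      rw [Category.id_comp]
      exact specialBase_eq.symm) : specSpecial p k ⟶ (Over.map (specResidueMap p k)).obj
        (specOver (padicResidueField p k) (GeomResidueField p k))) ≫
      ((Over.mapPullbackAdj (specResidueMap p k)).homEquiv _ _).symm y
  map_one' := by
    have h : ((Over.mapPullbackAdj (specResidueMap p k)).homEquiv (specOver (padicResidueField p k)
        (GeomResidueField p k)) 𝒳.X).symm 1 = 1 := by
      rw [Equiv.symm_apply_eq, Adjunction.homEquiv_unit, Functor.map_one, MonObj.comp_one]
    rw [h, MonObj.comp_one]
  map_mul' x y := by
    have h : ((Over.mapPullbackAdj (specResidueMap p k)).homEquiv (specOver (padicResidueField p k)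
        (GeomResidueField p k)) 𝒳.X).symm (x * y) =
        ((Over.mapPullbackAdj (specResidueMap p k)).homEquiv _ _).symm x *
        ((Over.mapPullbackAdj (specResidueMap p k)).homEquiv _ _).symm y := by
      rw [Equiv.symm_apply_eq, Adjunction.homEquiv_unit, Functor.map_mul,
        MonObj.comp_mul, ← Adjunction.homEquiv_unit, ← Adjunction.homEquiv_unit,
        Equiv.apply_symm_apply, Equiv.apply_symm_apply]
    rw [h, MonObj.comp_mul]

lemma ofSpecialFibre_left
    (y : specOver (padicResidueField p k) (GeomResidueField p k) ⟶ 𝒳.reduction) :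
    (𝒳.ofSpecialFibre y).left = y.left ≫ 𝒳.specialProj := by
  simp [ofSpecialFibre, specialProj, Over.mapPullbackAdj]

lemma ofSpecialFibre_bijective : Function.Bijective 𝒳.ofSpecialFibre := by
  constructor
  · intro y y' h
    ext1
    apply 𝒳.specialProj_hom_ext
    · rw [← ofSpecialFibre_left, h, ofSpecialFibre_left]
    · exact (Over.w y).trans (Over.w y').symm
  · intro m
    obtain ⟨y, hy1, hy2⟩ := 𝒳.exists_specialProj_eq m.left
      (Spec.map (CommRingCat.ofHom (algebraMap (padicResidueField p k) (GeomResidueField p k))))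
      ((Over.w m).trans specialBase_eq)
    refine ⟨Over.homMk y hy1, ?_⟩
    ext1
    rw [ofSpecialFibre_left]
    exact hy2

/-- The reduction homomorphism `A(k̄) → Ā(𝔽̄)`. -/
noncomputable def reductionHom [IsAbelianScheme A] :
    AVPoints A (AlgebraicClosure k) →+ AVPoints 𝒳.reduction (GeomResidueField p k) :=
  MonoidHom.toAdditive ((MulEquiv.ofBijective _ 𝒳.ofSpecialFibre_bijective).symm.toMonoidHom.comp
    (𝒳.toSpecial.comp ((MulEquiv.ofBijective _ 𝒳.toGeneric_bijective).symm.toMonoidHom.comp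
      𝒳.ofGenericFibre)))

lemma ofSpecialFibre_reductionHom [IsAbelianScheme A] (x : AVPoints A (AlgebraicClosure k))
    (z : specInt p k ⟶ 𝒳.X) (hz : 𝒳.toGeneric z = 𝒳.ofGenericFibre x.toMul) :
    𝒳.ofSpecialFibre (𝒳.reductionHom x).toMul = 𝒳.toSpecial z := by
  have h1 : (MulEquiv.ofBijective _ 𝒳.toGeneric_bijective).symm (𝒳.ofGenericFibre x.toMul) = z := by
    rw [MulEquiv.symm_apply_eq]
    exact hz.symm
  have h2 : (𝒳.reductionHom x).toMul =
      (MulEquiv.ofBijective _ 𝒳.ofSpecialFibre_bijective).symm (𝒳.toSpecial z) := by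
    rw [← h1]
    rfl
  rw [h2]
  exact (MulEquiv.ofBijective _ 𝒳.ofSpecialFibre_bijective).apply_symm_apply _

lemma reductionHom_eq_of_isReduction [IsAbelianScheme A] {x : AVPoints A (AlgebraicClosure k)}
    {y : AVPoints 𝒳.reduction (GeomResidueField p k)} (h : 𝒳.IsReduction x.toMul y.toMul) :
    𝒳.reductionHom x = y := by
  obtain ⟨z, hz1, hz2, hz3⟩ := h
  let z' : specInt p k ⟶ 𝒳.X := Over.homMk z hz1
  have h1 := 𝒳.ofSpecialFibre_reductionHom x z' (by
    ext1
    rw [ofGenericFibre_left]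
    exact hz2)
  have h2 : 𝒳.ofSpecialFibre y.toMul = 𝒳.toSpecial z' := by
    ext1
    rw [ofSpecialFibre_left]
    exact hz3.symm
  exact 𝒳.ofSpecialFibre_bijective.1 (h1.trans h2.symm)

lemma reductionHom_eq_zero_iff [IsAbelianScheme A] (x : AVPoints A (AlgebraicClosure k)) :
    𝒳.reductionHom x = 0 ↔ x ∈ 𝒳.kernelOfReduction := by
  have h0 : 𝒳.reductionHom x = 0 ↔ 𝒳.ofSpecialFibre (𝒳.reductionHom x).toMul = 1 :=
    (map_eq_one_iff 𝒳.ofSpecialFibre 𝒳.ofSpecialFibre_bijective.1).symm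
  rw [h0]
  constructor
  · intro h
    obtain ⟨z, hz⟩ := 𝒳.toGeneric_bijective.2 (𝒳.ofGenericFibre x.toMul)
    rw [𝒳.ofSpecialFibre_reductionHom x z hz] at h
    exact ⟨z, h, hz⟩
  · rintro ⟨z, hz, hzx⟩
    rw [𝒳.ofSpecialFibre_reductionHom x z hzx]
    exact hz

end Homomorphism

end GoodReduction

end ReductionOfPoints

/-! ### The quotient of an abelian variety by its formal group -/

section FiniteExtensions

open IsLocalRing

variable {k : Type u} [Field k]

/-- Finitely many elements of `k̄` lie in a finite extension of `k`. -/
lemma exists_finExt_range (S : Set (AlgebraicClosure k)) (hS : S.Finite) :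
    ∃ (L : FinExt k) (θ : L →ₐ[k] AlgebraicClosure k), S ⊆ Set.range θ := by
  let F : IntermediateField k (AlgebraicClosure k) := IntermediateField.adjoin k S
  have hF : FiniteDimensional k F := by
    have := hS.to_subtype
    exact IntermediateField.finiteDimensional_adjoin fun x _ =>
      (Algebra.IsAlgebraic.isAlgebraic x).isIntegral
  exact ⟨⟨F⟩, F.val, fun x hx => ⟨⟨x, IntermediateField.subset_adjoin k S hx⟩, rfl⟩⟩

section GaloisDescent

variable [CharZero k]

/-- Two embeddings of a finite extension into the algebraic closure are conjugate. -/
lemma exists_galois_comp_eq {K : Type*} [Field K] [Algebra k K]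
    (τ τ' : K →ₐ[k] AlgebraicClosure k) : ∃ σ : Gal(AlgebraicClosure k/k),
      (σ : AlgebraicClosure k →ₐ[k] AlgebraicClosure k).comp τ = τ' := by
  let χ : τ.fieldRange ≃ₐ[k] τ'.fieldRange :=
    (AlgEquiv.ofInjectiveField τ).symm.trans (AlgEquiv.ofInjectiveField τ')
  refine ⟨χ.liftNormal (AlgebraicClosure k), ?_⟩
  ext x
  have h1 := χ.liftNormal_commutes (AlgebraicClosure k) (AlgEquiv.ofInjectiveField τ x)
  have h2 : χ (AlgEquiv.ofInjectiveField τ x) = AlgEquiv.ofInjectiveField τ' x := by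
    change AlgEquiv.ofInjectiveField τ' ((AlgEquiv.ofInjectiveField τ).symm
      (AlgEquiv.ofInjectiveField τ x)) = _
    rw [AlgEquiv.symm_apply_apply]
  rw [h2] at h1
  exact h1

/-- Galois descent for elements of `k̄`. -/
lemma mem_range_of_galois_fixed {K : Type*} [Field K] [Algebra k K]
    (τ : K →ₐ[k] AlgebraicClosure k) (c : AlgebraicClosure k)
    (hc : ∀ σ : Gal(AlgebraicClosure k/k),
      (σ : AlgebraicClosure k →ₐ[k] AlgebraicClosure k).comp τ = τ → σ c = c) :
    c ∈ Set.range τ := by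
  have hgal : IsGalois k (AlgebraicClosure k) := inferInstance
  have h1 : c ∈ IntermediateField.fixedField τ.fieldRange.fixingSubgroup := by
    rintro ⟨σ, hσ⟩
    refine hc σ ?_
    ext x
    exact hσ ⟨τ x, ⟨x, rfl⟩⟩
  rw [InfiniteGalois.fixedField_fixingSubgroup] at h1
  exact h1

/-- Galois descent for points: an equivariant family of points indexed by the embeddings of `K`
comes from a `K`-rational point. -/
lemma exists_point_of_mem_galoisObj (A : Over (Spec (.of k))) [GrpObj A] [IsAbelianScheme A]
    (K : FinExt k) (φ : MackeyFunctor.galoisObj (avRep A) K) :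
    ∃ x : AVPoints A K, ∀ τ : K →ₐ[k] AlgebraicClosure k, φ.1 τ = AVPoints.map A τ x := by
  have hpr : IsProper A.hom := IsAbelianScheme.proper
  let τ : K →ₐ[k] AlgebraicClosure k := IsAlgClosed.lift
  obtain ⟨C, -, hC1, hC2⟩ := exists_finite_coordinates (φ.1 τ).toMul
  obtain ⟨x, hx⟩ := hC1 K τ fun c hc => mem_range_of_galois_fixed τ c fun σ hσ => by
    have h1 := φ.2 σ τ
    rw [hσ] at h1
    exact hC2 (σ : AlgebraicClosure k →ₐ[k] AlgebraicClosure k)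
      (congrArg Additive.toMul h1.symm) c hc
  refine ⟨Additive.ofMul x, fun τ' => ?_⟩
  obtain ⟨σ, rfl⟩ := exists_galois_comp_eq τ τ'
  rw [φ.2 σ τ]
  refine congrArg Additive.ofMul ?_
  change specOverMap _ ≫ (φ.1 τ).toMul = specOverMap _ ≫ x
  rw [specOverMap_comp, Category.assoc, hx]

end GaloisDescent

variable {p : ℕ} [Fact p.Prime] [Algebra ℚ_[p] k] [FiniteDimensional ℚ_[p] k]

/-- A finite extension of `k` is an extension of `ℚ_p` through `k`. -/
noncomputable instance FinExt.padicAlgebra (K : FinExt k) : Algebra ℚ_[p] K :=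
  ((algebraMap k K).comp (algebraMap ℚ_[p] k)).toAlgebra

instance FinExt.padicScalarTower (K : FinExt k) : IsScalarTower ℚ_[p] k K :=
  .of_algebraMap_eq fun _ => rfl

instance FinExt.padicFiniteDimensional (K : FinExt k) : FiniteDimensional ℚ_[p] K :=
  .trans ℚ_[p] k K

variable (p) in
/-- The residue field of a finite extension of `k`. -/
abbrev FinExt.ResField (K : FinExt k) : Type u := ResidueField (padicInt p K)

lemma AVPoints.map_comp {k : Type u} [Field k] (A : Over (Spec (.of k))) [GrpObj A]
    [IsAbelianScheme A] {S S' S'' : Type u} [CommRing S] [CommRing S'] [CommRing S'']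
    [Algebra k S] [Algebra k S'] [Algebra k S''] (g : S' →ₐ[k] S'') (f : S →ₐ[k] S')
    (x : AVPoints A S) : AVPoints.map A (g.comp f) x = AVPoints.map A g (AVPoints.map A f x) := by
  refine congrArg Additive.ofMul ?_
  change specOverMap (g.comp f) ≫ x.toMul = specOverMap g ≫ specOverMap f ≫ x.toMul
  rw [specOverMap_comp, Category.assoc]

lemma AVPoints.map_id {k : Type u} [Field k] (A : Over (Spec (.of k))) [GrpObj A]
    [IsAbelianScheme A] {S : Type u} [CommRing S] [Algebra k S] (x : AVPoints A S) :
    AVPoints.map A (AlgHom.id k S) x = x := by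
  refine congrArg Additive.ofMul ?_
  change specOverMap (AlgHom.id k S) ≫ x.toMul = x.toMul
  have h : specOverMap (AlgHom.id k S) = 𝟙 _ := by
    ext1
    exact Spec.map_id _
  rw [h, Category.id_comp]

lemma AVPoints.map_injective {k : Type u} [Field k] (A : Over (Spec (.of k))) [GrpObj A]
    [IsAbelianScheme A] {E Ω : Type u} [Field E] [Field Ω] [Algebra k E] [Algebra k Ω]
    (i : E →ₐ[k] Ω) : Function.Injective (AVPoints.map A i) := fun _ _ h =>
  congrArg Additive.ofMul (specOverMap_comp_injective i (congrArg Additive.toMul h))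

/-- `exists_finite_coordinates` for the points of an abelian variety. -/
lemma AVPoints.exists_finite_coordinates {k : Type u} [Field k] (A : Over (Spec (.of k)))
    [GrpObj A] [IsAbelianScheme A] {Ω : Type u} [Field Ω] [Algebra k Ω]
    (x : AVPoints A Ω) : ∃ C : Set Ω, C.Finite ∧
      (∀ (E : Type u) [Field E] [Algebra k E] (i : E →ₐ[k] Ω), C ⊆ Set.range i →
        ∃ y : AVPoints A E, AVPoints.map A i y = x) ∧
      ∀ g : Ω →ₐ[k] Ω, AVPoints.map A g x = x → ∀ c ∈ C, g c = c := by
  have hpr : IsProper A.hom := IsAbelianScheme.proper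
  obtain ⟨C, hC, hC1, hC2⟩ := _root_.exists_finite_coordinates x.toMul
  refine ⟨C, hC, fun E _ _ i hi => ?_, fun g hg => hC2 g (congrArg Additive.toMul hg)⟩
  obtain ⟨y, hy⟩ := hC1 E i hi
  exact ⟨Additive.ofMul y, congrArg Additive.ofMul hy⟩

namespace GoodReduction

variable {A : Over (Spec (.of k))} [GrpObj A] (𝒳 : GoodReduction p A) [IsAbelianScheme A]

/-- The reduction of a class in `A(K) / Â(K)` along an embedding `τ : K → k̄`. -/
noncomputable def abarReduction (K : FinExt k) (τ : K →ₐ[k] AlgebraicClosure k) :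
    𝒳.abarMackey.obj K →+ AVPoints 𝒳.reduction (GeomResidueField p k) :=
  QuotientAddGroup.lift _
    { toFun := fun φ : MackeyFunctor.galoisObj (avRep A) K => 𝒳.reductionHom (φ.1 τ)
      map_zero' := map_zero _
      map_add' := fun φ ψ => map_add _ (φ.1 τ) (ψ.1 τ) }
    fun _ hφ => (𝒳.reductionHom_eq_zero_iff _).mpr (hφ τ)

lemma abarReduction_res {K L : FinExt k} (f : K →ₐ[k] L) (τ : L →ₐ[k] AlgebraicClosure k)
    (b : 𝒳.abarMackey.obj K) :
    𝒳.abarReduction L τ (𝒳.abarMackey.res f b) = 𝒳.abarReduction K (τ.comp f) b := by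
  induction b using QuotientAddGroup.induction_on with
  | H φ => rfl

open Classical in
lemma abarReduction_norm {K L : FinExt k} (f : K →ₐ[k] L) (τ : K →ₐ[k] AlgebraicClosure k)
    (b : 𝒳.abarMackey.obj L) :
    𝒳.abarReduction K τ (𝒳.abarMackey.norm f b) =
      ∑ θ : L →ₐ[k] AlgebraicClosure k with θ.comp f = τ, 𝒳.abarReduction L θ b := by
  induction b using QuotientAddGroup.induction_on with
  | H φ => exact map_sum 𝒳.reductionHom _ _

/-- A class in `A(K) / Â(K)` is determined by its reductions. -/
lemma abarReduction_injective {K : FinExt k} {b : 𝒳.abarMackey.obj K}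
    (h : ∀ τ, 𝒳.abarReduction K τ b = 0) : b = 0 := by
  induction b using QuotientAddGroup.induction_on with
  | H φ =>
    refine (QuotientAddGroup.eq_zero_iff _).mpr fun τ => ?_
    exact (𝒳.reductionHom_eq_zero_iff _).mp (h τ)

/-- The reductions of a class in `A(K) / Â(K)` along all embeddings come from one `𝔽_K`-point. -/
lemma exists_abarReduction_eq [CharZero k] (K : FinExt k) (b : 𝒳.abarMackey.obj K) :
    ∃ y : AVPoints 𝒳.reduction (K.ResField p), ∀ τ,
      𝒳.abarReduction K τ b = AVPoints.map _ (padicResidueAlgHom p τ) y := by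
  induction b using QuotientAddGroup.induction_on with
  | H φ =>
    obtain ⟨x, hx⟩ := exists_point_of_mem_galoisObj A K φ
    obtain ⟨y, hy⟩ := 𝒳.exists_isReduction x.toMul
    refine ⟨Additive.ofMul y, fun τ => ?_⟩
    change 𝒳.reductionHom (φ.1 τ) = _
    rw [hx τ]
    exact 𝒳.reductionHom_eq_of_isReduction (hy.map τ)

/-- Every `𝔽_K`-point is the reduction of a class in `A(K) / Â(K)`. -/
lemma exists_abarReduction_eq' (K : FinExt k) (y : AVPoints 𝒳.reduction (K.ResField p)) :
    ∃ b : 𝒳.abarMackey.obj K, ∀ τ,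
      𝒳.abarReduction K τ b = AVPoints.map _ (padicResidueAlgHom p τ) y := by
  obtain ⟨x, hx⟩ := 𝒳.exists_isReduction_of_finite (K := K) y.toMul
  let φ : MackeyFunctor.galoisObj (avRep A) K :=
    ⟨fun τ => AVPoints.map A τ (Additive.ofMul x), fun σ τ => AVPoints.map_comp A _ _ _⟩
  exact ⟨QuotientAddGroup.mk φ, fun τ => 𝒳.reductionHom_eq_of_isReduction (hx.map τ)⟩

variable [CharZero k]

/-- The isomorphism `A(K) / Â(K) ≃ Ā(𝔽_K)`. -/
noncomputable def abarEquiv (K : FinExt k) :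
    𝒳.abarMackey.obj K ≃+ AVPoints 𝒳.reduction (K.ResField p) :=
  have hinj : ∀ y y' : AVPoints 𝒳.reduction (K.ResField p),
      (∀ τ : K →ₐ[k] AlgebraicClosure k, AVPoints.map _ (padicResidueAlgHom p τ) y =
        AVPoints.map _ (padicResidueAlgHom p τ) y') → y = y' := fun _ _ h =>
    AVPoints.map_injective 𝒳.reduction _ (h IsAlgClosed.lift)
  AddEquiv.ofBijective
    (AddMonoidHom.mk' (fun b => (𝒳.exists_abarReduction_eq K b).choose) fun b b' =>
      hinj _ _ fun τ => by
        rw [map_add, ← (𝒳.exists_abarReduction_eq K b).choose_spec,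
          ← (𝒳.exists_abarReduction_eq K b').choose_spec,
          ← (𝒳.exists_abarReduction_eq K (b + b')).choose_spec, map_add])
    ⟨fun b b' h => by
      rw [← sub_eq_zero]
      refine 𝒳.abarReduction_injective fun τ => ?_
      change (𝒳.exists_abarReduction_eq K b).choose =
        (𝒳.exists_abarReduction_eq K b').choose at h
      rw [map_sub, (𝒳.exists_abarReduction_eq K b).choose_spec, h,
        ← (𝒳.exists_abarReduction_eq K b').choose_spec, sub_self],
    fun y => by
      obtain ⟨b, hb⟩ := 𝒳.exists_abarReduction_eq' K y
      exact ⟨b, hinj _ _ fun τ =>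
        ((𝒳.exists_abarReduction_eq K b).choose_spec τ).symm.trans (hb τ)⟩⟩

lemma map_abarEquiv (K : FinExt k) (b : 𝒳.abarMackey.obj K)
    (τ : K →ₐ[k] AlgebraicClosure k) :
    AVPoints.map _ (padicResidueAlgHom p τ) (𝒳.abarEquiv K b) = 𝒳.abarReduction K τ b :=
  ((𝒳.exists_abarReduction_eq K b).choose_spec τ).symm

lemma abarEquiv_res {K L : FinExt k} (f : K →ₐ[k] L) (b : 𝒳.abarMackey.obj K) :
    𝒳.abarEquiv L (𝒳.abarMackey.res f b) =
      AVPoints.map _ (padicResidueAlgHom p f) (𝒳.abarEquiv K b) := by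
  apply AVPoints.map_injective 𝒳.reduction (padicResidueAlgHom p (IsAlgClosed.lift :
    L →ₐ[k] AlgebraicClosure k))
  rw [map_abarEquiv, abarReduction_res, ← AVPoints.map_comp, ← padicResidueAlgHom_comp,
    map_abarEquiv]

end GoodReduction

variable (p k) in
/-- Finitely many elements of the residue field of `k̄` lie in the residue field of a finite
extension of `k`. -/
lemma exists_finExt_range_residue (C : Set (GoodReduction.GeomResidueField p k)) (hC : C.Finite) :
    ∃ (L : FinExt k) (θ : L →ₐ[k] AlgebraicClosure k),
      C ⊆ Set.range (padicResidueAlgHom p θ) := by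
  choose r hr using fun c : GoodReduction.GeomResidueField p k => residue_surjective c
  let S : Set (AlgebraicClosure k) := (fun c => (r c : AlgebraicClosure k)) '' C
  have hS : S.Finite := hC.image _
  obtain ⟨L, θ, hθ⟩ := exists_finExt_range S hS
  refine ⟨L, θ, fun c hc => ?_⟩
  obtain ⟨x, hxc⟩ := hθ ⟨c, hc, rfl⟩
  have hx : x ∈ padicInt p L := by
    rw [mem_padicInt, ← spectralNorm_algHom (θ.restrictScalars ℚ_[p]) x]
    exact hxc ▸ (r c).2
  refine ⟨residue _ ⟨x, hx⟩, ?_⟩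
  rw [padicResidueAlgHom_residue, ← hr c]
  exact congrArg _ (Subtype.ext hxc)

namespace GoodReduction

variable {A : Over (Spec (.of k))} [GrpObj A] (𝒳 : GoodReduction p A) [IsAbelianScheme A]

/-- A geometric point of the special fibre is defined over a finite field, and so it lifts to a
finite extension of `k`. -/
lemma reductionHom_surjective : Function.Surjective 𝒳.reductionHom := by
  intro m
  obtain ⟨C, hC, hC1, -⟩ := AVPoints.exists_finite_coordinates 𝒳.reduction m
  obtain ⟨L, θ, hθ⟩ := exists_finExt_range_residue k p C hC
  obtain ⟨y, hy⟩ := hC1 _ (padicResidueAlgHom p θ) hθ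
  obtain ⟨x, hx⟩ := 𝒳.exists_isReduction_of_finite (K := L) y.toMul
  refine ⟨AVPoints.map A θ (Additive.ofMul x), ?_⟩
  rw [← hy]
  exact 𝒳.reductionHom_eq_of_isReduction (hx.map θ)

/-- The geometric points of the reduction are divisible, even by the residue characteristic: they
are reductions of points in characteristic zero. -/
lemma exists_nsmul_eq [CharZero k] {N : ℕ} (hN : N ≠ 0)
    (m : AVPoints 𝒳.reduction (GeomResidueField p k)) : ∃ m', N • m' = m := by
  obtain ⟨x, rfl⟩ := 𝒳.reductionHom_surjective m
  obtain ⟨x', hx'⟩ := exists_pow_eq A hN x.toMul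
  let x'' : AVPoints A (AlgebraicClosure k) := Additive.ofMul x'
  exact ⟨𝒳.reductionHom x'', (map_nsmul 𝒳.reductionHom N x'').symm.trans
    (congrArg _ (congrArg Additive.ofMul hx'))⟩

end GoodReduction

end FiniteExtensions

/-! ### Ramification and embeddings -/

section Ramification

open IsLocalRing Polynomial

/-- The number of extensions of an embedding `τ : K → Ω` to `L` is the degree of `L` over `K`. -/
lemma card_algHom_comp_eq_mul_finrank {k K L Ω : Type*} [Field k] [Field K] [Field L] [Field Ω]
    [Algebra k K] [Algebra k L] [Algebra k Ω] [IsAlgClosed Ω] [PerfectField K]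
    [FiniteDimensional k L] (f : K →ₐ[k] L) (τ : K →ₐ[k] Ω) :
    Nat.card {θ : L →ₐ[k] Ω // θ.comp f = τ} * Module.finrank k K = Module.finrank k L := by
  let _ : Algebra K L := f.toRingHom.toAlgebra
  let _ : Algebra K Ω := τ.toRingHom.toAlgebra
  have _ : IsScalarTower k K L := .of_algebraMap_eq fun x => (f.commutes x).symm
  have _ : IsScalarTower k K Ω := .of_algebraMap_eq fun x => (τ.commutes x).symm
  have _ : FiniteDimensional K L := FiniteDimensional.right k K L
  let e : {θ : L →ₐ[k] Ω // θ.comp f = τ} ≃ (L →ₐ[K] Ω) :=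
    { toFun := fun θ => { θ.1 with commutes' := fun x => DFunLike.congr_fun θ.2 x }
      invFun := fun θ => ⟨θ.restrictScalars k, AlgHom.ext fun x => θ.commutes x⟩
      left_inv := fun _ => rfl
      right_inv := fun _ => rfl }
  rw [Nat.card_congr e, Nat.card_eq_fintype_card, AlgHom.card, mul_comm,
    Module.finrank_mul_finrank]

open Classical in
/-- Adjoining a root of an irreducible polynomial to a finite extension of `k`. -/
lemma exists_finExt_root {k : Type u} [Field k] [CharZero k] (K : FinExt k) (g : K[X])
    (hg : g.Monic) (hirr : Irreducible g) :
    ∃ (L : FinExt k) (f : K →ₐ[k] L) (x : L),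
      Module.finrank k L = g.natDegree * Module.finrank k K ∧
      g.eval₂ (f : K →+* L) x = 0 ∧
      (∀ (Ω : Type u) [Field Ω] [Algebra k Ω] (τ : K →ₐ[k] Ω) (α : Ω),
        g.eval₂ (τ : K →+* Ω) α = 0 → ∃ θ : L →ₐ[k] Ω, θ.comp f = τ ∧ θ x = α) ∧
      (∀ (Ω : Type u) [Field Ω] [Algebra k Ω] (θ θ' : L →ₐ[k] Ω),
        θ.comp f = θ'.comp f → θ x = θ' x → θ = θ') ∧
      ∀ τ : K →ₐ[k] AlgebraicClosure k,
        ∏ θ : L →ₐ[k] AlgebraicClosure k with θ.comp f = τ, θ x =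
          (-1) ^ g.natDegree * τ (g.coeff 0) := by
  have : Fact (Irreducible g) := ⟨hirr⟩
  have : FiniteDimensional K (AdjoinRoot g) := hg.finite_adjoinRoot
  have : FiniteDimensional k (AdjoinRoot g) := .trans k K (AdjoinRoot g)
  let L : FinExt k := ⟨AdjoinRoot g⟩
  let f : K →ₐ[k] L := AdjoinRoot.ofAlgHom k g
  let x : L := AdjoinRoot.root g
  have hx : g.eval₂ (f : K →+* L) x = 0 := AdjoinRoot.eval₂_root g
  have hex : ∀ (Ω : Type u) [Field Ω] [Algebra k Ω] (τ : K →ₐ[k] Ω) (α : Ω),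
      g.eval₂ (τ : K →+* Ω) α = 0 → ∃ θ : L →ₐ[k] Ω, θ.comp f = τ ∧ θ x = α := by
    intro Ω _ _ τ α h
    refine ⟨AdjoinRoot.liftAlgHom g τ α h, ?_, AdjoinRoot.liftAlgHom_root g τ α h⟩
    ext y
    exact AdjoinRoot.liftAlgHom_of g τ α h y
  have hext : ∀ (Ω : Type u) [Field Ω] [Algebra k Ω] (θ θ' : L →ₐ[k] Ω),
      θ.comp f = θ'.comp f → θ x = θ' x → θ = θ' := by
    intro Ω _ _ θ θ' h h'
    exact AdjoinRoot.algHom_ext' h h'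
  refine ⟨L, f, x, ?_, hx, hex, hext, fun τ => ?_⟩
  · rw [mul_comm, ← Module.finrank_mul_finrank k K (AdjoinRoot g)]
    congr 1
    exact (AdjoinRoot.powerBasis' hg).finrank.trans rfl
  · have : CharZero K := charZero_of_injective_algebraMap (algebraMap k K).injective
    have hnd : (g.map (τ : K →+* AlgebraicClosure k)).roots.Nodup :=
      nodup_roots (hirr.separable.map (f := (τ : K →+* AlgebraicClosure k)))
    have h1 := (IsAlgClosed.splits
      (g.map (τ : K →+* AlgebraicClosure k))).coeff_zero_eq_prod_roots_of_monic (hg.map _)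
    have h2 : (g.map (τ : K →+* AlgebraicClosure k)).roots.prod =
        ∏ θ : L →ₐ[k] AlgebraicClosure k with θ.comp f = τ, θ x := by
      have h3 : (g.map (τ : K →+* AlgebraicClosure k)).roots.prod =
          ∏ α ∈ ⟨(g.map (τ : K →+* AlgebraicClosure k)).roots, hnd⟩, α := by
        rw [Finset.prod, Multiset.map_id']
      rw [h3]
      symm
      refine Finset.prod_bij (fun θ _ => θ x) ?_ ?_ ?_ fun _ _ => rfl
      · intro θ hθ
        rw [Finset.mem_filter] at hθ
        rw [Finset.mem_mk, mem_roots (hg.map _).ne_zero, IsRoot, Polynomial.eval_map]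
        have h4 : (τ : K →+* AlgebraicClosure k) = (θ : L →+* AlgebraicClosure k).comp f := by
          rw [← hθ.2]; rfl
        rw [h4]
        exact (hom_eval₂ g (f : K →+* L) (θ : L →+* AlgebraicClosure k) x).symm.trans
          ((congrArg θ hx).trans (map_zero θ))
      · intro θ hθ θ' hθ' h
        rw [Finset.mem_filter] at hθ hθ'
        exact hext _ θ θ' (hθ.2.trans hθ'.2.symm) h
      · intro α hα
        rw [Finset.mem_mk, mem_roots (hg.map _).ne_zero, IsRoot, Polynomial.eval_map] at hα
        obtain ⟨θ, h5, h6⟩ := hex _ τ α hα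
        exact ⟨θ, by simp [h5], h6⟩
    rw [coeff_map, hg.natDegree_map] at h1
    change τ (g.coeff 0) = _ at h1
    rw [← h2, h1, ← mul_assoc, ← mul_pow]
    simp

variable {p : ℕ} [Fact p.Prime]

section Algebraic

variable {K L : Type*} [Field K] [Field L] [Algebra ℚ_[p] K] [Algebra ℚ_[p] L]
  [Algebra.IsAlgebraic ℚ_[p] K] [Algebra.IsAlgebraic ℚ_[p] L]

/-- The valuation ring is integrally closed. -/
lemma mem_padicInt_of_eval_eq_zero {g : (padicInt p L)[X]} (hg : g.Monic) {x : L}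
    (hx : g.eval₂ (padicInt p L).subtype x = 0) : x ∈ padicInt p L := by
  have : IsIntegral (padicInt p L) x := ⟨g, hg, hx⟩
  obtain ⟨y, rfl⟩ := IsIntegrallyClosed.isIntegral_iff.mp this
  exact y.2

/-- A monic polynomial with integral coefficients splits over the valuation ring of an
algebraically closed field. -/
lemma padicInt_eq_prod_X_sub_C [IsAlgClosed L] {g : (padicInt p L)[X]} (hg : g.Monic) :
    ∃ s : Multiset (padicInt p L), g = (s.map fun a => X - C a).prod := by
  have h1 := (IsAlgClosed.splits (g.map (padicInt p L).subtype)).eq_prod_roots_of_monic (hg.map _)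
  have h2 : ∀ a ∈ (g.map (padicInt p L).subtype).roots, a ∈ padicInt p L := fun a ha =>
    mem_padicInt_of_eval_eq_zero hg (by
      rw [mem_roots (hg.map _).ne_zero, IsRoot, Polynomial.eval_map] at ha
      exact ha)
  lift (g.map (padicInt p L).subtype).roots to Multiset (padicInt p L) using h2 with s hs
  refine ⟨s, map_injective _ Subtype.val_injective (h1.trans ?_)⟩
  rw [Polynomial.map_multiset_prod, Multiset.map_map, Multiset.map_map]
  congr 2
  ext a
  simp

/-- A root of the reduction of a monic polynomial lifts to a root over an algebraically closed
field. -/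
lemma padicInt_exists_root [IsAlgClosed L] {g : (padicInt p L)[X]} (hg : g.Monic)
    {c : ResidueField (padicInt p L)} (hc : (g.map (residue _)).eval c = 0) :
    ∃ a : padicInt p L, g.eval a = 0 ∧ residue _ a = c := by
  obtain ⟨s, rfl⟩ := padicInt_eq_prod_X_sub_C hg
  rw [Polynomial.map_multiset_prod, Multiset.map_map, eval_multiset_prod, Multiset.map_map,
    Multiset.prod_eq_zero_iff, Multiset.mem_map] at hc
  obtain ⟨a, ha, hac⟩ := hc
  refine ⟨a, ?_, ?_⟩
  · rw [eval_multiset_prod, Multiset.map_map, Multiset.prod_eq_zero_iff, Multiset.mem_map]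
    exact ⟨a, ha, by simp⟩
  · simp at hac
    exact (sub_eq_zero.mp hac).symm

/-- The residue field of an algebraically closed field is algebraically closed. -/
instance padicResidueField_isAlgClosed [IsAlgClosed L] :
    IsAlgClosed (ResidueField (padicInt p L)) := by
  refine IsAlgClosed.of_exists_root _ fun h hh hirr => ?_
  obtain ⟨g, rfl, hd, hg⟩ := lifts_and_natDegree_eq_and_monic (f := residue (padicInt p L))
    ((mem_lifts _).mpr (map_surjective _ residue_surjective h)) hh
  obtain ⟨s, rfl⟩ := padicInt_eq_prod_X_sub_C hg
  obtain ⟨a, ha⟩ : ∃ a, a ∈ s := by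
    rw [← Multiset.card_pos_iff_exists_mem, Nat.pos_iff_ne_zero, Ne, Multiset.card_eq_zero]
    rintro rfl
    exact hirr.not_isUnit (by simp)
  refine ⟨residue _ a, ?_⟩
  rw [Polynomial.map_multiset_prod, Multiset.map_map, eval_multiset_prod, Multiset.map_map,
    Multiset.prod_eq_zero_iff, Multiset.mem_map]
  exact ⟨a, ha, by simp⟩

end Algebraic

section Relative

variable {k : Type u} [Field k] [Algebra ℚ_[p] k] [FiniteDimensional ℚ_[p] k]

lemma padicResidueDegree_eq_mul_finrank {K L : Type*} [Field K] [Field L] [Algebra ℚ_[p] K]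
    [Algebra ℚ_[p] L] [FiniteDimensional ℚ_[p] K] [FiniteDimensional ℚ_[p] L]
    [Algebra (ResidueField (padicInt p K)) (ResidueField (padicInt p L))] :
    padicResidueDegree p L = padicResidueDegree p K *
      Module.finrank (ResidueField (padicInt p K)) (ResidueField (padicInt p L)) := by
  have hp : p.Prime := Fact.out
  have h := Module.natCard_eq_pow_finrank (K := ResidueField (padicInt p K))
    (V := ResidueField (padicInt p L))
  rw [card_padicResidueField, card_padicResidueField, ← pow_mul] at h
  exact Nat.pow_right_injective hp.two_le h

variable (p) in
/-- The relative residue degree. -/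
lemma exists_padicResidueDegree_eq_mul {K L : FinExt k} (f : K →ₐ[k] L) :
    ∃ s, 0 < s ∧ padicResidueDegree p L = s * padicResidueDegree p K := by
  let _ : Algebra (K.ResField p) (L.ResField p) := (padicResidueAlgHom p f).toRingHom.toAlgebra
  exact ⟨_, Module.finrank_pos, padicResidueDegree_eq_mul_finrank.trans (mul_comm _ _)⟩

variable (p) in
/-- The relative ramification index, computed from the absolute value of a uniformizer. -/
lemma exists_padicRamification_eq_mul {K L : FinExt k} (f : K →ₐ[k] L) :
    ∃ r, 0 < r ∧ padicRamification p L = r * padicRamification p K := by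
  have hp : p.Prime := Fact.out
  obtain ⟨x, hx0, hx⟩ := exists_padic_uniformizer p K
  obtain ⟨m, hm⟩ := exists_spectralNorm_pow_eq p L (x := f x) (by simpa using hx0)
  have h1 := spectralNorm_algHom (f.restrictScalars ℚ_[p]) x
  change spectralNorm ℚ_[p] L (f x) = _ at h1
  have h2 : (p : ℝ) ^ (-(m * padicRamification p K)) =
      (p : ℝ) ^ (-(padicRamification p L : ℤ)) := by
    rw [← neg_mul, zpow_mul, ← hm, zpow_natCast, pow_right_comm, h1, hx, ← zpow_natCast, ← zpow_mul]
    simp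
  have h3 := neg_injective (zpow_right_injective₀ (by exact_mod_cast hp.pos)
    (by exact_mod_cast hp.one_lt.ne') h2)
  have h4 := padicRamification_pos p L
  have h5 := padicRamification_pos p K
  have h6 : 0 < m := by
    by_contra! h
    nlinarith
  lift m to ℕ using h6.le
  exact ⟨m, by exact_mod_cast h6, by exact_mod_cast h3.symm⟩

/-- The number of extensions of an embedding is `e f`. -/
lemma card_embeddings_eq [CharZero k] {K L : FinExt k} (f : K →ₐ[k] L)
    (τ : K →ₐ[k] AlgebraicClosure k) {r s : ℕ}
    (hr : padicRamification p L = r * padicRamification p K)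
    (hs : padicResidueDegree p L = s * padicResidueDegree p K) :
    Nat.card {θ : L →ₐ[k] AlgebraicClosure k // θ.comp f = τ} = r * s := by
  have : CharZero K := charZero_of_injective_algebraMap (algebraMap k K).injective
  have h1 := card_algHom_comp_eq_mul_finrank f τ
  have h2 := padicRamification_mul_padicResidueDegree p L
  have h3 := padicRamification_mul_padicResidueDegree p K
  rw [← Module.finrank_mul_finrank ℚ_[p] k, ← h1, hr, hs] at h2
  rw [← Module.finrank_mul_finrank ℚ_[p] k] at h3
  have h4 : 0 < padicRamification p K * padicResidueDegree p K :=
    Nat.mul_pos (padicRamification_pos p K) (padicResidueDegree_pos p K)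
  refine (Nat.eq_of_mul_eq_mul_right h4 ?_).symm
  calc _ = _ := by ring
    _ = _ := h2
    _ = _ := by rw [h3]; ring

/-- The number of extensions of an embedding of residue fields is the residue degree. -/
lemma card_residue_embeddings_eq {K L : FinExt k} (f : K →ₐ[k] L)
    (κ : K.ResField p →ₐ[padicResidueField p k] GoodReduction.GeomResidueField p k) {s : ℕ}
    (hs : padicResidueDegree p L = s * padicResidueDegree p K) :
    Nat.card {κ' : L.ResField p →ₐ[padicResidueField p k] GoodReduction.GeomResidueField p k //
      κ'.comp (padicResidueAlgHom p f) = κ} = s := by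
  have h1 := card_algHom_comp_eq_mul_finrank (padicResidueAlgHom p f) κ
  have hK := padicResidueDegree_eq_mul_finrank (p := p) (K := k) (L := K)
  have hL := padicResidueDegree_eq_mul_finrank (p := p) (K := k) (L := L)
  have h2 := padicResidueDegree_pos p K
  rw [hL, ← h1] at hs
  refine Nat.eq_of_mul_eq_mul_right h2 (Eq.trans ?_ hs)
  rw [hK]
  ring

/-- A zero modulo the maximal ideal of a polynomial with separable reduction is a simple zero. -/
lemma isUnit_eval_derivative_of_separable {R : Type*} [CommRing R] [IsLocalRing R] {g : R[X]}
    (hg : (g.map (residue R)).Separable) {a : R} (ha : g.eval a ∈ maximalIdeal R) :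
    IsUnit (g.derivative.eval a) := by
  have h1 : (g.map (residue R)).eval (residue R a) = 0 := by
    rw [eval_map_apply]
    exact (residue_eq_zero_iff _).mpr ha
  have h2 := hg.eval₂_derivative_ne_zero (RingHom.id _) (x := residue R a) h1
  rw [← residue_ne_zero_iff_isUnit]
  intro h3
  apply h2
  rw [eval₂_id, derivative_map, eval_map_apply, h3]

lemma map_residue_map_padicInt {K L : Type*} [Field K] [Field L] [Algebra ℚ_[p] K]
    [Algebra ℚ_[p] L] [Algebra.IsAlgebraic ℚ_[p] K] [Algebra.IsAlgebraic ℚ_[p] L]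
    (f : K →ₐ[ℚ_[p]] L) (g : (padicInt p K)[X]) :
    (g.map (padicInt.map f)).map (residue _) = (g.map (residue _)).map (padicResidueMap f) := by
  rw [Polynomial.map_map, Polynomial.map_map]
  rfl

lemma exists_monic_lift {K : Type*} [Field K] [Algebra ℚ_[p] K] [Algebra.IsAlgebraic ℚ_[p] K]
    {h : (ResidueField (padicInt p K))[X]} (hh : h.Monic) :
    ∃ g : (padicInt p K)[X], g.map (residue _) = h ∧ g.natDegree = h.natDegree ∧ g.Monic :=
  lifts_and_natDegree_eq_and_monic
    ((mem_lifts _).mpr (map_surjective _ residue_surjective h)) hh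

lemma irreducible_map_of_irreducible_residue {K : Type*} [Field K] [Algebra ℚ_[p] K]
    [Algebra.IsAlgebraic ℚ_[p] K] {g : (padicInt p K)[X]} (hg : g.Monic)
    (hirr : Irreducible (g.map (residue _))) : Irreducible (g.map (padicInt p K).subtype) :=
  (hg.irreducible_iff_irreducible_map_fraction_map (K := K)).mp
    (hg.irreducible_of_irreducible_map _ _ hirr)

variable (p) in
/-- The maximal unramified subextension `K₀` of `L / K`: it has the residue field of `L` and the
ramification index of `K`, and its embeddings are determined by their effect on residue fields. -/
lemma exists_unramified_subextension [CharZero k] {K L : FinExt k} (f : K →ₐ[k] L) :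
    ∃ (K₀ : FinExt k) (f₁ : K →ₐ[k] K₀) (f₂ : K₀ →ₐ[k] L), f₂.comp f₁ = f ∧
      Function.Surjective (padicResidueAlgHom p f₂) ∧
      padicRamification p K₀ = padicRamification p K ∧
      padicResidueDegree p K₀ = padicResidueDegree p L ∧
      ∀ θ θ' : K₀ →ₐ[k] AlgebraicClosure k, θ.comp f₁ = θ'.comp f₁ →
        padicResidueAlgHom p θ = padicResidueAlgHom p θ' → θ = θ' := by
  let _ : Algebra (K.ResField p) (L.ResField p) := (padicResidueAlgHom p f).toRingHom.toAlgebra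
  obtain ⟨ζ, hζ⟩ := Field.exists_primitive_element (K.ResField p) (L.ResField p)
  have hζint : IsIntegral (K.ResField p) ζ := Algebra.IsIntegral.isIntegral ζ
  have hdeg : (minpoly (K.ResField p) ζ).natDegree =
      Module.finrank (K.ResField p) (L.ResField p) :=
    (Field.primitive_element_iff_minpoly_natDegree_eq _ ζ).mp hζ
  have hsep : (minpoly (K.ResField p) ζ).Separable := Algebra.IsSeparable.isSeparable _ ζ
  obtain ⟨g, hg1, hg2, hg⟩ := exists_monic_lift (minpoly.monic hζint)
  have hirr : Irreducible (g.map (padicInt p K).subtype) :=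
    irreducible_map_of_irreducible_residue hg (hg1 ▸ minpoly.irreducible hζint)
  obtain ⟨K₀, f₁, x, hfin, hx, hex, hext, -⟩ := exists_finExt_root K _ (hg.map _) hirr
  have hx0 : x ∈ padicInt p K₀ := mem_padicInt_of_eval_eq_zero
    (hg.map (padicInt.map (f₁.restrictScalars ℚ_[p]))) (by
      rw [eval₂_map] at hx ⊢
      exact hx)
  -- Hensel's lemma provides the root in `L` with reduction `ζ`.
  obtain ⟨a₀, ha₀⟩ := residue_surjective ζ
  have hGres : ((g.map (padicInt.map (f.restrictScalars ℚ_[p]))).map (residue _)) =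
      (minpoly (K.ResField p) ζ).map (algebraMap (K.ResField p) (L.ResField p)) := by
    rw [map_residue_map_padicInt, hg1]
    rfl
  have ha₀mem : (g.map (padicInt.map (f.restrictScalars ℚ_[p]))).eval a₀ ∈
      maximalIdeal (padicInt p L) := by
    rw [← residue_eq_zero_iff, ← eval_map_apply, hGres, ha₀, eval_map_algebraMap, minpoly.aeval]
  obtain ⟨α, hα, hαa⟩ := HenselianLocalRing.is_henselian
    (g.map (padicInt.map (f.restrictScalars ℚ_[p]))) (hg.map _) a₀ ha₀mem
    (isUnit_eval_derivative_of_separable (hGres ▸ hsep.map) ha₀mem)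
  have hαζ : residue _ α = ζ := by
    rw [← ha₀, ← sub_eq_zero, ← map_sub]
    exact (residue_eq_zero_iff _).mpr hαa
  obtain ⟨f₂, hf₂, hf₂x⟩ := hex L f (α : L) (by
    rw [IsRoot, Polynomial.eval_map] at hα
    have h1 := congrArg (padicInt p L).subtype hα
    rw [hom_eval₂, map_zero] at h1
    rw [eval₂_map]
    exact h1)
  have hsurj : Function.Surjective (padicResidueAlgHom p f₂) := by
    have h1 : (padicResidueAlgHom p f₂) (residue _ ⟨x, hx0⟩) = ζ := by
      rw [padicResidueAlgHom_residue, ← hαζ]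
      exact congrArg _ (Subtype.ext hf₂x)
    let R : IntermediateField (K.ResField p) (L.ResField p) :=
      { (padicResidueAlgHom p f₂).toRingHom.fieldRange with
        algebraMap_mem' := fun c => ⟨padicResidueAlgHom p f₁ c, by
          change padicResidueAlgHom p f₂ (padicResidueAlgHom p f₁ c) = padicResidueAlgHom p f c
          rw [← hf₂, padicResidueAlgHom_comp]
          rfl⟩ }
    have h3 : (⊤ : IntermediateField (K.ResField p) (L.ResField p)) ≤ R := by
      rw [← hζ, IntermediateField.adjoin_simple_le_iff]
      exact ⟨_, h1⟩
    intro y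
    exact h3 (IntermediateField.mem_top (x := y))
  have hdegL : padicResidueDegree p K₀ = padicResidueDegree p L := by
    have h1 := Nat.card_congr (Equiv.ofBijective _ ⟨(padicResidueAlgHom p f₂).injective, hsurj⟩)
    rw [card_padicResidueField, card_padicResidueField] at h1
    exact Nat.pow_right_injective (Fact.out : p.Prime).two_le h1
  refine ⟨K₀, f₁, f₂, hf₂, hsurj, ?_, hdegL, fun θ θ' h1 h2 => ?_⟩
  · have h1 := padicRamification_mul_padicResidueDegree p K₀
    rw [← Module.finrank_mul_finrank ℚ_[p] k, hfin, hg.natDegree_map, hg2, hdeg, mul_left_comm,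
      Module.finrank_mul_finrank, ← padicRamification_mul_padicResidueDegree, mul_left_comm,
      mul_comm (Module.finrank _ _), ← padicResidueDegree_eq_mul_finrank, hdegL] at h1
    exact Nat.eq_of_mul_eq_mul_right (padicResidueDegree_pos p L) h1
  · refine hext _ θ θ' h1 ?_
    have hroot : ∀ ψ : K₀ →ₐ[k] AlgebraicClosure k, ψ.comp f₁ = θ.comp f₁ →
        (g.map (padicInt.map ((θ.comp f₁).restrictScalars ℚ_[p]))).eval
          (padicInt.map (ψ.restrictScalars ℚ_[p]) ⟨x, hx0⟩) = 0 := fun ψ hψ => by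
      rw [← hψ]
      refine Subtype.val_injective ?_
      change (padicInt p (AlgebraicClosure k)).subtype _ = 0
      rw [Polynomial.eval_map, hom_eval₂]
      rw [eval₂_map] at hx
      have h3 := congrArg ψ hx
      rw [map_zero] at h3
      refine Eq.trans ?_ h3
      exact (hom_eval₂ g ((f₁ : K →+* K₀).comp (padicInt p K).subtype)
        (ψ : K₀ →+* AlgebraicClosure k) x).symm
    have hkey := IsLocalRing.eq_of_eval_eq_zero_of_not_isUnit_sub (hroot θ rfl) (hroot θ' h1.symm)
      (by
        have h3 := DFunLike.congr_fun h2 (residue _ ⟨x, hx0⟩)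
        rw [padicResidueAlgHom_residue, padicResidueAlgHom_residue, ← sub_eq_zero, ← map_sub,
          residue_eq_zero_iff] at h3
        exact h3)
      (isUnit_eval_derivative_of_separable (by
        rw [map_residue_map_padicInt, hg1]
        exact hsep.map) (by
          rw [hroot θ rfl]
          exact zero_mem _))
    exact congrArg Subtype.val hkey

/-- The number of embeddings of `L` over `K` with prescribed effect on residue fields is the
ramification index. -/
lemma card_embeddings_residue_eq [CharZero k] {K L : FinExt k} (f : K →ₐ[k] L)
    (τ : K →ₐ[k] AlgebraicClosure k)
    (κ : L.ResField p →ₐ[padicResidueField p k] GoodReduction.GeomResidueField p k)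
    (hκ : κ.comp (padicResidueAlgHom p f) = padicResidueAlgHom p τ) {r : ℕ}
    (hr : padicRamification p L = r * padicRamification p K) :
    Nat.card {θ : L →ₐ[k] AlgebraicClosure k // θ.comp f = τ ∧ padicResidueAlgHom p θ = κ} = r := by
  obtain ⟨K₀, f₁, f₂, hf, hsurj, he, hd, hinj⟩ := exists_unramified_subextension p f
  obtain ⟨s, hs0, hs⟩ := exists_padicResidueDegree_eq_mul p f
  -- The embeddings of `K₀` over `K` correspond to the embeddings of residue fields.
  let Φ : {θ : K₀ →ₐ[k] AlgebraicClosure k // θ.comp f₁ = τ} →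
      {κ' : K₀.ResField p →ₐ[padicResidueField p k] GoodReduction.GeomResidueField p k //
        κ'.comp (padicResidueAlgHom p f₁) = padicResidueAlgHom p τ} := fun θ =>
    ⟨padicResidueAlgHom p θ.1, by rw [← padicResidueAlgHom_comp, θ.2]⟩
  have hΦinj : Function.Injective Φ := fun θ θ' h =>
    Subtype.ext (hinj θ.1 θ'.1 (θ.2.trans θ'.2.symm) (congrArg Subtype.val h))
  have hΦ : Function.Bijective Φ := by
    rw [Nat.bijective_iff_injective_and_card]
    refine ⟨hΦinj, ?_⟩
    rw [card_embeddings_eq (r := 1) (s := s) f₁ τ (by rw [he, one_mul]) (by rw [hd, hs]), one_mul,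
      card_residue_embeddings_eq f₁ _ (by rw [hd, hs])]
  obtain ⟨θ₀, hθ₀⟩ := hΦ.2 ⟨κ.comp (padicResidueAlgHom p f₂), by
    rw [AlgHom.comp_assoc, ← padicResidueAlgHom_comp, hf, hκ]⟩
  have hθ₀' : padicResidueAlgHom p θ₀.1 = κ.comp (padicResidueAlgHom p f₂) :=
    congrArg Subtype.val hθ₀
  have h1 : ∀ θ : L →ₐ[k] AlgebraicClosure k,
      (θ.comp f = τ ∧ padicResidueAlgHom p θ = κ) ↔ θ.comp f₂ = θ₀.1 := by
    intro θ
    constructor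
    · rintro ⟨h2, h3⟩
      refine hinj _ _ ?_ ?_
      · rw [AlgHom.comp_assoc, hf, h2, θ₀.2]
      · rw [padicResidueAlgHom_comp, h3, hθ₀']
    · intro h2
      refine ⟨by rw [← hf, ← AlgHom.comp_assoc, h2, θ₀.2], ?_⟩
      ext y
      obtain ⟨y, rfl⟩ := hsurj y
      have h3 := DFunLike.congr_fun ((padicResidueAlgHom_comp (p := p) θ f₂).symm.trans
        ((congrArg (padicResidueAlgHom p) h2).trans hθ₀')) y
      exact h3
  rw [Nat.card_congr (Equiv.subtypeEquivRight h1),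
    card_embeddings_eq (r := r) (s := 1) f₂ θ₀.1 (by rw [he, hr]) (by rw [hd, one_mul]), mul_one]

end Relative

end Ramification

/-! ### The valuation on the multiplicative group -/

section MultiplicativeGroup

variable {k : Type u} [Field k]

/-- The element of `𝔾ₘ(K)` given by a unit of `K`. -/
noncomputable def gmUnit (K : FinExt k) (x : Kˣ) : (gmMackey k).obj K :=
  (⟨fun τ => Additive.ofMul (Units.map (τ : K →* AlgebraicClosure k) x), fun _ _ => rfl⟩ :
    MackeyFunctor.galoisObj _ K)

/-- The component at an embedding of `K` of an element of `𝔾ₘ(K)`. -/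
noncomputable def gmEval {K : FinExt k} (a : (gmMackey k).obj K) (τ : K →ₐ[k] AlgebraicClosure k) :
    (AlgebraicClosure k)ˣ :=
  ((show MackeyFunctor.galoisObj _ K from a).1 τ).toMul

lemma gm_ext {K : FinExt k} {a b : (gmMackey k).obj K} (h : ∀ τ, gmEval a τ = gmEval b τ) :
    a = b :=
  Subtype.ext (funext h)

@[simp] lemma gmEval_gmUnit (K : FinExt k) (x : Kˣ) (τ : K →ₐ[k] AlgebraicClosure k) :
    (gmEval (gmUnit K x) τ : AlgebraicClosure k) = τ x := rfl

lemma gmEval_res {K L : FinExt k} (f : K →ₐ[k] L) (a : (gmMackey k).obj K)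
    (τ : L →ₐ[k] AlgebraicClosure k) :
    gmEval ((gmMackey k).res f a) τ = gmEval a (τ.comp f) := rfl

open Classical in
lemma gmEval_norm {K L : FinExt k} (f : K →ₐ[k] L) (a : (gmMackey k).obj L)
    (τ : K →ₐ[k] AlgebraicClosure k) :
    gmEval ((gmMackey k).norm f a) τ =
      ∏ θ : L →ₐ[k] AlgebraicClosure k with θ.comp f = τ, gmEval a θ := rfl

lemma gmUnit_mul (K : FinExt k) (x y : Kˣ) : gmUnit K (x * y) = gmUnit K x + gmUnit K y :=
  gm_ext fun τ => Units.ext (map_mul τ (x : K) (y : K))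

/-- Galois descent: every element of `𝔾ₘ(K)` is given by a unit of `K`. -/
lemma exists_gmUnit_eq [CharZero k] {K : FinExt k} (a : (gmMackey k).obj K) :
    ∃ x : Kˣ, gmUnit K x = a := by
  let τ : K →ₐ[k] AlgebraicClosure k := IsAlgClosed.lift
  have hequiv : ∀ (σ : Gal(AlgebraicClosure k/k)) (τ : K →ₐ[k] AlgebraicClosure k),
      (gmEval a ((σ : AlgebraicClosure k →ₐ[k] AlgebraicClosure k).comp τ) : AlgebraicClosure k) =
        σ (gmEval a τ : AlgebraicClosure k) := fun σ τ =>
    congrArg (fun z : Additive (AlgebraicClosure k)ˣ => (z.toMul : AlgebraicClosure k))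
      ((show MackeyFunctor.galoisObj _ K from a).2 σ τ)
  obtain ⟨x, hx⟩ := mem_range_of_galois_fixed τ (gmEval a τ : AlgebraicClosure k) fun σ hσ => by
    rw [← hequiv, hσ]
  have hx0 : x ≠ 0 := by
    rintro rfl
    exact (gmEval a τ).ne_zero (by rw [← hx, map_zero])
  refine ⟨Units.mk0 x hx0, gm_ext fun τ' => ?_⟩
  obtain ⟨σ, rfl⟩ := exists_galois_comp_eq τ τ'
  ext
  rw [hequiv, ← hx]
  rfl

variable {p : ℕ} [Fact p.Prime] [Algebra ℚ_[p] k] [FiniteDimensional ℚ_[p] k] [CharZero k]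

variable (p) in
lemma exists_gmVal (K : FinExt k) (a : (gmMackey k).obj K) :
    ∃ m : ℤ, ∀ τ, spectralNorm ℚ_[p] (AlgebraicClosure k) (gmEval a τ) ^ padicRamification p K =
      (p : ℝ) ^ (-m) := by
  obtain ⟨x, rfl⟩ := exists_gmUnit_eq a
  obtain ⟨m, hm⟩ := exists_spectralNorm_pow_eq p K x.ne_zero
  refine ⟨m, fun τ => ?_⟩
  rw [gmEval_gmUnit, ← hm]
  congr 1
  exact spectralNorm_algHom (τ.restrictScalars ℚ_[p]) (x : K)

variable (p) in
lemma padic_zpow_injective {m n : ℤ} (h : (p : ℝ) ^ (-m) = (p : ℝ) ^ (-n)) : m = n := by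
  have hp : p.Prime := Fact.out
  exact neg_injective (zpow_right_injective₀ (by exact_mod_cast hp.pos)
    (by exact_mod_cast hp.one_lt.ne') h)

variable (p) in
/-- The normalized valuation `𝔾ₘ(K) → ℤ`. -/
noncomputable def gmVal (K : FinExt k) : (gmMackey k).obj K →+ ℤ :=
  AddMonoidHom.mk' (fun a => (exists_gmVal p K a).choose) fun a b => by
    let τ : K →ₐ[k] AlgebraicClosure k := IsAlgClosed.lift
    apply padic_zpow_injective p
    rw [← (exists_gmVal p K (a + b)).choose_spec τ, neg_add,
      zpow_add₀ (by exact_mod_cast (Fact.out : p.Prime).ne_zero),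
      ← (exists_gmVal p K a).choose_spec τ, ← (exists_gmVal p K b).choose_spec τ, ← mul_pow,
      ← spectralNorm_padic_mul]
    rfl

lemma spectralNorm_gmEval_pow {K : FinExt k} (a : (gmMackey k).obj K)
    (τ : K →ₐ[k] AlgebraicClosure k) :
    spectralNorm ℚ_[p] (AlgebraicClosure k) (gmEval a τ) ^ padicRamification p K =
      (p : ℝ) ^ (-gmVal p K a) :=
  (exists_gmVal p K a).choose_spec τ

lemma spectralNorm_gmUnit_pow {K : FinExt k} (x : Kˣ) :
    spectralNorm ℚ_[p] K x ^ padicRamification p K = (p : ℝ) ^ (-gmVal p K (gmUnit K x)) := by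
  let τ : K →ₐ[k] AlgebraicClosure k := IsAlgClosed.lift
  rw [← spectralNorm_gmEval_pow _ τ]
  congr 1
  exact (spectralNorm_algHom (τ.restrictScalars ℚ_[p]) (x : K)).symm

/-- Restriction multiplies the valuation by the ramification index. -/
lemma gmVal_res {K L : FinExt k} (f : K →ₐ[k] L) (a : (gmMackey k).obj K) {r : ℕ}
    (hr : padicRamification p L = r * padicRamification p K) :
    gmVal p L ((gmMackey k).res f a) = r * gmVal p K a := by
  let τ : L →ₐ[k] AlgebraicClosure k := IsAlgClosed.lift
  apply padic_zpow_injective p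
  rw [← spectralNorm_gmEval_pow _ τ, gmEval_res, hr, mul_comm, pow_mul, spectralNorm_gmEval_pow,
    ← zpow_natCast, ← zpow_mul]
  congr 1
  ring

open Classical in
/-- The norm multiplies the valuation by the residue degree. -/
lemma gmVal_norm {K L : FinExt k} (f : K →ₐ[k] L) (a : (gmMackey k).obj L) {s : ℕ}
    (hs : padicResidueDegree p L = s * padicResidueDegree p K) :
    gmVal p K ((gmMackey k).norm f a) = s * gmVal p L a := by
  obtain ⟨r, hr0, hr⟩ := exists_padicRamification_eq_mul p f
  let τ : K →ₐ[k] AlgebraicClosure k := IsAlgClosed.lift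
  have h1 : (p : ℝ) ^ (-(gmVal p K ((gmMackey k).norm f a) * r)) =
      (p : ℝ) ^ (-(s * gmVal p L a * r)) := by
    rw [← neg_mul, zpow_mul, ← spectralNorm_gmEval_pow _ τ, gmEval_norm, zpow_natCast, ← pow_mul,
      mul_comm _ r, ← hr]
    have h2 : spectralNorm ℚ_[p] (AlgebraicClosure k)
        ((∏ θ : L →ₐ[k] AlgebraicClosure k with θ.comp f = τ, gmEval a θ :
          (AlgebraicClosure k)ˣ) : AlgebraicClosure k) =
        ∏ θ : L →ₐ[k] AlgebraicClosure k with θ.comp f = τ,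
          spectralNorm ℚ_[p] (AlgebraicClosure k) (gmEval a θ) := by
      rw [Units.coe_prod]
      exact map_prod (spectralMulAlgNorm ℚ_[p] (AlgebraicClosure k)) _ _
    rw [h2, ← Finset.prod_pow, Finset.prod_congr rfl fun θ _ => spectralNorm_gmEval_pow a θ,
      Finset.prod_const, ← zpow_natCast, ← zpow_mul]
    congr 1
    have h3 := card_embeddings_eq f τ hr hs
    rw [Nat.card_eq_fintype_card, Fintype.card_subtype] at h3
    rw [h3]
    push_cast
    ring
  exact mul_right_cancel₀ (by exact_mod_cast hr0.ne') (padic_zpow_injective p h1)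

end MultiplicativeGroup

/-! ### Traces on the reduction -/

section Trace

open IsLocalRing

/-- An element of an extension of a finite field `F` fixed by the Frobenius of `F` lies in `F`. -/
lemma mem_range_of_pow_card_eq {F E : Type*} [Field F] [Fintype F] [Field E] [Algebra F E] {c : E}
    (hc : c ^ Fintype.card F = c) : c ∈ Set.range (algebraMap F E) := by
  have h1 : (Polynomial.X ^ Fintype.card F - Polynomial.X : Polynomial F) =
      ∏ a : F, (Polynomial.X - Polynomial.C a) := by
    have hroots := FiniteField.roots_X_pow_card_sub_X F
    have hdeg := FiniteField.X_pow_card_sub_X_natDegree_eq F (Fintype.one_lt_card (α := F))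
    have h := Polynomial.prod_multiset_X_sub_C_of_monic_of_roots_card_eq
      (Polynomial.monic_X_pow_sub (show (Polynomial.X : Polynomial F).degree < Fintype.card F by
        rw [Polynomial.degree_X]
        exact_mod_cast Fintype.one_lt_card (α := F))) (by
        rw [hroots, hdeg]
        rfl)
    rw [← h, hroots]
    rfl
  have h2 := congrArg (Polynomial.aeval c) h1
  rw [map_sub, map_pow, Polynomial.aeval_X, hc, sub_self, map_prod] at h2
  obtain ⟨a, -, ha⟩ := Finset.prod_eq_zero_iff.mp h2.symm
  refine ⟨a, ?_⟩
  rw [map_sub, Polynomial.aeval_X, Polynomial.aeval_C, sub_eq_zero] at ha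
  exact ha.symm

variable {p : ℕ} [Fact p.Prime] {k : Type u} [Field k] [Algebra ℚ_[p] k] [FiniteDimensional ℚ_[p] k]

noncomputable instance FinExt.fintypeResidueEmbeddings (K : FinExt k) :
    Fintype (K.ResField p →ₐ[padicResidueField p k] GoodReduction.GeomResidueField p k) :=
  Fintype.ofFinite _

namespace GoodReduction

variable {A : Over (Spec (.of k))} [GrpObj A] (𝒳 : GoodReduction p A)

/-- The inclusion `Ā(𝔽) → Ā(𝔽̄)`. -/
noncomputable def reductionPointsMap :
    𝒳.reductionPoints →+ AVPoints 𝒳.reduction (GeomResidueField p k) :=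
  AVPoints.map 𝒳.reduction (Algebra.ofId (padicResidueField p k) (GeomResidueField p k))

lemma reductionPointsMap_injective : Function.Injective 𝒳.reductionPointsMap :=
  AVPoints.map_injective 𝒳.reduction _

/-- The sum of the conjugates of a point is rational, because it is fixed by Frobenius. -/
lemma exists_reductionPointsMap_eq_sum (K : FinExt k) (y : AVPoints 𝒳.reduction (K.ResField p)) :
    ∃ z, 𝒳.reductionPointsMap z =
      ∑ κ : K.ResField p →ₐ[padicResidueField p k] GeomResidueField p k,
        AVPoints.map 𝒳.reduction κ y := by
  let _ : Fintype (padicResidueField p k) := Fintype.ofFinite _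
  obtain ⟨C, -, hC1, hC2⟩ := AVPoints.exists_finite_coordinates 𝒳.reduction
    (∑ κ : K.ResField p →ₐ[padicResidueField p k] GeomResidueField p k,
        AVPoints.map 𝒳.reduction κ y)
  refine hC1 _ _ fun c hc => mem_range_of_pow_card_eq ?_
  refine hC2 (FiniteField.frobeniusAlgHom (padicResidueField p k) (GeomResidueField p k)) ?_ c hc
  rw [map_sum]
  have hinj : Function.Injective fun κ : K.ResField p →ₐ[padicResidueField p k]
      GeomResidueField p k => (FiniteField.frobeniusAlgHom (padicResidueField p k)
        (GeomResidueField p k)).comp κ := fun κ κ' h => by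
    ext x
    exact (FiniteField.frobeniusAlgHom (padicResidueField p k) (GeomResidueField p k)).injective
      (DFunLike.congr_fun h x)
  rw [← (Finite.injective_iff_bijective.mp hinj).sum_comp fun κ => AVPoints.map 𝒳.reduction κ y]
  exact Finset.sum_congr rfl fun κ _ => (AVPoints.map_comp _ _ _ _).symm

/-- The trace `Ā(𝔽_K) → Ā(𝔽)`, the sum over the embeddings of `𝔽_K` into `𝔽̄`. -/
noncomputable def reductionTrace (K : FinExt k) :
    AVPoints 𝒳.reduction (K.ResField p) →+ 𝒳.reductionPoints :=
  AddMonoidHom.mk' (fun y => (𝒳.exists_reductionPointsMap_eq_sum K y).choose) fun y y' => by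
    apply 𝒳.reductionPointsMap_injective
    rw [map_add, (𝒳.exists_reductionPointsMap_eq_sum K _).choose_spec,
      (𝒳.exists_reductionPointsMap_eq_sum K _).choose_spec,
      (𝒳.exists_reductionPointsMap_eq_sum K _).choose_spec, ← Finset.sum_add_distrib]
    exact Finset.sum_congr rfl fun κ _ => map_add _ _ _

lemma reductionPointsMap_reductionTrace (K : FinExt k) (y : AVPoints 𝒳.reduction (K.ResField p)) :
    𝒳.reductionPointsMap (𝒳.reductionTrace K y) =
      ∑ κ : K.ResField p →ₐ[padicResidueField p k] GeomResidueField p k,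
        AVPoints.map 𝒳.reduction κ y :=
  (𝒳.exists_reductionPointsMap_eq_sum K y).choose_spec

/-- Every embedding of `𝔽_K` has `s` extensions to `𝔽_L`. -/
lemma reductionTrace_map {K L : FinExt k} (f : K →ₐ[k] L) {s : ℕ}
    (hs : padicResidueDegree p L = s * padicResidueDegree p K)
    (y : AVPoints 𝒳.reduction (K.ResField p)) :
    𝒳.reductionTrace L (AVPoints.map 𝒳.reduction (padicResidueAlgHom p f) y) =
      s • 𝒳.reductionTrace K y := by
  classical
  apply 𝒳.reductionPointsMap_injective
  rw [map_nsmul, reductionPointsMap_reductionTrace, reductionPointsMap_reductionTrace,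
    Finset.smul_sum, ← Finset.sum_fiberwise (g := fun κ : L.ResField p →ₐ[padicResidueField p k]
      GeomResidueField p k => κ.comp (padicResidueAlgHom p f))]
  refine Finset.sum_congr rfl fun κ _ => ?_
  have h1 := card_residue_embeddings_eq f κ hs
  rw [Nat.card_eq_fintype_card, Fintype.card_subtype] at h1
  rw [← h1, ← Finset.sum_const]
  refine Finset.sum_congr rfl fun κ' hκ' => ?_
  rw [Finset.mem_filter] at hκ'
  rw [← AVPoints.map_comp, hκ'.2]

variable (p k) in
/-- The residue field of the trivial extension is that of `k`. The two are formed with respect to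
`ℚ_p`-algebra structures that agree only propositionally. -/
lemma algebraMap_base_residue_surjective :
    Function.Surjective (algebraMap (padicResidueField p k) ((FinExt.base k).ResField p)) := by
  intro x
  obtain ⟨y, rfl⟩ := residue_surjective x
  let g : k →ₐ[ℚ_[p]] FinExt.base k := IsScalarTower.toAlgHom ℚ_[p] k (FinExt.base k)
  let z : k := (y : FinExt.base k)
  have hz : z ∈ padicInt p k := by
    rw [mem_padicInt, ← spectralNorm_algHom g z]
    exact y.2
  exact ⟨residue _ ⟨z, hz⟩, rfl⟩

/-- The reductions of the embeddings of `K` exhaust the embeddings of the residue field. -/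
lemma exists_padicResidueAlgHom_eq [CharZero k] (K : FinExt k)
    (κ : K.ResField p →ₐ[padicResidueField p k] GeomResidueField p k) :
    ∃ τ : K →ₐ[k] AlgebraicClosure k, padicResidueAlgHom p τ = κ := by
  let f : FinExt.base k →ₐ[k] K := Algebra.ofId k K
  let τ₀ : FinExt.base k →ₐ[k] AlgebraicClosure k := Algebra.ofId k _
  obtain ⟨r, hr0, hr⟩ := exists_padicRamification_eq_mul p f
  have h : κ.comp (padicResidueAlgHom p f) = padicResidueAlgHom p τ₀ := by
    ext x
    obtain ⟨y, rfl⟩ := algebraMap_base_residue_surjective p k x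
    rw [AlgHom.commutes, AlgHom.commutes]
  have h1 := card_embeddings_residue_eq f τ₀ κ h hr
  obtain ⟨θ⟩ : Nonempty {θ : K →ₐ[k] AlgebraicClosure k // θ.comp f = τ₀ ∧
      padicResidueAlgHom p θ = κ} := (Nat.card_pos_iff.mp (h1 ▸ hr0)).1
  exact ⟨θ.1, θ.2.2⟩

/-- The trace map is bijective for the trivial extension. -/
lemma reductionTrace_base_bijective :
    Function.Bijective (𝒳.reductionTrace (FinExt.base k)) := by
  have hsub : Subsingleton ((FinExt.base k).ResField p →ₐ[padicResidueField p k]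
      GeomResidueField p k) := ⟨fun κ κ' => by
    ext x
    obtain ⟨y, rfl⟩ := algebraMap_base_residue_surjective p k x
    rw [AlgHom.commutes, AlgHom.commutes]⟩
  let κ : (FinExt.base k).ResField p →ₐ[padicResidueField p k] GeomResidueField p k :=
    padicResidueAlgHom p IsAlgClosed.lift
  have h : ∀ y, 𝒳.reductionPointsMap (𝒳.reductionTrace (FinExt.base k) y) =
      AVPoints.map 𝒳.reduction κ y := fun y => by
    rw [reductionPointsMap_reductionTrace, Fintype.sum_subsingleton _ κ]
  constructor
  · intro y y' hy
    apply AVPoints.map_injective 𝒳.reduction κ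
    rw [← h, ← h, hy]
  · intro z
    refine ⟨AVPoints.map 𝒳.reduction (Algebra.ofId _ _) z, 𝒳.reductionPointsMap_injective ?_⟩
    rw [h, ← AVPoints.map_comp]
    exact congrArg (fun g => AVPoints.map 𝒳.reduction g z) (Subsingleton.elim _ _)

variable [IsAbelianScheme A] [CharZero k]

/-- The norm on `A / Â` is `r` times the trace of residue fields: the embeddings of `L` over a given
embedding of `K` induce each compatible embedding of `𝔽_L` exactly `r` times. -/
lemma reductionTrace_abarEquiv_norm {K L : FinExt k} (f : K →ₐ[k] L) {r : ℕ}
    (hr : padicRamification p L = r * padicRamification p K) (b : 𝒳.abarMackey.obj L) :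
    𝒳.reductionTrace K (𝒳.abarEquiv K (𝒳.abarMackey.norm f b)) =
      r • 𝒳.reductionTrace L (𝒳.abarEquiv L b) := by
  classical
  apply 𝒳.reductionPointsMap_injective
  rw [map_nsmul, reductionPointsMap_reductionTrace, reductionPointsMap_reductionTrace,
    Finset.smul_sum, ← Finset.sum_fiberwise (s := Finset.univ) (g := fun κ :
      L.ResField p →ₐ[padicResidueField p k] GeomResidueField p k =>
        κ.comp (padicResidueAlgHom p f))]
  refine Finset.sum_congr rfl fun κ _ => ?_
  obtain ⟨τ, rfl⟩ := exists_padicResidueAlgHom_eq K κ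
  rw [map_abarEquiv, abarReduction_norm]
  rw [← Finset.sum_fiberwise_of_maps_to (t := Finset.univ.filter fun κ :
      L.ResField p →ₐ[padicResidueField p k] GeomResidueField p k =>
        κ.comp (padicResidueAlgHom p f) = padicResidueAlgHom p τ)
    (g := fun θ : L →ₐ[k] AlgebraicClosure k => padicResidueAlgHom p θ) (by
      intro θ hθ
      rw [Finset.mem_filter] at hθ ⊢
      exact ⟨Finset.mem_univ _, by rw [← padicResidueAlgHom_comp, hθ.2]⟩)]
  refine Finset.sum_congr rfl fun κ hκ => ?_
  rw [Finset.mem_filter] at hκ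
  have h1 := card_embeddings_residue_eq f τ κ hκ.2 hr
  rw [Nat.card_eq_fintype_card, Fintype.card_subtype] at h1
  rw [Finset.filter_filter, ← h1, ← Finset.sum_const]
  refine Finset.sum_congr rfl fun θ hθ => ?_
  rw [Finset.mem_filter] at hθ
  rw [← map_abarEquiv, hθ.2.2]

end GoodReduction

end Trace

/-! ### Symbols in Mackey products -/

section Symbols

namespace MackeyFunctor

variable {k : Type u} [Field k]

section General

variable (M N : MackeyFunctor k) {k' : FinExt k}

/-- The symbol `{x, y}_K` in the Mackey product, as a bilinear map. -/
noncomputable def pairing {K : FinExt k} (s : k' →ₐ[k] K) :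
    M.obj K →+ N.obj K →+ M.Product N k' :=
  AddMonoidHom.mk' (fun x => AddMonoidHom.mk' (fun y => QuotientAddGroup.mk (gen M N s x y))
    fun y y' => by
      rw [gen, TensorProduct.tmul_add, map_add]
      rfl)
    fun x x' => AddMonoidHom.ext fun y => by
      change QuotientAddGroup.mk (gen M N s (x + x') y) = _
      rw [gen, TensorProduct.add_tmul, map_add]
      rfl

variable {M N}

lemma pairing_norm_left {K L : FinExt k} (s : k' →ₐ[k] K) (f : K →ₐ[k] L) (x : M.obj L)
    (y : N.obj K) : pairing M N s (M.norm f x) y = pairing M N (f.comp s) x (N.res f y) :=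
  (QuotientAddGroup.eq_iff_sub_mem (N := PF M N k')).mpr
    (AddSubgroup.subset_closure (Or.inl ⟨K, L, s, f, x, y, rfl⟩))

lemma pairing_norm_right {K L : FinExt k} (s : k' →ₐ[k] K) (f : K →ₐ[k] L) (x : M.obj K)
    (y : N.obj L) : pairing M N s x (N.norm f y) = pairing M N (f.comp s) (M.res f x) y :=
  ((QuotientAddGroup.eq_iff_sub_mem (N := PF M N k')).mpr
    (AddSubgroup.subset_closure (Or.inr ⟨K, L, s, f, x, y, rfl⟩))).symm

/-- The Mackey product is generated by symbols. -/
lemma mem_of_pairing_mem (H : AddSubgroup (M.Product N k'))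
    (h : ∀ (K : FinExt k) (s : k' →ₐ[k] K) (x : M.obj K) (y : N.obj K), pairing M N s x y ∈ H)
    (z : M.Product N k') : z ∈ H := by
  classical
  induction z using QuotientAddGroup.induction_on with
  | H z =>
    induction z using DirectSum.induction_on with
    | zero => exact H.zero_mem
    | add x y hx hy => exact H.add_mem hx hy
    | of i t =>
      induction t using TensorProduct.induction_on with
      | zero =>
        rw [map_zero]
        exact H.zero_mem
      | add x y hx hy =>
        rw [map_add]
        exact H.add_mem hx hy
      | tmul x y =>
        have h1 := h i.1 i.2 x y
        change QuotientAddGroup.mk (gen M N i.2 x y) ∈ H at h1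
        unfold gen at h1
        convert h1

/-- The universal property of the Mackey product: families of bilinear maps that satisfy the
projection formula. -/
lemma exists_product_lift {Q : Type*} [AddCommGroup Q]
    (φ : ∀ K : FinExt k, M.obj K →+ N.obj K →+ Q)
    (h₁ : ∀ {K L : FinExt k} (f : K →ₐ[k] L) (x : M.obj L) (y : N.obj K),
      φ K (M.norm f x) y = φ L x (N.res f y))
    (h₂ : ∀ {K L : FinExt k} (f : K →ₐ[k] L) (x : M.obj K) (y : N.obj L),
      φ L (M.res f x) y = φ K x (N.norm f y)) :
    ∃ Ψ : M.Product N k' →+ Q, ∀ (K : FinExt k) (s : k' →ₐ[k] K) (x : M.obj K) (y : N.obj K),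
      Ψ (pairing M N s x y) = φ K x y := by
  classical
  let φ' : ∀ K : FinExt k, M.obj K ⊗[ℤ] N.obj K →+ Q := fun K =>
    TensorProduct.liftAddHom (φ K) fun r x y => by
      rw [map_zsmul, map_zsmul, AddMonoidHom.zsmul_apply]
  let Ψ₀ : ProductGen M N k' →+ Q :=
    DirectSum.toAddMonoid fun K : (Σ K : FinExt k, k' →ₐ[k] K) => φ' K.1
  have hΨ₀ : ∀ (K : FinExt k) (s : k' →ₐ[k] K) x y, Ψ₀ (gen _ _ s x y) = φ K x y := by
    intro K s x y
    have h3 : Ψ₀ (DirectSum.of (fun K : (Σ K : FinExt k, k' →ₐ[k] K) =>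
        M.obj K.1 ⊗[ℤ] N.obj K.1) ⟨K, s⟩ (x ⊗ₜ[ℤ] y)) = φ' K (x ⊗ₜ y) :=
      DirectSum.toAddMonoid_of _ _ _
    refine Eq.trans ?_ h3
    unfold gen
    congr!
  have hle : PF M N k' ≤ Ψ₀.ker := by
    refine (AddSubgroup.closure_le _).mpr ?_
    rintro z (⟨K, L, s, f, x, y, rfl⟩ | ⟨K, L, s, f, x, y, rfl⟩)
    · change Ψ₀ _ = 0
      rw [map_sub, hΨ₀, hΨ₀]
      exact sub_eq_zero.mpr (h₁ f x y)
    · change Ψ₀ _ = 0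
      rw [map_sub, hΨ₀, hΨ₀]
      exact sub_eq_zero.mpr (h₂ f x y)
  exact ⟨QuotientAddGroup.lift _ Ψ₀ hle, fun K s x y => hΨ₀ K s x y⟩

end General

section Modulo

variable (M N : MackeyFunctor k) (m : ℕ) {k' : FinExt k}

/-- The projection `M(K) → M(K) / m M(K)`. -/
def modMk (K : FinExt k) : M.obj K →+ (M.modNat m).obj K :=
  QuotientAddGroup.mk' ((M.nsmulSub m).obj K)

lemma modMk_surjective (K : FinExt k) : Function.Surjective (M.modMk m K) :=
  QuotientAddGroup.mk'_surjective _

lemma modMk_nsmul (K : FinExt k) (x : M.obj K) : M.modMk m K (m • x) = 0 :=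
  (QuotientAddGroup.eq_zero_iff _).mpr ⟨x, rfl⟩

/-- The symbol `{a, b}_K` in the Mackey product of `M / m` and `N / m`, as a bilinear map on
`M(K) × N(K)`. -/
noncomputable def symbol {K : FinExt k} (s : k' →ₐ[k] K) :
    M.obj K →+ N.obj K →+ (M.modNat m).Product (N.modNat m) k' :=
  ((pairing (M.modNat m) (N.modNat m) s).compl₂ (N.modMk m K)).comp (M.modMk m K)

variable {M N m}

lemma symbol_apply {K : FinExt k} (s : k' →ₐ[k] K) (a : M.obj K) (b : N.obj K) :
    symbol M N m s a b =
      pairing (M.modNat m) (N.modNat m) s (M.modMk m K a) (N.modMk m K b) := rfl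

lemma symbol_norm_left {K L : FinExt k} (s : k' →ₐ[k] K) (f : K →ₐ[k] L) (a : M.obj L)
    (b : N.obj K) : symbol M N m s (M.norm f a) b = symbol M N m (f.comp s) a (N.res f b) :=
  pairing_norm_left s f (M.modMk m L a) (N.modMk m K b)

lemma symbol_norm_right {K L : FinExt k} (s : k' →ₐ[k] K) (f : K →ₐ[k] L) (a : M.obj K)
    (b : N.obj L) : symbol M N m s a (N.norm f b) = symbol M N m (f.comp s) (M.res f a) b :=
  pairing_norm_right s f (M.modMk m K a) (N.modMk m L b)

lemma symbol_nsmul_right {K : FinExt k} (s : k' →ₐ[k] K) (a : M.obj K) (b : N.obj K) :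
    symbol M N m s a (m • b) = 0 := by
  rw [symbol_apply, modMk_nsmul, map_zero]

lemma nsmul_symbol {K : FinExt k} (s : k' →ₐ[k] K) (a : M.obj K) (b : N.obj K) :
    m • symbol M N m s a b = 0 := by
  rw [← map_nsmul, symbol_nsmul_right]

lemma mem_of_symbol_mem (H : AddSubgroup ((M.modNat m).Product (N.modNat m) k'))
    (h : ∀ (K : FinExt k) (s : k' →ₐ[k] K) (a : M.obj K) (b : N.obj K), symbol M N m s a b ∈ H)
    (z : (M.modNat m).Product (N.modNat m) k') : z ∈ H := by
  refine mem_of_pairing_mem H (fun K s x y => ?_) z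
  obtain ⟨a, rfl⟩ := M.modMk_surjective m K x
  obtain ⟨b, rfl⟩ := N.modMk_surjective m K y
  exact h K s a b

/-- The universal property of the Mackey product of `M / m` and `N / m`, for groups killed
by `m`. -/
lemma exists_symbol_lift {Q : Type*} [AddCommGroup Q] (hQ : ∀ q : Q, m • q = 0)
    (φ : ∀ K : FinExt k, M.obj K →+ N.obj K →+ Q)
    (h₁ : ∀ {K L : FinExt k} (f : K →ₐ[k] L) (x : M.obj L) (y : N.obj K),
      φ K (M.norm f x) y = φ L x (N.res f y))
    (h₂ : ∀ {K L : FinExt k} (f : K →ₐ[k] L) (x : M.obj K) (y : N.obj L),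
      φ L (M.res f x) y = φ K x (N.norm f y)) :
    ∃ Ψ : (M.modNat m).Product (N.modNat m) k' →+ Q,
      ∀ (K : FinExt k) (s : k' →ₐ[k] K) (a : M.obj K) (b : N.obj K),
        Ψ (symbol M N m s a b) = φ K a b := by
  have hright : ∀ K a, ∀ y ∈ (N.nsmulSub m).obj K, φ K a y = 0 := by
    rintro K a _ ⟨y, rfl⟩
    exact (map_nsmul (φ K a) m y).trans (hQ _)
  let φ₁ : ∀ K : FinExt k, M.obj K →+ (N.modNat m).obj K →+ Q := fun K =>
    AddMonoidHom.mk' (fun a => QuotientAddGroup.lift _ (φ K a) (hright K a)) fun a a' => by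
      refine AddMonoidHom.ext fun y => ?_
      obtain ⟨y, rfl⟩ := N.modMk_surjective m K y
      exact DFunLike.congr_fun (map_add (φ K) a a') y
  have hleft : ∀ K, ∀ x ∈ (M.nsmulSub m).obj K, φ₁ K x = 0 := by
    rintro K _ ⟨x, rfl⟩
    exact (map_nsmul (φ₁ K) m x).trans (AddMonoidHom.ext fun y => hQ _)
  let φ₂ : ∀ K : FinExt k, (M.modNat m).obj K →+ (N.modNat m).obj K →+ Q := fun K =>
    QuotientAddGroup.lift _ (φ₁ K) (hleft K)
  obtain ⟨Ψ, hΨ⟩ := exists_product_lift (k' := k') φ₂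
    (fun {K L} f x y => by
      obtain ⟨x, rfl⟩ := M.modMk_surjective m L x
      obtain ⟨y, rfl⟩ := N.modMk_surjective m K y
      exact h₁ f x y)
    (fun {K L} f x y => by
      obtain ⟨x, rfl⟩ := M.modMk_surjective m K x
      obtain ⟨y, rfl⟩ := N.modMk_surjective m L y
      exact h₂ f x y)
  exact ⟨Ψ, fun K s a b => hΨ K s _ _⟩

end Modulo

end MackeyFunctor

end Symbols

/-! ### Vanishing of unit symbols and the isomorphism -/

section UnitSymbols

open IsLocalRing MackeyFunctor

variable {p : ℕ} [Fact p.Prime] {k : Type u} [Field k] [Algebra ℚ_[p] k] [FiniteDimensional ℚ_[p] k]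

lemma gmUnit_pow (K : FinExt k) (x : Kˣ) (m : ℕ) : gmUnit K (x ^ m) = m • gmUnit K x :=
  map_nsmul (AddMonoidHom.mk' (fun z : Additive Kˣ => gmUnit K z.toMul) fun a b =>
    gmUnit_mul K a.toMul b.toMul) m (Additive.ofMul x)

variable [CharZero k]

variable (p) in
/-- The valuation is onto. -/
lemma exists_gmVal_eq_one (K : FinExt k) : ∃ a, gmVal p K a = 1 := by
  obtain ⟨x, hx0, hx⟩ := exists_padic_uniformizer p K
  refine ⟨gmUnit K (Units.mk0 x hx0), padic_zpow_injective p ?_⟩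
  rw [← spectralNorm_gmUnit_pow]
  exact hx

namespace GoodReduction

variable {A : Over (Spec (.of k))} [GrpObj A] (𝒳 : GoodReduction p A) [IsAbelianScheme A]

/-- A class in `A(K) / Â(K)` becomes divisible by `N` in every extension whose residue field
contains a suitable root of unity `ζ`. -/
lemma exists_res_eq_nsmul {N : ℕ} (hN : N ≠ 0) (K : FinExt k) (τ : K →ₐ[k] AlgebraicClosure k)
    (b : 𝒳.abarMackey.obj K) :
    ∃ (ζ : GeomResidueField p k) (j : ℕ), 0 < j ∧ ζ ^ j = 1 ∧
      ∀ (L : FinExt k) (f : K →ₐ[k] L) (θ : L →ₐ[k] AlgebraicClosure k), θ.comp f = τ →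
        ζ ∈ Set.range (padicResidueAlgHom p θ) → ∃ b', 𝒳.abarMackey.res f b = N • b' := by
  obtain ⟨m', hm'⟩ := 𝒳.exists_nsmul_eq hN (𝒳.abarReduction K τ b)
  obtain ⟨C, hC, hC1, -⟩ := AVPoints.exists_finite_coordinates 𝒳.reduction m'
  obtain ⟨L₀, θ₀, hθ₀⟩ := exists_finExt_range_residue k p C hC
  -- A generator of the unit group of a finite field generates the field.
  obtain ⟨g, hg⟩ := IsCyclic.exists_generator (α := (L₀.ResField p)ˣ)
  refine ⟨padicResidueAlgHom p θ₀ g, Nat.card (L₀.ResField p)ˣ, Nat.card_pos, ?_, ?_⟩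
  · rw [← map_pow, ← Units.val_pow_eq_pow_val, pow_card_eq_one', Units.val_one, map_one]
  rintro L f θ rfl ⟨e, he⟩
  have hCθ : C ⊆ Set.range (padicResidueAlgHom p θ) := by
    intro c hc
    obtain ⟨d, rfl⟩ := hθ₀ hc
    by_cases hd : d = 0
    · exact ⟨0, by rw [hd, map_zero, map_zero]⟩
    · obtain ⟨j, hj⟩ := hg (Units.mk0 d hd)
      refine ⟨e ^ j, ?_⟩
      have hj' : (g : L₀.ResField p) ^ j = d := by
        rw [← Units.val_zpow_eq_zpow_val]
        exact congrArg Units.val hj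
      rw [map_zpow₀, he, ← map_zpow₀, hj']
  obtain ⟨y', hy'⟩ := hC1 _ (padicResidueAlgHom p θ) hCθ
  refine ⟨(𝒳.abarEquiv L).symm y', (𝒳.abarEquiv L).injective ?_⟩
  apply AVPoints.map_injective 𝒳.reduction (padicResidueAlgHom p θ)
  rw [map_nsmul, AddEquiv.apply_symm_apply, map_nsmul, hy', hm', map_abarEquiv, abarReduction_res]

open Classical Polynomial in
/-- If the reduction of `g` is the minimal polynomial of `ζ`, then `(-1)^d g(0)` is a norm from an
extension whose residue field contains `ζ`. -/
lemma symbol_eq_zero_of_coeff_zero {N : ℕ} {k' K : FinExt k} (s : k' →ₐ[k] K)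
    (τ : K →ₐ[k] AlgebraicClosure k) (b : 𝒳.abarMackey.obj K) {ζ : GeomResidueField p k}
    (hζ0 : ζ ≠ 0)
    (hζ : ∀ (L : FinExt k) (f : K →ₐ[k] L) (θ : L →ₐ[k] AlgebraicClosure k), θ.comp f = τ →
        ζ ∈ Set.range (padicResidueAlgHom p θ) → ∃ b', 𝒳.abarMackey.res f b = N • b')
    {g : (padicInt p K)[X]} (hg : g.Monic) (hirr : Irreducible (g.map (residue _)))
    (hgζ : (g.map (residue _)).eval₂ (padicResidueAlgHom p τ : K.ResField p →+* _) ζ = 0)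
    (w : Kˣ) (hw : (w : K) = (-1) ^ g.natDegree * g.coeff 0) :
    symbol (gmMackey k) 𝒳.abarMackey N s (gmUnit K w) b = 0 := by
  obtain ⟨L, f, x, -, hx, hex, -, hprod⟩ := exists_finExt_root K _ (hg.map (padicInt p K).subtype)
    (irreducible_map_of_irreducible_residue hg hirr)
  obtain ⟨α, hα, hαζ⟩ := padicInt_exists_root (L := AlgebraicClosure k)
    (hg.map (padicInt.map (τ.restrictScalars ℚ_[p]))) (c := ζ) (by
      rw [map_residue_map_padicInt, Polynomial.eval_map]
      exact hgζ)
  obtain ⟨θ, hθ, hθx⟩ := hex _ τ (α : AlgebraicClosure k) (by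
    rw [Polynomial.eval_map] at hα
    have h1 := congrArg (padicInt p (AlgebraicClosure k)).subtype hα
    rw [hom_eval₂, map_zero] at h1
    rw [eval₂_map]
    exact h1)
  have hx0 : x ∈ padicInt p L := mem_padicInt_of_eval_eq_zero
    (hg.map (padicInt.map (f.restrictScalars ℚ_[p]))) (by
      rw [eval₂_map] at hx ⊢
      exact hx)
  obtain ⟨b', hb'⟩ := hζ L f θ hθ ⟨residue _ ⟨x, hx0⟩, by
    rw [padicResidueAlgHom_residue, ← hαζ]
    exact congrArg _ (Subtype.ext hθx)⟩
  have hxne : x ≠ 0 := by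
    rintro rfl
    rw [map_zero] at hθx
    apply hζ0
    rw [← hαζ, show α = 0 from Subtype.ext hθx.symm, map_zero]
  have hnorm : (gmMackey k).norm f (gmUnit L (Units.mk0 x hxne)) = gmUnit K w := by
    refine gm_ext fun τ' => Units.ext ?_
    rw [gmEval_norm, Units.coe_prod, gmEval_gmUnit, hw]
    refine Eq.trans ?_ ((hprod τ').trans ?_)
    · rfl
    · rw [hg.natDegree_map, coeff_map]
      simp
  rw [← hnorm, symbol_norm_left, hb', symbol_nsmul_right]

open Polynomial in
/-- For a unit `c ≡ 1`, the symbol `{c, b}` is the difference of two symbols whose first entries are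
norms of roots of monic lifts of the same minimal polynomial. -/
lemma symbol_eq_zero_of_residue_eq_one {N : ℕ} (hN : N ≠ 0) {k' K : FinExt k} (s : k' →ₐ[k] K)
    (c : (padicInt p K)ˣ) (hc : residue (padicInt p K) c = 1) (b : 𝒳.abarMackey.obj K) :
    symbol (gmMackey k) 𝒳.abarMackey N s (gmUnit K (Units.map (padicInt p K).subtype c)) b = 0 := by
  let τ : K →ₐ[k] AlgebraicClosure k := IsAlgClosed.lift
  obtain ⟨ζ, j, hj, hζj, hζ⟩ := 𝒳.exists_res_eq_nsmul hN K τ b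
  let _ : Algebra (K.ResField p) (GeomResidueField p k) :=
    (padicResidueAlgHom p τ).toRingHom.toAlgebra
  have hζ0 : ζ ≠ 0 := by
    rintro rfl
    rw [zero_pow hj.ne'] at hζj
    exact zero_ne_one hζj
  have hint : IsIntegral (K.ResField p) ζ := .of_pow hj (hζj ▸ isIntegral_one)
  obtain ⟨g, hg1, hg2, hg⟩ := exists_monic_lift (minpoly.monic hint)
  have hirr : Irreducible (g.map (residue _)) := hg1 ▸ minpoly.irreducible hint
  have hroot : (g.map (residue _)).eval₂ (padicResidueAlgHom p τ : K.ResField p →+* _) ζ = 0 := by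
    rw [hg1]
    exact minpoly.aeval _ ζ
  have hg0 : ((g.coeff 0 : padicInt p K) : K) ≠ 0 := by
    intro h
    apply minpoly.coeff_zero_ne_zero hint hζ0
    rw [← hg1, coeff_map, show g.coeff 0 = 0 from Subtype.ext h, map_zero]
  let w : Kˣ := Units.mk0 ((-1) ^ g.natDegree * g.coeff 0) (mul_ne_zero (by simp) hg0)
  have h1 := 𝒳.symbol_eq_zero_of_coeff_zero s τ b hζ0 hζ hg hirr hroot w rfl
  -- Changing the constant coefficient by a factor `c` does not change the reduction.
  let d : (padicInt p K)[X] := C ((c - 1) * g.coeff 0)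
  have hdeg : d.degree < g.degree := by
    refine degree_C_le.trans_lt ?_
    rw [← natDegree_pos_iff_degree_pos, hg2]
    exact minpoly.natDegree_pos hint
  have hd : d.map (residue _) = 0 := by
    rw [map_C, map_mul, map_sub, hc, map_one, sub_self, zero_mul, map_zero]
  have hred : (g + d).map (residue _) = g.map (residue _) := by
    rw [Polynomial.map_add, hd, add_zero]
  have h2 := 𝒳.symbol_eq_zero_of_coeff_zero s τ b hζ0 hζ (hg.add_of_left hdeg)
    (hred ▸ hirr) (hred ▸ hroot) (Units.map (padicInt p K).subtype c * w) (by
      rw [natDegree_add_eq_left_of_degree_lt hdeg, coeff_add, coeff_C_zero]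
      simp [w]
      ring)
  rw [gmUnit_mul, map_add, AddMonoidHom.add_apply, h1, add_zero] at h2
  exact h2

/-- Symbols with a unit in the first entry vanish. -/
lemma symbol_eq_zero_of_gmVal_eq_zero (n : ℕ) {k' K : FinExt k} (s : k' →ₐ[k] K)
    (a : (gmMackey k).obj K) (ha : gmVal p K a = 0) (b : 𝒳.abarMackey.obj K) :
    symbol (gmMackey k) 𝒳.abarMackey (p ^ n) s a b = 0 := by
  have hp : p.Prime := Fact.out
  obtain ⟨x, rfl⟩ := exists_gmUnit_eq a
  have hx := spectralNorm_gmUnit_pow (p := p) x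
  rw [ha, neg_zero, zpow_zero, pow_eq_one_iff_of_nonneg (spectralNorm_nonneg _)
    (padicRamification_pos p K).ne'] at hx
  obtain ⟨u, hu⟩ := (padicInt_isUnit_iff (⟨x, hx.le⟩ : padicInt p K)).mpr hx
  have hux : Units.map (padicInt p K).subtype u = x := Units.ext (congrArg Subtype.val hu)
  -- With `q = |𝔽_K|`, the unit `x ^ (q - 1)` is congruent to `1`, and `q - 1` is prime to `p`.
  have hq : 0 < Nat.card (K.ResField p) := Nat.card_pos
  have h1 := 𝒳.symbol_eq_zero_of_residue_eq_one (pow_ne_zero n hp.ne_zero) s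
    (u ^ (Nat.card (K.ResField p) - 1)) (by
      let _ : Fintype (K.ResField p) := Fintype.ofFinite _
      rw [Units.val_pow_eq_pow_val, map_pow, Nat.card_eq_fintype_card]
      exact FiniteField.pow_card_sub_one_eq_one _ ((residue_ne_zero_iff_isUnit _).mpr u.isUnit)) b
  rw [map_pow, hux, gmUnit_pow, map_nsmul, AddMonoidHom.nsmul_apply] at h1
  have h2 := nsmul_symbol (m := p ^ n) s (gmUnit K x) b
  rw [← AddMonoid.addOrderOf_eq_one_iff]
  refine Nat.eq_one_of_dvd_coprimes ?_ (addOrderOf_dvd_of_nsmul_eq_zero h1)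
    (addOrderOf_dvd_of_nsmul_eq_zero h2)
  refine Nat.Coprime.pow_right n ?_
  rw [Nat.coprime_comm, hp.coprime_iff_not_dvd]
  intro h3
  have h4 : p ∣ Nat.card (K.ResField p) := by
    rw [card_padicResidueField]
    exact dvd_pow_self _ (padicResidueDegree_pos p K).ne'
  have h5 := (Nat.dvd_sub h4 h3)
  rw [Nat.sub_sub_self hq] at h5
  exact hp.one_lt.ne' (Nat.dvd_one.mp h5)

/-- Classes in `A / Â` depend only on the residue field. -/
lemma exists_res_eq_of_surjective {K L : FinExt k} (f : K →ₐ[k] L)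
    (hf : Function.Surjective (padicResidueAlgHom p f)) (b : 𝒳.abarMackey.obj L) :
    ∃ b', 𝒳.abarMackey.res f b' = b := by
  let e := AlgEquiv.ofBijective _ ⟨(padicResidueAlgHom p f).injective, hf⟩
  refine ⟨(𝒳.abarEquiv K).symm (AVPoints.map 𝒳.reduction (e.symm : _ →ₐ[_] _) (𝒳.abarEquiv L b)),
    (𝒳.abarEquiv L).injective ?_⟩
  rw [abarEquiv_res, AddEquiv.apply_symm_apply, ← AVPoints.map_comp]
  have h : (padicResidueAlgHom p f).comp (e.symm : L.ResField p →ₐ[_] K.ResField p) =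
      AlgHom.id _ _ := AlgHom.ext fun x => e.apply_symm_apply x
  rw [h, AVPoints.map_id]

/-- Every symbol is of the form `{π, b}_k` for a fixed uniformizer `π` of `k`. -/
lemma exists_symbol_base_eq (n : ℕ) (a : (gmMackey k).obj (FinExt.base k))
    (ha : gmVal p (FinExt.base k) a = 1)
    (z : ((gmMackey k).modNat (p ^ n)).Product (𝒳.abarMackey.modNat (p ^ n)) (FinExt.base k)) :
    ∃ b, symbol (gmMackey k) 𝒳.abarMackey (p ^ n) (AlgHom.id k (FinExt.base k)) a b = z := by
  refine mem_of_symbol_mem (symbol (gmMackey k) 𝒳.abarMackey (p ^ n)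
    (AlgHom.id k (FinExt.base k)) a).range (fun K s a' b => ?_) z
  obtain ⟨K₀, f₁, f₂, hf, hsurj, he, -, -⟩ := exists_unramified_subextension p s
  obtain ⟨b, rfl⟩ := 𝒳.exists_res_eq_of_surjective f₂ hsurj b
  rw [← hf, ← symbol_norm_left]
  -- A uniformizer of `k` is a uniformizer of the unramified extension `K₀`.
  have h1 : gmVal p K₀ ((gmMackey k).res f₁ a) = 1 := by
    rw [gmVal_res (r := 1) f₁ a (by rw [he, one_mul]), ha]
    rfl
  have h2 := 𝒳.symbol_eq_zero_of_gmVal_eq_zero n f₁ ((gmMackey k).norm f₂ a' -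
    gmVal p K₀ ((gmMackey k).norm f₂ a') • (gmMackey k).res f₁ a) (by
      rw [map_sub, map_zsmul, h1, smul_eq_mul, mul_one, sub_self]) b
  rw [map_sub, AddMonoidHom.sub_apply, sub_eq_zero, map_zsmul, AddMonoidHom.zsmul_apply] at h2
  rw [h2]
  refine AddSubgroup.zsmul_mem _ (AddMonoidHom.mem_range.mpr ⟨𝒳.abarMackey.norm f₁ b, ?_⟩) _
  rw [symbol_norm_right, AlgHom.comp_id]

end GoodReduction

end UnitSymbols

theorem lemma3p1 (p : ℕ) [Fact p.Prime] (k : Type u) [Field k] [Algebra ℚ_[p] k]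
    [FiniteDimensional ℚ_[p] k] (A : Over (Spec (.of k))) [GrpObj A] [IsAbelianScheme A]
    (𝒳 : GoodReduction p A) (n : ℕ) (hn : 1 ≤ n) :
    Nonempty (((gmMackey k).modNat (p ^ n)).Product (𝒳.abarMackey.modNat (p ^ n)) (FinExt.base k) ≃+
      𝒳.reductionPoints ⧸ (nsmulAddMonoidHom (α := 𝒳.reductionPoints) (p ^ n)).range) := by
  have : CharZero k := charZero_of_injective_algebraMap (algebraMap ℚ_[p] k).injective
  let Q := 𝒳.reductionPoints ⧸ (nsmulAddMonoidHom (α := 𝒳.reductionPoints) (p ^ n)).range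
  let T : ∀ K : FinExt k, 𝒳.abarMackey.obj K →+ Q := fun K =>
    (QuotientAddGroup.mk' _).comp ((𝒳.reductionTrace K).comp (𝒳.abarEquiv K).toAddMonoidHom)
  have hQ : ∀ q : Q, p ^ n • q = 0 := fun q => by
    induction q using QuotientAddGroup.induction_on with
    | H z => exact (QuotientAddGroup.eq_zero_iff _).mpr ⟨z, rfl⟩
  obtain ⟨Ψ, hΨ⟩ := MackeyFunctor.exists_symbol_lift (k' := FinExt.base k) hQ (M := gmMackey k)
    (N := 𝒳.abarMackey)
    (fun K => (zmultiplesHom (𝒳.abarMackey.obj K →+ Q) (T K)).comp (gmVal p K))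
    (fun {K L} f x y => by
      obtain ⟨s, -, hs⟩ := exists_padicResidueDegree_eq_mul p f
      have h1 : T L (𝒳.abarMackey.res f y) = s • T K y := by
        refine Eq.trans (congrArg QuotientAddGroup.mk ?_)
          (map_nsmul (QuotientAddGroup.mk' _) s (𝒳.reductionTrace K (𝒳.abarEquiv K y)))
        exact (congrArg _ (𝒳.abarEquiv_res f y)).trans (𝒳.reductionTrace_map f hs _)
      change gmVal p K ((gmMackey k).norm f x) • T K y = gmVal p L x • T L (𝒳.abarMackey.res f y)
      rw [h1, gmVal_norm f x hs, mul_comm, mul_smul, natCast_zsmul])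
    (fun {K L} f x y => by
      obtain ⟨r, -, hr⟩ := exists_padicRamification_eq_mul p f
      have h1 : T K (𝒳.abarMackey.norm f y) = r • T L y :=
        Eq.trans (congrArg QuotientAddGroup.mk (𝒳.reductionTrace_abarEquiv_norm f hr y))
          (map_nsmul (QuotientAddGroup.mk' _) r (𝒳.reductionTrace L (𝒳.abarEquiv L y)))
      change gmVal p L ((gmMackey k).res f x) • T L y = gmVal p K x • T K (𝒳.abarMackey.norm f y)
      rw [h1, gmVal_res f x hr, mul_comm, mul_smul, natCast_zsmul])
  obtain ⟨a, ha⟩ := exists_gmVal_eq_one p (FinExt.base k)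
  have hΨa : ∀ b, Ψ (MackeyFunctor.symbol (gmMackey k) 𝒳.abarMackey (p ^ n)
      (AlgHom.id k (FinExt.base k)) a b) = T (FinExt.base k) b := fun b => by
    refine (hΨ _ _ a b).trans ?_
    change gmVal p (FinExt.base k) a • T (FinExt.base k) b = _
    rw [ha, one_smul]
  refine ⟨AddEquiv.ofBijective Ψ ⟨(injective_iff_map_eq_zero Ψ).mpr fun z hz => ?_, fun q => ?_⟩⟩
  · obtain ⟨b, rfl⟩ := 𝒳.exists_symbol_base_eq n a ha z
    rw [hΨa] at hz
    obtain ⟨w, hw⟩ := (QuotientAddGroup.eq_zero_iff _).mp hz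
    obtain ⟨y, rfl⟩ := 𝒳.reductionTrace_base_bijective.2 w
    obtain ⟨b', rfl⟩ := (𝒳.abarEquiv (FinExt.base k)).surjective y
    have hb : p ^ n • b' = b := by
      apply (𝒳.abarEquiv (FinExt.base k)).injective
      apply 𝒳.reductionTrace_base_bijective.1
      rw [map_nsmul, map_nsmul]
      exact hw
    rw [← hb, MackeyFunctor.symbol_nsmul_right]
  · obtain ⟨w, rfl⟩ := QuotientAddGroup.mk_surjective q
    obtain ⟨y, rfl⟩ := 𝒳.reductionTrace_base_bijective.2 w
    obtain ⟨b, rfl⟩ := (𝒳.abarEquiv (FinExt.base k)).surjective y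
    exact ⟨_, hΨa b⟩
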